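/- Notation. Fix $N\ge 0$ and let $V=V_{\bar 0}\oplus V_{\bar 1}$ be a complex vector superspace. Let $Z=(z,\theta^1,\dots,\theta^N)$, $W=(w,\zeta^1,\dots,\zeta^N)$ with $z,w$ even and all $\theta^i,\zeta^j$ odd and anticommuting (and supercommuting with operators on $V$). For $I=\{i_1<\dots<i_k\}\subseteq\{1,\dots,N\}$ put $\theta^I=\theta^{i_1}\cdots\theta^{i_k}$, $Z^{n|I}=z^n\theta^I$, $(Z-W)^{n|I}=(z-w)^n\prod_{i\in I}(\theta^i-\zeta^i)$ (factors in increasing order), let $N\setminus I$ be the complement of $I$ (and write $N$ also for the full index set), define $\sigma(I,J)=\pm1$ by $\theta^I\theta^J=\sigma(I,J)\theta^{I\cup J}$ for disjoint $I,J$, and set $\sigma(I)=\sigma(I,N\setminus I)$. In exponents of $-1$, $I$ stands for $\#I$ and $a$ for the parity of $a$; formulas with such signs are extended bilinearly from homogeneous elements. Put $$\partial_Z^{(j|J)}=\frac{(-1)^{J(J+1)/2}}{j!}\,\partial_z^j\,\partial_{\theta^{j_1}}\cdots\partial_{\theta^{j_k}}\qquad (j\ge 0,\ J=\{j_1<\dots<j_k\}).$$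 $\operatorname{Res}_Z$ is the coefficient of $Z^{-1|N}$ (with $Z$ written to the left), $i_{z,w}$ and $i_{w,z}$ are the expansions in the domains $|z|>|w|$ and $|w|>|z|$, and $\delta(Z,W)=(i_{z,w}-i_{w,z})(Z-W)^{-1|N}$. A field is an $\operatorname{End}V$-valued formal distribution $a(Z)=\sum_{n\in\mathbb Z,\,I}Z^{n|I}a_{n|I}$ with $a(Z)v\in V((Z))=V((z))\otimes\mathbb C[\theta^1,\dots,\theta^N]$ for all $v\in V$; $a_+$ and $a_-$ are its parts with $n\ge0$ and $n<0$. For fields $a,b$ let $$:a(Z)b(Z):\;=a_+(Z)b(Z)+(-1)^{ab}b(Z)a_-(Z),$$ and let the $(j|J)$-product of fields be, for $j\ge0$, $$a(W)_{(j|J)}b(W)=\operatorname{Res}_Z (Z-W)^{j|J}[a(Z),b(W)],$$ and for negative first index $$a(W)_{(-1-j|N\setminus J)}b(W)=\sigma(J)(-1)^{JN}:\!\bigl(\partial_W^{(j|J)}a(W)\bigr)b(W)\!:\qquad(j\ge0),$$ where $[\cdot,\cdot]$ is the supercommutator. An $N_W=N$ SUSY vertex algebra consists of $V$, an even vector $|0\rangle$,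 an even operator $T$, odd operators $S^1,\dots,S^N$ on $V$, and a parity preserving linear map $a\mapsto Y(a,Z)$ from $V$ to the fields, such that $Y(a,Z)|0\rangle\in V[[Z]]$ has the value $a$ at $Z=0$; $T|0\rangle=S^i|0\rangle=0$; $[T,Y(a,Z)]=\partial_zY(a,Z)$, $[S^i,Y(a,Z)]=\partial_{\theta^i}Y(a,Z)$; and for all $a,b$ there is $n\ge 0$ with $(z-w)^n[Y(a,Z),Y(b,W)]=0$. Write $Y(a,Z)=\sum_{j\in\mathbb Z,\,J}Z^{-1-j|N\setminus J}a_{(j|J)}$ and $a_{(j|J)}b=a_{(j|J)}(b)$. Theorem. Let $V$ be an $N_W=N$ SUSY vertex algebra and $a,b\in V$. 1. For all $j\in\mathbb Z$ and $J\subseteq\{1,\dots,N\}$: $\;Y(a_{(j|J)}b,Z)=\sigma(J)\,Y(a,Z)_{(j|J)}Y(b,Z)$. 2. $Y(a_{(-1|N)}b,Z)=\;:Y(a,Z)Y(b,Z):$. 3. $Y(Ta,Z)=\partial_zY(a,Z)$. 4. $Y(S^ia,Z)=\partial_{\theta^i}Y(a,Z)$ for $i=1,\dots,N$. 5. $a_{(j|J)}b=0$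 for all sufficiently large $j$ and all $J$, and, the sums being thus finite, $$[Y(a,Z),Y(b,W)]=\sum_{j\ge0,\,J}\sigma(J)\bigl(\partial_W^{(j|J)}\delta(Z,W)\bigr)Y(a_{(j|J)}b,W)=\sum_{j\ge0,\,J}\bigl((i_{z,w}-i_{w,z})(Z-W)^{-1-j|N\setminus J}\bigr)Y(a_{(j|J)}b,W).$$ -/

import Mathlib

open scoped BigOperators

noncomputable section

namespace SUSYW

/-! ### Grassmann signs and formal superdistributions

Ordered tuples `I = (i₁ < ⋯ < i_k)` of indices in `{1, …, N}` are finsets of `Fin N`. -/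

/-- The sign `σ(I, J)` with `θ^I θ^J = σ(I, J) θ^{I ∪ J}`; it is zero if `I` and `J` meet.
The exponent counts the transpositions that sort the concatenation of `I` and `J`. -/
def sgn {N : ℕ} (I J : Finset (Fin N)) : ℂ :=
  if Disjoint I J then (-1) ^ ((I ×ˢ J).filter fun x => x.2 < x.1).card else 0

/-- `σ(I) = σ(I, N ∖ I)`. -/
def sgnC {N : ℕ} (I : Finset (Fin N)) : ℂ := sgn I Iᶜ

/-- `U`-valued formal distributions `a(Z) = ∑ Z^{n|I} a_{n|I}` in `Z = (z, θ¹, …, θᴺ)`;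
`a n I` is the coefficient `a_{n|I}`, and the odd variables stand to its left. -/
abbrev FormalDist (N : ℕ) (U : Type*) := ℤ → Finset (Fin N) → U

/-- `U`-valued formal distributions `f(Z, W) = ∑ Z^{j|J} W^{k|K} f_{j|J,k|K}` in
`Z = (z, θ¹, …, θᴺ)` and `W = (w, ζ¹, …, ζᴺ)`; `f j J k K` is the coefficient of
`Z^{j|J} W^{k|K}`, in this order. All `θ` and `ζ` anticommute. -/
abbrev FormalDist₂ (N : ℕ) (U : Type*) := ℤ → Finset (Fin N) → ℤ → Finset (Fin N) → U

section Calculus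

variable {N : ℕ} {U : Type*} [AddCommGroup U] [Module ℂ U]

/-- `∂_z`. -/
def dz : Module.End ℂ (FormalDist N U) where
  toFun a := fun n I => ((n : ℂ) + 1) • a (n + 1) I
  map_add' a b := by funext n I; simp
  map_smul' c a := by funext n I; simp [smul_comm c]

/-- The left derivative `∂_{θ^i}`. -/
def dtheta (i : Fin N) : Module.End ℂ (FormalDist N U) where
  toFun a := fun n I => if i ∈ I then 0 else sgn {i} I • a n (insert i I)
  map_add' a b := by funext n I; by_cases h : i ∈ I <;> simp [h]
  map_smul' c a := by funext n I; by_cases h : i ∈ I <;> simp [h, smul_comm c]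

/-- `∂_Z^{(j|J)} = (-1)^{J(J+1)/2} / j! · ∂_z^j ∂_{θ^{j₁}} ⋯ ∂_{θ^{j_k}}`. -/
def dDiv (j : ℕ) (J : Finset (Fin N)) : Module.End ℂ (FormalDist N U) :=
  ((-1 : ℂ) ^ (J.card * (J.card + 1) / 2) / (j.factorial : ℂ)) •
    (dz ^ j * ((J.sort (· ≤ ·)).map dtheta).prod)

/-- `∂_w` on distributions in `Z, W`. -/
def dw₂ : Module.End ℂ (FormalDist₂ N U) where
  toFun f := fun j J k K => ((k : ℂ) + 1) • f j J (k + 1) K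
  map_add' a b := by funext j J k K; simp
  map_smul' c a := by funext j J k K; simp [smul_comm c]

/-- The left derivative `∂_{ζ^i}` on distributions in `Z, W` (it has to pass `θ^J`). -/
def dzeta₂ (i : Fin N) : Module.End ℂ (FormalDist₂ N U) where
  toFun f := fun j J k K =>
    if i ∈ K then 0 else ((-1 : ℂ) ^ J.card * sgn {i} K) • f j J k (insert i K)
  map_add' a b := by funext j J k K; by_cases h : i ∈ K <;> simp [h]
  map_smul' c a := by funext j J k K; by_cases h : i ∈ K <;> simp [h, smul_comm c]

/-- `∂_W^{(j|J)}` on distributions in `Z, W`. -/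
def dDivW₂ (j : ℕ) (J : Finset (Fin N)) : Module.End ℂ (FormalDist₂ N U) :=
  ((-1 : ℂ) ^ (J.card * (J.card + 1) / 2) / (j.factorial : ℂ)) •
    (dw₂ ^ j * ((J.sort (· ≤ ·)).map dzeta₂).prod)

/-- Multiplication by `z - w`. -/
def mulZsubW : Module.End ℂ (FormalDist₂ N U) where
  toFun f := fun j J k K => f (j - 1) J k K - f j J (k - 1) K
  map_add' a b := by funext j J k K; simp only [Pi.add_apply]; abel
  map_smul' c a := by funext j J k K; simp [smul_sub]

/-- Left multiplication by `θ^i`. -/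
def mulTheta (i : Fin N) : Module.End ℂ (FormalDist₂ N U) where
  toFun f := fun j J k K => if i ∈ J then sgn {i} (J.erase i) • f j (J.erase i) k K else 0
  map_add' a b := by funext j J k K; by_cases h : i ∈ J <;> simp [h]
  map_smul' c a := by funext j J k K; by_cases h : i ∈ J <;> simp [h, smul_comm c]

/-- Left multiplication by `ζ^i` (it has to pass `θ^J`). -/
def mulZeta (i : Fin N) : Module.End ℂ (FormalDist₂ N U) where
  toFun f := fun j J k K =>
    if i ∈ K then ((-1 : ℂ) ^ J.card * sgn {i} (K.erase i)) • f j J k (K.erase i) else 0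
  map_add' a b := by funext j J k K; by_cases h : i ∈ K <;> simp [h]
  map_smul' c a := by funext j J k K; by_cases h : i ∈ K <;> simp [h, smul_comm c]

/-- Left multiplication by `(θ - ζ)^J = ∏_{i ∈ J} (θ^i - ζ^i)`, in increasing order. -/
def mulOdd (J : Finset (Fin N)) : Module.End ℂ (FormalDist₂ N U) :=
  ((J.sort (· ≤ ·)).map fun i => mulTheta i - mulZeta i).prod

/-- Left multiplication by `(Z - W)^{j|J} = (z - w)^j (θ - ζ)^J` for `j ≥ 0`. -/
def mulPow (j : ℕ) (J : Finset (Fin N)) : Module.End ℂ (FormalDist₂ N U) :=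
  mulZsubW ^ j * mulOdd J

/-- The super residue `Res_Z`: the coefficient of `Z^{-1|N}`, with `Z` moved to the left. -/
def resZ (f : FormalDist₂ N U) : FormalDist N U := fun k K => f (-1) Finset.univ k K

/-- The product `f(Z, W) c(W)` of a scalar distribution and a distribution in `W`. It is used for
`f` that are homogeneous of some degree `d` in `z, w`, so that for given `j` only the terms
`z^j w^{d-j}` of `f` contribute to the sum over `m`. -/
def mulW (f : FormalDist₂ N ℂ) (c : FormalDist N U) : FormalDist₂ N U := fun j J k K =>
  ∑ A ∈ K.powerset, sgn A (K \ A) • ∑ᶠ m : ℤ, f j J m A • c (k - m) (K \ A)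

end Calculus

/-- `i_{z,w} (z - w)^k`, the expansion in the domain `|z| > |w|`:
`∑_{m ≥ 0} (-1)^m binom(k, m) z^{k-m} w^m`. -/
def expandZW₀ (N : ℕ) (k : ℤ) : FormalDist₂ N ℂ := fun p P q Q =>
  if P = ∅ ∧ Q = ∅ ∧ 0 ≤ q ∧ p + q = k then (-1) ^ q * (Ring.choose k q.toNat : ℤ) else 0

/-- `i_{w,z} (z - w)^k`, the expansion in the domain `|w| > |z|`:
`∑_{m ≥ 0} binom(k, m) z^m (-w)^{k-m}`. -/
def expandWZ₀ (N : ℕ) (k : ℤ) : FormalDist₂ N ℂ := fun p P q Q =>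
  if P = ∅ ∧ Q = ∅ ∧ 0 ≤ p ∧ p + q = k then (-1) ^ q * (Ring.choose k p.toNat : ℤ) else 0

/-- `i_{z,w} (Z - W)^{k|J}` for `k ∈ ℤ`. -/
def expandZW {N : ℕ} (k : ℤ) (J : Finset (Fin N)) : FormalDist₂ N ℂ :=
  mulOdd J (expandZW₀ N k)

/-- `i_{w,z} (Z - W)^{k|J}` for `k ∈ ℤ`. -/
def expandWZ {N : ℕ} (k : ℤ) (J : Finset (Fin N)) : FormalDist₂ N ℂ :=
  mulOdd J (expandWZ₀ N k)

/-- The formal super delta function `δ(Z, W) = (i_{z,w} - i_{w,z}) (Z - W)^{-1|N}`. -/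
def superDelta (N : ℕ) : FormalDist₂ N ℂ :=
  expandZW (-1) Finset.univ - expandWZ (-1) Finset.univ

/-! ### Operators on a vector superspace -/

/-- `(-1)^{pq}` for parities `p, q`. -/
def ksign (p q : ZMod 2) : ℂ := (-1) ^ (p.val * q.val)

section Super

variable {N : ℕ} {V : Type*} [AddCommGroup V] [Module ℂ V]
  (𝒱 : ZMod 2 → Submodule ℂ V) [DirectSum.Decomposition 𝒱]

/-- The projection of a superspace to its component of parity `p`. -/
def proj (p : ZMod 2) : Module.End ℂ V :=
  (𝒱 p).subtype ∘ₗ DirectSum.component ℂ (ZMod 2) (fun i => 𝒱 i) p ∘ₗ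
    (DirectSum.decomposeLinearEquiv 𝒱).toLinearMap

/-- The component of parity `r` of an operator on a superspace. -/
def opPart (r : ZMod 2) (A : Module.End ℂ V) : Module.End ℂ V :=
  ∑ p : ZMod 2, proj 𝒱 (p + r) * A * proj 𝒱 p

/-- The operator `A'` with `A θ^K = θ^K A'`, where `K` has `k` elements: the odd part of `A`
changes its sign `k` times. -/
def koszul (k : ℕ) (A : Module.End ℂ V) : Module.End ℂ V :=
  opPart 𝒱 0 A + (-1 : ℂ) ^ k • opPart 𝒱 1 A

/-- The component of parity `p` of an `End V`-valued distribution: `θ^I A` has parity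
`#I + p(A)`. -/
def distPart (p : ZMod 2) (a : FormalDist N (Module.End ℂ V)) :
    FormalDist N (Module.End ℂ V) :=
  fun n I => opPart 𝒱 (p + (I.card : ZMod 2)) (a n I)

/-- The product `a(Z) b(W)`. -/
def prodZW (a b : FormalDist N (Module.End ℂ V)) : FormalDist₂ N (Module.End ℂ V) :=
  fun j J k K => koszul 𝒱 K.card (a j J) * b k K

/-- The product `b(W) a(Z)`, rewritten with `Z` to the left of `W`. -/
def prodWZ (b a : FormalDist N (Module.End ℂ V)) : FormalDist₂ N (Module.End ℂ V) :=
  fun j J k K => (-1 : ℂ) ^ (J.card * K.card) • (koszul 𝒱 J.card (b k K) * a j J)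

/-- The supercommutator `[a(Z), b(W)] = a(Z) b(W) - (-1)^{ab} b(W) a(Z)`, extended bilinearly
from homogeneous distributions. -/
def superComm (a b : FormalDist N (Module.End ℂ V)) : FormalDist₂ N (Module.End ℂ V) :=
  ∑ p : ZMod 2, ∑ q : ZMod 2,
    (prodZW 𝒱 (distPart 𝒱 p a) (distPart 𝒱 q b) -
      ksign p q • prodWZ 𝒱 (distPart 𝒱 q b) (distPart 𝒱 p a))

/-- The supercommutator `[D, a(Z)] = D a(Z) - (-1)^{Da} a(Z) D` of an operator and a
distribution, extended bilinearly from homogeneous ones. -/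
def opComm (D : Module.End ℂ V) (a : FormalDist N (Module.End ℂ V)) :
    FormalDist N (Module.End ℂ V) := fun n I =>
  ∑ p : ZMod 2, ∑ q : ZMod 2,
    (koszul 𝒱 I.card (opPart 𝒱 p D) * distPart 𝒱 q a n I -
      ksign p q • (distPart 𝒱 q a n I * opPart 𝒱 p D))

/-- The `End V`-valued fields: distributions with `a(Z) v ∈ V((Z))` for all `v`. -/
def fields (N : ℕ) (V : Type*) [AddCommGroup V] [Module ℂ V] :
    Submodule ℂ (FormalDist N (Module.End ℂ V)) where
  carrier := {a | ∀ v, ∃ n₀ : ℤ, ∀ n < n₀, ∀ I, a n I v = 0}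
  zero_mem' v := ⟨0, fun n _ I => by simp⟩
  add_mem' {a b} ha hb v := by
    obtain ⟨n₁, h₁⟩ := ha v
    obtain ⟨n₂, h₂⟩ := hb v
    refine ⟨min n₁ n₂, fun n hn I => ?_⟩
    simp [h₁ n (lt_of_lt_of_le hn (min_le_left _ _)) I,
      h₂ n (lt_of_lt_of_le hn (min_le_right _ _)) I]
  smul_mem' c a ha v := by
    obtain ⟨n₁, h₁⟩ := ha v
    exact ⟨n₁, fun n hn I => by simp [h₁ n hn I]⟩

/-- A family of operators is locally finite if it is finite on every vector. -/
def LocFinite (f : ℤ → Module.End ℂ V) : Prop := ∀ v, {m | f m v ≠ 0}.Finite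

open Classical in
/-- The sum of a locally finite family of operators. -/
def locSum (f : ℤ → Module.End ℂ V) : Module.End ℂ V :=
  if h : LocFinite f then
    { toFun := fun v => ∑ᶠ m, f m v
      map_add' := fun v w => by
        simp only [map_add]
        exact finsum_add_distrib (h v) (h w)
      map_smul' := fun c v => by
        simp only [map_smul, RingHom.id_apply]
        exact (smul_finsum' c (h v)).symm }
  else 0

/-- The product `a(Z) b(Z)` in one variable. The sums over `m` are locally finite in the two cases
where it is used, `a_+(Z) b(Z)` and `b(Z) a_-(Z)` for fields `a` and `b`, see
`locFinite_pos_mul` and `locFinite_mul_neg`. -/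
def mulSame (a b : FormalDist N (Module.End ℂ V)) : FormalDist N (Module.End ℂ V) :=
  fun n K => ∑ A ∈ K.powerset, sgn A (K \ A) •
    locSum fun m : ℤ => koszul 𝒱 (K \ A).card (a m A) * b (n - m) (K \ A)

/-- `a_+(Z)`: the terms with `z^n`, `n ≥ 0`. -/
def posPart (a : FormalDist N (Module.End ℂ V)) : FormalDist N (Module.End ℂ V) :=
  fun n I => if 0 ≤ n then a n I else 0

/-- `a_-(Z)`: the terms with `z^n`, `n < 0`. -/
def negPart (a : FormalDist N (Module.End ℂ V)) : FormalDist N (Module.End ℂ V) :=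
  fun n I => if n < 0 then a n I else 0

/-- The normally ordered product `:a(Z) b(Z): = a_+(Z) b(Z) + (-1)^{ab} b(Z) a_-(Z)`, extended
bilinearly from homogeneous fields. -/
def normalOrd (a b : FormalDist N (Module.End ℂ V)) : FormalDist N (Module.End ℂ V) :=
  ∑ p : ZMod 2, ∑ q : ZMod 2,
    (mulSame 𝒱 (posPart (distPart 𝒱 p a)) (distPart 𝒱 q b) +
      ksign p q • mulSame 𝒱 (distPart 𝒱 q b) (negPart (distPart 𝒱 p a)))

/-- The `(j|J)`-product `a(W)_{(j|J)} b(W)` of two fields: `Res_Z (Z - W)^{j|J} [a(Z), b(W)]` for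
`j ≥ 0`, and `a_{(-1-m|N∖K)} b = σ(K) (-1)^{KN} :(∂^{(m|K)} a) b:` for `j = -1 - m < 0`. -/
def fieldProd (a b : FormalDist N (Module.End ℂ V)) (j : ℤ) (J : Finset (Fin N)) :
    FormalDist N (Module.End ℂ V) :=
  match j with
  | Int.ofNat j => resZ (mulPow j J (superComm 𝒱 a b))
  | Int.negSucc m =>
      (sgnC Jᶜ * (-1 : ℂ) ^ (Jᶜ.card * N)) • normalOrd 𝒱 (dDiv m Jᶜ a) b

end Super

/-! ### The sums in the normally ordered product are locally finite -/

section WellDefined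

variable {N : ℕ} {V : Type*} [AddCommGroup V] [Module ℂ V]
  (𝒱 : ZMod 2 → Submodule ℂ V) [DirectSum.Decomposition 𝒱]

theorem distPart_mem_fields (p : ZMod 2) {a : FormalDist N (Module.End ℂ V)}
    (ha : a ∈ fields N V) : distPart 𝒱 p a ∈ fields N V := by
  intro v
  choose f hf using fun r : ZMod 2 => ha (proj 𝒱 r v)
  refine ⟨min (f 0) (f 1), fun n hn I => ?_⟩
  have h0 : ∀ r : ZMod 2, a n I (proj 𝒱 r v) = 0 := by
    intro r
    refine hf r n (lt_of_lt_of_le hn ?_) I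
    fin_cases r
    · exact min_le_left _ _
    · exact min_le_right _ _
  simp [distPart, opPart, LinearMap.sum_apply, h0]

theorem locFinite_pos_mul (k : ℕ) (n : ℤ) (A B : Finset (Fin N))
    (a : FormalDist N (Module.End ℂ V)) {b : FormalDist N (Module.End ℂ V)}
    (hb : b ∈ fields N V) :
    LocFinite fun m : ℤ => koszul 𝒱 k (posPart a m A) * b (n - m) B := by
  intro v
  obtain ⟨n₀, h⟩ := hb v
  refine (Set.finite_Icc (0 : ℤ) (n - n₀)).subset fun m hm => ?_
  by_contra hc
  apply hm
  by_cases h0 : 0 ≤ m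
  · have : n - m < n₀ := by
      by_contra h'
      exact hc ⟨h0, by omega⟩
    simp [h _ this B]
  · simp [posPart, h0, koszul, opPart]

theorem locFinite_mul_neg (k : ℕ) (n : ℤ) (A B : Finset (Fin N))
    (b : FormalDist N (Module.End ℂ V)) {a : FormalDist N (Module.End ℂ V)}
    (ha : a ∈ fields N V) :
    LocFinite fun m : ℤ => koszul 𝒱 k (b m A) * negPart a (n - m) B := by
  intro v
  obtain ⟨n₀, h⟩ := ha v
  refine (Set.finite_Icc n (n - n₀)).subset fun m hm => ?_
  by_contra hc
  apply hm
  by_cases h0 : n - m < 0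
  · have : n - m < n₀ := by
      by_contra h'
      exact hc ⟨by omega, by omega⟩
    have h1 : negPart a (n - m) B v = 0 := by
      simp only [negPart, if_pos h0]
      exact h _ this B
    simp only [Module.End.mul_apply, h1, map_zero]
  · simp [negPart, h0]

end WellDefined

/-! ### SUSY vertex algebras -/

/-- An `N_W = N` SUSY vertex algebra structure on the vector superspace `V = 𝒱 0 ⊕ 𝒱 1`. -/
structure SUSYVertexAlgebra (N : ℕ) {V : Type*} [AddCommGroup V] [Module ℂ V]
    (𝒱 : ZMod 2 → Submodule ℂ V) [DirectSum.Decomposition 𝒱] where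
  /-- the vacuum vector -/
  vac : V
  /-- the even translation operator -/
  T : Module.End ℂ V
  /-- the odd translation operators -/
  S : Fin N → Module.End ℂ V
  /-- the state-field correspondence -/
  Y : V →ₗ[ℂ] fields N V
  vac_even : vac ∈ 𝒱 0
  T_even : ∀ p, ∀ v ∈ 𝒱 p, T v ∈ 𝒱 p
  S_odd : ∀ i p, ∀ v ∈ 𝒱 p, S i v ∈ 𝒱 (p + 1)
  /-- `Y` preserves parity, where `θ^I A` has parity `#I + p(A)`. -/
  Y_parity : ∀ p, ∀ a ∈ 𝒱 p, ∀ n I q, ∀ v ∈ 𝒱 q,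
    (Y a : FormalDist N (Module.End ℂ V)) n I v ∈ 𝒱 (p + (I.card : ZMod 2) + q)
  /-- `Y(a, Z)|0⟩ ∈ V[[Z]]` -/
  vacuum_regular : ∀ a, ∀ n < 0, ∀ I,
    (Y a : FormalDist N (Module.End ℂ V)) n I vac = 0
  /-- `Y(a, Z)|0⟩` has the value `a` at `Z = 0`. -/
  vacuum_value : ∀ a, (Y a : FormalDist N (Module.End ℂ V)) 0 ∅ vac = a
  T_vac : T vac = 0
  S_vac : ∀ i, S i vac = 0
  /-- `[T, Y(a, Z)] = ∂_z Y(a, Z)` -/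
  T_comm : ∀ a, opComm 𝒱 T (Y a : FormalDist N (Module.End ℂ V)) =
    dz (Y a : FormalDist N (Module.End ℂ V))
  /-- `[S^i, Y(a, Z)] = ∂_{θ^i} Y(a, Z)` -/
  S_comm : ∀ i a, opComm 𝒱 (S i) (Y a : FormalDist N (Module.End ℂ V)) =
    dtheta i (Y a : FormalDist N (Module.End ℂ V))
  /-- `(z - w)^n [Y(a, Z), Y(b, W)] = 0` for some `n` -/
  locality : ∀ a b, ∃ n : ℕ, (mulZsubW ^ n) (superComm 𝒱 (Y a : FormalDist N (Module.End ℂ V))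
    (Y b : FormalDist N (Module.End ℂ V))) = 0

namespace SUSYVertexAlgebra

variable {N : ℕ} {V : Type*} [AddCommGroup V] [Module ℂ V]
  {𝒱 : ZMod 2 → Submodule ℂ V} [DirectSum.Decomposition 𝒱] (X : SUSYVertexAlgebra N 𝒱)

/-- The superfield `Y(a, Z)` as a formal distribution. -/
def field (a : V) : FormalDist N (Module.End ℂ V) := X.Y a

/-- The product `a_{(j|J)} b`, where `Y(a, Z) = ∑ Z^{-1-j|N∖J} a_{(j|J)}`. -/
def prod (a : V) (j : ℤ) (J : Finset (Fin N)) (b : V) : V := X.field a (-1 - j) Jᶜ b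

end SUSYVertexAlgebra

end SUSYW

end

open SUSYW

/-! Everything is reduced to the fields at θ = 0. These have translation covariance, locality and
the vacuum property, so they form an ordinary vertex superalgebra. Goddard's argument
(`IsLocalField.eq_evenField`) shows that a field local with respect to all of them and translation
covariant on the vacuum is determined by its value on the vacuum at z = 0. Since (z - w)^n involves
no odd variables, each θ^I-component of Y(a, Z) is such a field, and hence is the θ = 0 field of the
vector Y(a, Z)_{0|I}|0⟩ (`field_eq_evenField`). On the vacuum S^i acts as ∂_{θ^i}, so these vectors
are determined by the one with I = ∅. This gives the recognition criterion `eq_field_of_components`: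
a superdistribution is Y(u_∅, Z) once its components are θ = 0 fields of vectors u_K that satisfy
the S-relation.

The criterion gives parts 3 and 4 directly. For products the even input is `evenField_residue` and
`evenField_normalOrd`: residues of (z - w)^n [a(z), b(w)] and normally ordered products are local by
Dong's lemma (`wSubX₃_pow_eq_zero`), so Goddard's argument identifies them. The S-relation for the
corresponding superproducts is a Leibniz rule. For residues it uses that ∂_θ + ∂_ζ annihilates θ -
ζ, and that the top coefficient in θ of a θ-derivative is zero. A product with negative first index
is a normally ordered product of a derivative, and this derivative is again some Y(a', Z).

Part 5 is the decomposition theorem. A distribution killed by a power of z - w vanishes if all its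
residues against (Z - W)^{m|I} do (`eq_zero_of_resZ`). The proposed right-hand side is local, and
`resZ_mulPow_mulWDeg` says that its terms are dual to these residues, so part 1 for j ≥ 0 shows that
both sides have the same residues. The two forms of the sum agree by `sgnC_smul_dDivW₂_superDelta`.
-/

noncomputable section

namespace SUSYW

/-! ### Signs -/

section Signs

variable {N : ℕ}

/-- The sign `(-1)^k`, where `k` is the number of elements of `A` below `i`. -/
def eps (i : Fin N) (A : Finset (Fin N)) : ℂ := (-1) ^ (A.filter (· < i)).card

@[simp] theorem eps_empty (i : Fin N) : eps i ∅ = 1 := by simp [eps]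

@[simp] theorem eps_mul_self (i : Fin N) (A : Finset (Fin N)) : eps i A * eps i A = 1 := by
  rw [eps, ← mul_pow]; simp

theorem eps_ne_zero (i : Fin N) (A : Finset (Fin N)) : eps i A ≠ 0 := by simp [eps]

theorem eps_insert {i j : Fin N} {A : Finset (Fin N)} (h : j ∉ A) :
    eps i (insert j A) = (if j < i then -1 else 1) * eps i A := by
  unfold eps
  rw [Finset.filter_insert]
  split_ifs with hji
  · rw [Finset.card_insert_of_notMem (by simp [h]), pow_succ]; ring
  · simp

theorem eps_insert_self (i : Fin N) (A : Finset (Fin N)) : eps i (insert i A) = eps i A := by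
  unfold eps
  rw [Finset.filter_insert, if_neg (lt_irrefl i)]

theorem eps_erase {i j : Fin N} {A : Finset (Fin N)} (h : j ∈ A) :
    eps i (A.erase j) = (if j < i then -1 else 1) * eps i A := by
  conv_rhs => rw [← Finset.insert_erase h, eps_insert (Finset.notMem_erase j A)]
  split_ifs <;> ring

theorem eps_erase_self (i : Fin N) (A : Finset (Fin N)) : eps i (A.erase i) = eps i A := by
  by_cases h : i ∈ A
  · rw [eps_erase h]; simp
  · rw [Finset.erase_eq_of_notMem h]

theorem eps_union {i : Fin N} {A B : Finset (Fin N)} (h : Disjoint A B) :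
    eps i (A ∪ B) = eps i A * eps i B := by
  unfold eps
  rw [Finset.filter_union, Finset.card_union_of_disjoint
    (Finset.disjoint_filter_filter h), pow_add]

/-- Exactly one of i < j and j < i holds. This one sign is the source of the anticommutation
relations below. -/
theorem eps_swap {i j : Fin N} (h : i ≠ j) :
    (if j < i then -1 else 1 : ℂ) = - (if i < j then -1 else 1) := by
  rcases lt_or_gt_of_ne h with h' | h'
  · simp [h', not_lt.mpr h'.le]
  · simp [h', not_lt.mpr h'.le]

theorem sgn_singleton {i : Fin N} {A : Finset (Fin N)} (h : i ∉ A) : sgn {i} A = eps i A := by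
  unfold sgn eps
  rw [if_pos (by simpa using h)]
  congr 1
  refine Finset.card_bij (fun x _ => x.2) ?_ ?_ ?_
  · rintro ⟨x, y⟩ hx
    simp only [Finset.mem_filter, Finset.mem_product, Finset.mem_singleton] at hx ⊢
    obtain ⟨⟨rfl, h1⟩, h2⟩ := hx
    exact ⟨h1, h2⟩
  · rintro ⟨x, y⟩ hx ⟨x', y'⟩ hx' hxy
    simp only [Finset.mem_filter, Finset.mem_product, Finset.mem_singleton] at hx hx' hxy
    rw [hx.1.1, hx'.1.1, hxy]
  · intro b hb
    simp at hb
    exact ⟨(i, b), by simp [hb], rfl⟩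

theorem sgn_erase (i : Fin N) (A : Finset (Fin N)) : sgn {i} (A.erase i) = eps i A := by
  rw [sgn_singleton (Finset.notMem_erase i A), eps_erase_self]

/-- The new inversions are the pairs (i, y) with y in B below i. No disjointness of A and B is
needed, since otherwise both sides are zero. -/
theorem sgn_insert_left {i : Fin N} {A B : Finset (Fin N)} (hA : i ∉ A) (hB : i ∉ B) :
    sgn (insert i A) B = eps i B * sgn A B := by
  by_cases hd : Disjoint A B
  · have hd' : Disjoint (insert i A) B := by simp [hd, hB]
    rw [← sgn_singleton hB]
    unfold sgn
    rw [if_pos hd, if_pos hd', if_pos (by simpa using hB), ← pow_add]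
    congr 1
    rw [← Finset.card_union_of_disjoint]
    · congr 1
      ext ⟨x, y⟩
      simp only [Finset.mem_filter, Finset.mem_product, Finset.mem_insert, Finset.mem_union,
        Finset.mem_singleton]
      tauto
    · rw [Finset.disjoint_left]
      rintro ⟨x, y⟩ h1 h2
      simp only [Finset.mem_filter, Finset.mem_product, Finset.mem_singleton] at h1 h2
      exact hA (h1.1.1 ▸ h2.1.1)
  · have hd' : ¬ Disjoint (insert i A) B := by simp [hd]
    simp [sgn, hd, hd']

@[simp] theorem sgn_empty_left (A : Finset (Fin N)) : sgn ∅ A = 1 := by simp [sgn]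

@[simp] theorem sgn_empty_right (A : Finset (Fin N)) : sgn A ∅ = 1 := by simp [sgn]

/-- The new inversions come from the elements of A above i, and their number is `A.card` minus the
number below i. -/
theorem sgn_insert_right {i : Fin N} {A B : Finset (Fin N)} (hA : i ∉ A) (hB : i ∉ B) :
    sgn A (insert i B) = (-1) ^ A.card * eps i A * sgn A B := by
  induction A using Finset.induction_on with
  | empty => simp
  | insert j A hj ih =>
    rw [Finset.mem_insert, not_or] at hA
    by_cases hjB : j ∈ B
    · have h1 : ¬ Disjoint (insert j A) (insert i B) := by simp [hjB]
      have h2 : ¬ Disjoint (insert j A) B := by simp [hjB]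
      simp [sgn, h1, h2]
    · have hji : j ∉ ({i} : Finset (Fin N)) := by simpa using Ne.symm hA.1
      rw [sgn_insert_left hj (by simp [hjB, Ne.symm hA.1]), ih hA.2, sgn_insert_left hj hjB,
        eps_insert hB, eps_insert hj, Finset.card_insert_of_notMem hj, eps_swap (Ne.symm hA.1), pow_succ]
      ring

/-- For disjoint sets each pair in A × B is an inversion in exactly one of the two orders. -/
theorem sgn_comm {A B : Finset (Fin N)} : sgn B A = (-1) ^ (A.card * B.card) * sgn A B := by
  by_cases hd : Disjoint A B
  · induction A using Finset.induction_on with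
    | empty => simp
    | insert j A hj ih =>
      rw [Finset.disjoint_insert_left] at hd
      rw [sgn_insert_right hd.1 hj, ih hd.2, sgn_insert_left hj hd.1,
        Finset.card_insert_of_notMem hj, Nat.succ_mul, pow_add]
      ring
  · have hd' : ¬ Disjoint B A := fun h => hd h.symm
    simp [sgn, hd, hd']

theorem sgn_mul_self {A B : Finset (Fin N)} (h : Disjoint A B) : sgn A B * sgn A B = 1 := by
  unfold sgn
  rw [if_pos h, ← mul_pow]; simp

theorem sgn_eq_zero {A B : Finset (Fin N)} (h : ¬ Disjoint A B) : sgn A B = 0 := by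
  simp [sgn, h]

theorem sgnC_mul_self (J : Finset (Fin N)) : sgnC J * sgnC J = 1 :=
  sgn_mul_self disjoint_compl_right

theorem sgnC_compl_mul (J : Finset (Fin N)) :
    sgnC J * sgnC Jᶜ = (-1) ^ (J.card * Jᶜ.card) := by
  unfold sgnC
  rw [compl_compl, sgn_comm (A := J) (B := Jᶜ)]
  rw [mul_comm, mul_assoc, sgn_mul_self disjoint_compl_right, mul_one]

theorem negOne_pow_sq (n : ℕ) : (-1 : ℂ) ^ n * (-1) ^ n = 1 := by
  rw [← mul_pow]; simp

end Signs

/-! ### The Grassmann calculus of the odd variables -/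

section Grassmann

variable {N : ℕ} {U : Type*} [AddCommGroup U] [Module ℂ U]

theorem mulTheta_apply (i : Fin N) (f : FormalDist₂ N U) (j : ℤ) (J : Finset (Fin N)) (k : ℤ)
    (K : Finset (Fin N)) :
    mulTheta i f j J k K = if i ∈ J then eps i J • f j (J.erase i) k K else 0 := by
  simp [mulTheta, sgn_erase]

theorem mulZeta_apply (i : Fin N) (f : FormalDist₂ N U) (j : ℤ) (J : Finset (Fin N)) (k : ℤ)
    (K : Finset (Fin N)) :
    mulZeta i f j J k K =
      if i ∈ K then ((-1 : ℂ) ^ J.card * eps i K) • f j J k (K.erase i) else 0 := by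
  simp [mulZeta, sgn_erase]

theorem dzeta₂_apply (i : Fin N) (f : FormalDist₂ N U) (j : ℤ) (J : Finset (Fin N)) (k : ℤ)
    (K : Finset (Fin N)) :
    dzeta₂ i f j J k K =
      if i ∈ K then 0 else ((-1 : ℂ) ^ J.card * eps i K) • f j J k (insert i K) := by
  by_cases h : i ∈ K
  · simp [dzeta₂, h]
  · simp [dzeta₂, h, sgn_singleton h]

theorem dtheta_apply (i : Fin N) (a : FormalDist N U) (n : ℤ) (I : Finset (Fin N)) :
    dtheta i a n I = if i ∈ I then 0 else eps i I • a n (insert i I) := by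
  by_cases h : i ∈ I
  · simp [dtheta, h]
  · simp [dtheta, h, sgn_singleton h]

/-- The left derivative `∂_{θ^i}` on distributions in `Z, W`. -/
def dtheta₂ (i : Fin N) : Module.End ℂ (FormalDist₂ N U) where
  toFun f := fun j J k K => if i ∈ J then 0 else eps i J • f j (insert i J) k K
  map_add' a b := by funext j J k K; by_cases h : i ∈ J <;> simp [h]
  map_smul' c a := by funext j J k K; by_cases h : i ∈ J <;> simp [h, smul_comm c]

theorem dtheta₂_apply (i : Fin N) (f : FormalDist₂ N U) (j : ℤ) (J : Finset (Fin N)) (k : ℤ)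
    (K : Finset (Fin N)) :
    dtheta₂ i f j J k K = if i ∈ J then 0 else eps i J • f j (insert i J) k K := rfl

theorem card_erase_sign {i : Fin N} {J : Finset (Fin N)} (h : i ∈ J) :
    (-1 : ℂ) ^ (J.erase i).card = - (-1) ^ J.card := by
  conv_rhs => rw [← Finset.insert_erase h, Finset.card_insert_of_notMem (Finset.notMem_erase i J)]
  rw [pow_succ]; ring

theorem card_insert_sign {i : Fin N} {J : Finset (Fin N)} (h : i ∉ J) :
    (-1 : ℂ) ^ (insert i J).card = - (-1) ^ J.card := by
  rw [Finset.card_insert_of_notMem h, pow_succ]; ring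

/-- This and the next six relations are the Clifford relations of θ, ζ, ∂_θ and ∂_ζ; the identities
for θ - ζ are derived from them without returning to coefficients. -/
theorem mulTheta_anticomm (i j : Fin N) (f : FormalDist₂ N U) :
    mulTheta i (mulTheta j f) = - mulTheta j (mulTheta i f) := by
  funext p P q Q
  simp only [Pi.neg_apply, mulTheta_apply, Finset.mem_erase]
  by_cases hij : i = j
  · subst hij; simp
  · by_cases hi : i ∈ P <;> by_cases hj : j ∈ P <;> simp [hi, hj, hij, Ne.symm hij]
    rw [eps_erase hi, eps_erase hj, Finset.erase_right_comm, smul_smul, smul_smul, ← neg_smul,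
      eps_swap hij]
    congr 1; ring

theorem mulZeta_anticomm (i j : Fin N) (f : FormalDist₂ N U) :
    mulZeta i (mulZeta j f) = - mulZeta j (mulZeta i f) := by
  funext p P q Q
  simp only [Pi.neg_apply, mulZeta_apply, Finset.mem_erase]
  by_cases hij : i = j
  · subst hij; simp
  · by_cases hi : i ∈ Q <;> by_cases hj : j ∈ Q <;> simp [hi, hj, hij, Ne.symm hij]
    rw [eps_erase hi, eps_erase hj, Finset.erase_right_comm, smul_smul, smul_smul, ← neg_smul,
      eps_swap hij]
    congr 1; ring

theorem mulTheta_mulZeta (i j : Fin N) (f : FormalDist₂ N U) :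
    mulTheta i (mulZeta j f) = - mulZeta j (mulTheta i f) := by
  funext p P q Q
  simp only [Pi.neg_apply, mulZeta_apply, mulTheta_apply]
  by_cases hi : i ∈ P <;> by_cases hj : j ∈ Q <;> simp [hi, hj]
  rw [← Finset.card_erase_of_mem hi, card_erase_sign hi, smul_smul, smul_smul, ← neg_smul]
  congr 1; ring

theorem dtheta₂_mulTheta (i j : Fin N) (f : FormalDist₂ N U) :
    dtheta₂ i (mulTheta j f) = (if i = j then f else 0) - mulTheta j (dtheta₂ i f) := by
  funext p P q Q
  by_cases hij : i = j
  · subst hij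
    by_cases hi : i ∈ P
    · simp [dtheta₂_apply, mulTheta_apply, hi, smul_smul, eps_erase_self]
    · simp [dtheta₂_apply, mulTheta_apply, hi, smul_smul, eps_insert_self]
  · by_cases hi : i ∈ P <;> by_cases hj : j ∈ P <;>
      simp [dtheta₂_apply, mulTheta_apply, hi, hj, hij, Ne.symm hij]
    rw [eps_erase hj, eps_insert hi, Finset.erase_insert_of_ne hij, smul_smul, smul_smul,
      ← neg_smul, eps_swap hij]
    congr 1; ring

theorem dzeta₂_mulZeta (i j : Fin N) (f : FormalDist₂ N U) :
    dzeta₂ i (mulZeta j f) = (if i = j then f else 0) - mulZeta j (dzeta₂ i f) := by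
  funext p P q Q
  by_cases hij : i = j
  · subst hij
    by_cases hi : i ∈ Q
    · simp [dzeta₂_apply, mulZeta_apply, hi, smul_smul, eps_erase_self]
      rw [mul_mul_mul_comm]; simp [negOne_pow_sq]
    · simp [dzeta₂_apply, mulZeta_apply, hi, smul_smul, eps_insert_self]
      rw [mul_mul_mul_comm]; simp [negOne_pow_sq]
  · by_cases hi : i ∈ Q <;> by_cases hj : j ∈ Q <;>
      simp [dzeta₂_apply, mulZeta_apply, hi, hj, hij, Ne.symm hij]
    rw [eps_erase hj, eps_insert hi, Finset.erase_insert_of_ne hij, smul_smul, smul_smul,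
      ← neg_smul, eps_swap hij]
    congr 1; ring

theorem dtheta₂_mulZeta (i j : Fin N) (f : FormalDist₂ N U) :
    dtheta₂ i (mulZeta j f) = - mulZeta j (dtheta₂ i f) := by
  funext p P q Q
  by_cases hi : i ∈ P <;> by_cases hj : j ∈ Q <;>
    simp [dtheta₂_apply, mulZeta_apply, hi, hj]
  rw [← Finset.card_insert_of_notMem hi, card_insert_sign hi, smul_smul, smul_smul, ← neg_smul]
  congr 1; ring

theorem dzeta₂_mulTheta (i j : Fin N) (f : FormalDist₂ N U) :
    dzeta₂ i (mulTheta j f) = - mulTheta j (dzeta₂ i f) := by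
  funext p P q Q
  by_cases hi : i ∈ Q <;> by_cases hj : j ∈ P <;>
    simp [dzeta₂_apply, mulTheta_apply, hi, hj]
  rw [← Finset.card_erase_of_mem hj, card_erase_sign hj, smul_smul, smul_smul, ← neg_smul]
  congr 1; ring

/-- Left multiplication by `θ^i - ζ^i`. -/
def mulChi (i : Fin N) : Module.End ℂ (FormalDist₂ N U) := mulTheta i - mulZeta i

theorem mulChi_apply (i : Fin N) (f : FormalDist₂ N U) :
    mulChi i f = mulTheta i f - mulZeta i f := rfl

theorem mulChi_anticomm (i j : Fin N) (f : FormalDist₂ N U) :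
    mulChi i (mulChi j f) = - mulChi j (mulChi i f) := by
  simp only [mulChi_apply, map_sub]
  rw [mulTheta_anticomm i j, mulZeta_anticomm i j, mulTheta_mulZeta i j, mulTheta_mulZeta j i]
  abel

theorem mulChi_self (i : Fin N) (f : FormalDist₂ N U) : mulChi i (mulChi i f) = 0 := by
  -- Anticommuting with itself only gives 2χ² = 0; division by 2 finishes.
  have h : (2 : ℂ) • mulChi i (mulChi i f) = 0 := by
    rw [two_smul]
    nth_rewrite 1 [mulChi_anticomm i i f]
    exact neg_add_cancel _
  exact (smul_eq_zero.mp h).resolve_left two_ne_zero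

theorem mulChi_mulZeta (i j : Fin N) (f : FormalDist₂ N U) :
    mulChi i (mulZeta j f) = - mulZeta j (mulChi i f) := by
  simp only [mulChi_apply, map_sub]
  rw [mulTheta_mulZeta i j, mulZeta_anticomm i j]
  abel

theorem mulOdd_empty (f : FormalDist₂ N U) : mulOdd ∅ f = f := by
  simp [mulOdd]

/-- A new minimum becomes the head of the sorted list, so no sign arises. For this reason the
inductions over odd products add minima. -/
theorem mulOdd_insert_min {i : Fin N} {A : Finset (Fin N)} (h : ∀ x ∈ A, i < x)
    (f : FormalDist₂ N U) : mulOdd (insert i A) f = mulChi i (mulOdd A f) := by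
  have hi : i ∉ A := fun hi => lt_irrefl _ (h i hi)
  unfold mulOdd
  rw [Finset.sort_insert (r := (· ≤ ·)) (fun x hx => (h x hx).le) hi]
  rfl

theorem induction_min {P : Finset (Fin N) → Prop} (A : Finset (Fin N)) (h0 : P ∅)
    (h1 : ∀ (i : Fin N) (A : Finset (Fin N)), (∀ x ∈ A, i < x) → P A → P (insert i A)) : P A :=
  Finset.induction_on_min A h0 fun a s h hP => h1 a s h hP

/-- An operator that anticommutes with all `θ^i - ζ^i` (super)commutes with `(θ - ζ)^A`. -/
theorem map_mulOdd {U' : Type*} [AddCommGroup U'] [Module ℂ U'] (c : ℂ)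
    (E : FormalDist₂ N U →ₗ[ℂ] FormalDist₂ N U')
    (hE : ∀ i f, E (mulChi i f) = c • mulChi i (E f)) (A : Finset (Fin N))
    (f : FormalDist₂ N U) : E (mulOdd A f) = c ^ A.card • mulOdd A (E f) := by
  induction A using induction_min with
  | h0 => simp [mulOdd_empty]
  | h1 i A h ih =>
    have hi : i ∉ A := fun hi => lt_irrefl _ (h i hi)
    rw [mulOdd_insert_min h, hE, ih, mulOdd_insert_min h, map_smul, smul_smul,
      Finset.card_insert_of_notMem hi, pow_succ']

/-- The factor moves past the smaller factors to its sorted place, which costs `eps i A`; if it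
meets its own copy, the product is zero. -/
theorem mulChi_mulOdd (i : Fin N) (A : Finset (Fin N)) (f : FormalDist₂ N U) :
    mulChi i (mulOdd A f) = if i ∈ A then 0 else eps i A • mulOdd (insert i A) f := by
  induction A using induction_min with
  | h0 =>
    rw [mulOdd_insert_min (by simp)]
    simp [mulOdd_empty]
  | h1 j A h ih =>
    have hj : j ∉ A := fun hi => lt_irrefl _ (h j hi)
    by_cases hij : i = j
    · subst hij; rw [mulOdd_insert_min h]; simp [mulChi_self]
    · by_cases hlt : i < j
      · have hmin : ∀ x ∈ insert j A, i < x := by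
          intro x hx
          rcases Finset.mem_insert.mp hx with rfl | hx
          · exact hlt
          · exact hlt.trans (h x hx)
        have hi : i ∉ insert j A := fun hi => lt_irrefl _ (hmin i hi)
        rw [if_neg hi, mulOdd_insert_min hmin]
        have : eps i (insert j A) = 1 := by
          unfold eps
          rw [Finset.filter_false_of_mem (fun x hx => not_lt.mpr (hmin x hx).le)]; simp
        rw [this, one_smul]
      · have hgt : j < i := lt_of_le_of_ne (not_lt.mp hlt) (Ne.symm hij)
        rw [mulOdd_insert_min h, mulChi_anticomm, ih]
        by_cases hi : i ∈ A
        · simp [hi]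
        · have hi' : i ∉ insert j A := by simp [hi, hij]
          have hmin : ∀ x ∈ insert i A, j < x := by
            intro x hx
            rcases Finset.mem_insert.mp hx with rfl | hx
            · exact hgt
            · exact h x hx
          rw [if_neg hi, if_neg hi', map_smul, ← mulOdd_insert_min hmin, eps_insert hj, if_pos hgt,
            Finset.insert_comm, ← neg_smul, neg_one_mul]

theorem mulOdd_mulChi (i : Fin N) (A : Finset (Fin N)) (f : FormalDist₂ N U) :
    mulOdd A (mulChi i f) = (-1 : ℂ) ^ A.card • mulChi i (mulOdd A f) := by
  rw [map_mulOdd (-1) (mulChi i) (fun j g => by rw [mulChi_anticomm, neg_one_smul]), smul_smul,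
    negOne_pow_sq, one_smul]

theorem mulOdd_mulZeta (i : Fin N) (A : Finset (Fin N)) (f : FormalDist₂ N U) :
    mulOdd A (mulZeta i f) = (-1 : ℂ) ^ A.card • mulZeta i (mulOdd A f) := by
  rw [map_mulOdd (-1) (mulZeta i) (fun j g => by rw [mulChi_mulZeta, neg_one_smul, neg_neg]),
    smul_smul, negOne_pow_sq, one_smul]

/-- The θ^i - ζ^i anticommute just as the θ^i do, so they multiply with the same signs σ. -/
theorem mulOdd_mulOdd (A B : Finset (Fin N)) (f : FormalDist₂ N U) :
    mulOdd A (mulOdd B f) = sgn A B • mulOdd (A ∪ B) f := by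
  induction A using induction_min with
  | h0 => simp [mulOdd_empty]
  | h1 i A h ih =>
    have hi : i ∉ A := fun hi => lt_irrefl _ (h i hi)
    rw [mulOdd_insert_min h, ih, map_smul, mulChi_mulOdd]
    by_cases hB : i ∈ B
    · simp [hB, sgn_eq_zero (A := insert i A) (B := B) (by simp [hB])]
    · by_cases hd : Disjoint A B
      · rw [if_neg (by simp [hi, hB]), smul_smul, Finset.insert_union, sgn_insert_left hi hB,
          eps_union hd]
        have : eps i A = 1 := by
          unfold eps
          rw [Finset.filter_false_of_mem (fun x hx => not_lt.mpr (h x hx).le)]; simp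
        rw [this, one_mul, mul_comm]
      · rw [sgn_eq_zero hd, sgn_insert_left hi hB, sgn_eq_zero hd]; simp

theorem mulZsubW_mulTheta (i : Fin N) (f : FormalDist₂ N U) :
    mulZsubW (mulTheta i f) = mulTheta i (mulZsubW f) := by
  funext p P q Q
  by_cases h : i ∈ P <;> simp [mulZsubW, mulTheta_apply, h, smul_sub]

theorem mulZsubW_mulZeta (i : Fin N) (f : FormalDist₂ N U) :
    mulZsubW (mulZeta i f) = mulZeta i (mulZsubW f) := by
  funext p P q Q
  by_cases h : i ∈ Q <;> simp [mulZsubW, mulZeta_apply, h, smul_sub]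

theorem mulZsubW_pow_comm (E : Module.End ℂ (FormalDist₂ N U))
    (h : ∀ f, mulZsubW (E f) = E (mulZsubW f)) (n : ℕ) (f : FormalDist₂ N U) :
    (mulZsubW ^ n) (E f) = E ((mulZsubW ^ n) f) := by
  have : Commute (mulZsubW (N := N) (U := U)) E := LinearMap.ext h
  exact LinearMap.congr_fun (this.pow_left n) f

theorem mulZsubW_mulChi (i : Fin N) (f : FormalDist₂ N U) :
    mulZsubW (mulChi i f) = mulChi i (mulZsubW f) := by
  rw [mulChi_apply, mulChi_apply, map_sub, mulZsubW_mulTheta, mulZsubW_mulZeta]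

theorem mulZsubW_mulOdd (A : Finset (Fin N)) (f : FormalDist₂ N U) :
    mulZsubW (mulOdd A f) = mulOdd A (mulZsubW f) := by
  rw [map_mulOdd 1 mulZsubW (fun i f => by rw [mulZsubW_mulChi, one_smul])]; simp

theorem mulZsubW_pow_mulOdd (n : ℕ) (A : Finset (Fin N)) (f : FormalDist₂ N U) :
    (mulZsubW ^ n) (mulOdd A f) = mulOdd A ((mulZsubW ^ n) f) :=
  mulZsubW_pow_comm _ (mulZsubW_mulOdd A) n f

/-- The coefficient of `θ^N`. -/
def topCoeff (f : FormalDist₂ N U) : ℤ → ℤ → Finset (Fin N) → U :=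
  fun p q Q => f p Finset.univ q Q

/-- A distribution vanishes if the `θ^N`-coefficients of all `(θ - ζ)^J f` do. -/
theorem eq_zero_of_topCoeff_mulOdd {f : FormalDist₂ N U}
    (h : ∀ J, topCoeff (mulOdd J f) = 0) : f = 0 := by
  -- The property is strengthened to a set stable under ζ^i, which leaves the θ-degree alone, and
  -- under θ^i - ζ^i, which only changes J. It is then stable under θ^i.
  let K : Set (FormalDist₂ N U) := {f | ∀ J, topCoeff (mulOdd J f) = 0}
  have hzeta : ∀ i, ∀ g ∈ K, mulZeta i g ∈ K := by
    intro i g hg J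
    funext p q Q
    have := fun Q' => congrFun (congrFun (congrFun (hg J) p) q) Q'
    simp only [topCoeff, Pi.zero_apply] at this
    rw [mulOdd_mulZeta]
    simp [topCoeff, mulZeta_apply, this]
  have hchi : ∀ i, ∀ g ∈ K, mulChi i g ∈ K := by
    intro i g hg J
    funext p q Q
    have := fun J' => congrFun (congrFun (congrFun (hg J') p) q) Q
    simp only [topCoeff, Pi.zero_apply] at this
    rw [mulOdd_mulChi, mulChi_mulOdd]
    split_ifs <;> simp [topCoeff, this]
  have htheta : ∀ i, ∀ g ∈ K, mulTheta i g ∈ K := by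
    intro i g hg J
    have : mulTheta i g = mulChi i g + mulZeta i g := by rw [mulChi_apply]; abel
    funext p q Q
    have h1 := congrFun (congrFun (congrFun (hchi i g hg J) p) q) Q
    have h2 := congrFun (congrFun (congrFun (hzeta i g hg J) p) q) Q
    simp only [topCoeff, Pi.zero_apply] at h1 h2
    simp [topCoeff, this, map_add, h1, h2]
  -- Multiplying by the missing θ^i moves the coefficient at P up to θ^N; the induction is on the
  -- number of missing variables.
  have key : ∀ (n : ℕ) (P : Finset (Fin N)), Pᶜ.card = n → ∀ g ∈ K, ∀ p q Q, g p P q Q = 0 := by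
    intro n
    induction n with
    | zero =>
      intro P hP g hg p q Q
      have hP' : P = Finset.univ := by simpa using hP
      have := congrFun (congrFun (congrFun (hg ∅) p) q) Q
      rw [mulOdd_empty] at this
      rw [hP']; exact this
    | succ n ih =>
      intro P hP g hg p q Q
      have : (Pᶜ).Nonempty := by rw [← Finset.card_pos, hP]; omega
      obtain ⟨i, hi⟩ := this
      have hi' : i ∉ P := by simpa using hi
      have h1 := ih (insert i P) (by
        rw [Finset.compl_insert, Finset.card_erase_of_mem hi, hP]; rfl) _ (htheta i g hg) p q Q
      rw [mulTheta_apply, if_pos (Finset.mem_insert_self _ _), Finset.erase_insert hi',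
        smul_eq_zero] at h1
      exact h1.resolve_left (eps_ne_zero _ _)
  funext p P q Q
  exact key _ P rfl f h p q Q

end Grassmann

/-! ### Locality of formal distributions in even variables -/

section EvenCalculus

variable {U : Type*} [AddCommGroup U] [Module ℂ U] {U' : Type*} [AddCommGroup U'] [Module ℂ U']

/-- Multiplication of distributions in `z, w` by `z - w`. -/
def zSubW : Module.End ℂ (ℤ → ℤ → U) where
  toFun f := fun j k => f (j - 1) k - f j (k - 1)
  map_add' a b := by funext j k; simp only [Pi.add_apply]; abel
  map_smul' c a := by funext j k; simp [smul_sub]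

theorem zSubW_apply (f : ℤ → ℤ → U) (j k : ℤ) : zSubW f j k = f (j - 1) k - f j (k - 1) := rfl

/-- `∂_z + ∂_w`. -/
def dzAddDw : Module.End ℂ (ℤ → ℤ → U) where
  toFun f := fun j k => ((j : ℂ) + 1) • f (j + 1) k + ((k : ℂ) + 1) • f j (k + 1)
  map_add' a b := by funext j k; simp only [Pi.add_apply, smul_add]; abel
  map_smul' c a := by funext j k; simp [smul_comm c]

theorem dzAddDw_apply (f : ℤ → ℤ → U) (j k : ℤ) :
    dzAddDw f j k = ((j : ℂ) + 1) • f (j + 1) k + ((k : ℂ) + 1) • f j (k + 1) := rfl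

/-- `∂_z` on distributions in `z, w`. -/
def dzEven : Module.End ℂ (ℤ → ℤ → U) where
  toFun f := fun j k => ((j : ℂ) + 1) • f (j + 1) k
  map_add' a b := by funext j k; simp only [Pi.add_apply, smul_add]
  map_smul' c a := by funext j k; simp [smul_comm c]

/-- The derivation ∂_z + ∂_w annihilates z - w. -/
theorem zSubW_dzAddDw (f : ℤ → ℤ → U) : zSubW (dzAddDw f) = dzAddDw (zSubW f) := by
  funext j k
  simp only [zSubW_apply, dzAddDw_apply, sub_add_cancel, add_sub_cancel_right, smul_sub]
  push_cast
  module

theorem zSubW_pow_dzAddDw (n : ℕ) (f : ℤ → ℤ → U) :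
    (zSubW ^ n) (dzAddDw f) = dzAddDw ((zSubW ^ n) f) := by
  have : Commute (zSubW (U := U)) dzAddDw := LinearMap.ext zSubW_dzAddDw
  exact LinearMap.congr_fun (this.pow_left n) f

/-- Used with L the evaluation at a vector or the multiplication by a fixed operator, to carry
locality relations along. -/
theorem zSubW_pow_map (L : U →ₗ[ℂ] U') (n : ℕ) (f : ℤ → ℤ → U) (j k : ℤ) :
    (zSubW ^ n) (fun j k => L (f j k)) j k = L ((zSubW ^ n) f j k) := by
  induction n generalizing j k with
  | zero => rfl
  | succ n ih => simp only [pow_succ', Module.End.mul_apply, zSubW_apply, ih, map_sub]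

theorem zSubW_map (L : U →ₗ[ℂ] U') (f : ℤ → ℤ → U) (j k : ℤ) :
    zSubW (fun j k => L (f j k)) j k = L (zSubW f j k) := by
  simp only [zSubW_apply, map_sub]

theorem zSubW_swap (f : ℤ → ℤ → U) : zSubW (fun j k => f k j) = - fun j k => zSubW f k j := by
  funext j k; simp [zSubW_apply]

theorem zSubW_pow_swap (n : ℕ) (f : ℤ → ℤ → U) (j k : ℤ) :
    (zSubW ^ n) (fun j k => f k j) j k = (-1 : ℂ) ^ n • (zSubW ^ n) f k j := by
  induction n generalizing j k with
  | zero => simp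
  | succ n ih =>
    simp only [pow_succ' zSubW, Module.End.mul_apply, zSubW_apply, ih, ← smul_sub]
    rw [pow_succ, mul_neg_one, neg_smul, ← smul_neg, neg_sub]

theorem mulZsubW_pow_apply {N : ℕ} (n : ℕ) (f : FormalDist₂ N U) (j : ℤ) (J : Finset (Fin N))
    (k : ℤ) (K : Finset (Fin N)) :
    (mulZsubW ^ n) f j J k K = (zSubW ^ n) (fun j k => f j J k K) j k := by
  induction n generalizing j k with
  | zero => rfl
  | succ n ih =>
    simp only [pow_succ', Module.End.mul_apply, zSubW_apply, ← ih]
    rfl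

/-- The Leibniz rule; it shows that differentiating a local distribution costs one more power of z -
w. -/
theorem zSubW_pow_dzEven (n : ℕ) (f : ℤ → ℤ → U) :
    (zSubW ^ (n + 1)) (dzEven f) = dzEven ((zSubW ^ (n + 1)) f) - ((n : ℂ) + 1) • (zSubW ^ n) f := by
  have h1 : ∀ g : ℤ → ℤ → U, zSubW (dzEven g) = dzEven (zSubW g) - g := by
    intro g
    funext j k
    simp only [dzEven, zSubW_apply, LinearMap.coe_mk, AddHom.coe_mk, Pi.sub_apply,
      sub_add_cancel, add_sub_cancel_right, smul_sub]
    push_cast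
    module
  induction n with
  | zero => simp [h1]
  | succ n ih =>
    have e : ∀ (m : ℕ) (g : ℤ → ℤ → U), zSubW ((zSubW ^ m) g) = (zSubW ^ (m + 1)) g :=
      fun m g => by rw [pow_succ', Module.End.mul_apply]
    rw [← e, ih, map_sub, h1, map_smul, e, e]
    push_cast
    module

/-- If `f` has no negative powers of `w`, neither does `(z - w)^n f`, and the terms of
`(z - w)^n f` without `w` are those of `z^n f`. -/
theorem zSubW_pow_of_regular_right {f : ℤ → ℤ → U} (h : ∀ j, ∀ k < 0, f j k = 0) (n : ℕ) :
    (∀ j, ∀ k < 0, (zSubW ^ n) f j k = 0) ∧ ∀ j, (zSubW ^ n) f j 0 = f (j - n) 0 := by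
  induction n with
  | zero => exact ⟨h, fun j => by simp⟩
  | succ n ih =>
    constructor
    · intro j k hk
      rw [pow_succ', Module.End.mul_apply, zSubW_apply, ih.1 _ _ hk, ih.1 _ _ (by omega), sub_zero]
    · intro j
      rw [pow_succ', Module.End.mul_apply, zSubW_apply, ih.2, ih.1 _ _ (by omega), sub_zero]
      congr 1; push_cast; ring

theorem zSubW_pow_of_regular_left {f : ℤ → ℤ → U} (h : ∀ k, ∀ j < 0, f j k = 0) (n : ℕ) :
    ∀ k, ∀ j < 0, (zSubW ^ n) f j k = 0 := by
  intro k j hj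
  have := zSubW_pow_swap n (fun k j => f j k) j k
  rw [this, (zSubW_pow_of_regular_right h n).1 k j hj, smul_zero]

/-- Coefficients are constant along j + k = const, and each such line reaches k < n₀. This is the
cancellation law for z - w behind all statements about `ordL`. -/
theorem eq_zero_of_zSubW {f : ℤ → ℤ → U} (h : zSubW f = 0) {n₀ : ℤ}
    (hf : ∀ j, ∀ k < n₀, f j k = 0) : f = 0 := by
  have key : ∀ (n : ℕ) (j : ℤ), f j (n₀ - 1 + n) = 0 := by
    intro n
    induction n with
    | zero => intro j; exact hf _ _ (by omega)
    | succ n ih =>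
      intro j
      have := congrFun (congrFun h (j + 1)) (n₀ - 1 + (n + 1))
      simp only [zSubW_apply, Pi.zero_apply, add_sub_cancel_right] at this
      have h2 := ih (j + 1)
      rw [show n₀ - 1 + ((n : ℤ) + 1) - 1 = n₀ - 1 + n by ring, h2, sub_zero] at this
      push_cast
      exact this
  funext j k
  rcases lt_or_ge k n₀ with hk | hk
  · exact hf j k hk
  · have := key (k - n₀ + 1).toNat j
    rwa [Int.toNat_of_nonneg (by omega), show n₀ - 1 + (k - n₀ + 1) = k by ring] at this

/-- A distribution that is killed by a power of `z - w` vanishes if its residues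
`Res_z (z - w)^m f` do. -/
theorem eq_zero_of_residues {n : ℕ} {f : ℤ → ℤ → U} (h : (zSubW ^ n) f = 0)
    (hf : ∀ m < n, ∀ k, (zSubW ^ m) f (-1) k = 0) : f = 0 := by
  -- One power of z - w: g is constant along each line j + k = const, and every such line meets j =
  -- -1.
  have base : ∀ g : ℤ → ℤ → U, zSubW g = 0 → (∀ k, g (-1) k = 0) → g = 0 := by
    intro g hg h1
    have hs : ∀ j k, g (j - 1) k = g j (k - 1) := fun j k =>
      sub_eq_zero.mp (congrFun (congrFun hg j) k)
    have up : ∀ (n : ℕ) (k : ℤ), g (-1 + n) k = 0 := by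
      intro n
      induction n with
      | zero => intro k; simpa using h1 k
      | succ n ih =>
        intro k
        have := hs (-1 + n + 1) (k + 1)
        simp only [add_sub_cancel_right] at this
        push_cast
        rw [← add_assoc, ← this, ih]
    have down : ∀ (n : ℕ) (k : ℤ), g (-1 - n) k = 0 := by
      intro n
      induction n with
      | zero => intro k; simpa using h1 k
      | succ n ih =>
        intro k
        have := hs (-1 - n) k
        push_cast
        rw [← sub_sub, this, ih]
    funext j k
    rcases le_total (-1) j with hj | hj
    · have := up (j + 1).toNat k
      rwa [Int.toNat_of_nonneg (by omega), show -1 + (j + 1) = j by ring] at this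
    · have := down (-1 - j).toNat k
      rwa [Int.toNat_of_nonneg (by omega), show -1 - (-1 - j) = j by ring] at this
  induction n with
  | zero => exact h
  | succ n ih =>
    -- The base case applied to (z - w)^n f lowers the exponent.
    refine ih (base _ ?_ (hf n (Nat.lt_succ_self n))) fun m hm => hf m (by omega)
    rwa [pow_succ', Module.End.mul_apply] at h

/-- Multiplication of distributions in `z, w, x` by `z - w`. -/
def zSubW₃ : Module.End ℂ (ℤ → ℤ → ℤ → U) where
  toFun f := fun j k l => f (j - 1) k l - f j (k - 1) l
  map_add' a b := by funext j k l; simp only [Pi.add_apply]; abel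
  map_smul' c a := by funext j k l; simp [smul_sub]

/-- Multiplication of distributions in `z, w, x` by `z - x`. -/
def zSubX₃ : Module.End ℂ (ℤ → ℤ → ℤ → U) where
  toFun f := fun j k l => f (j - 1) k l - f j k (l - 1)
  map_add' a b := by funext j k l; simp only [Pi.add_apply]; abel
  map_smul' c a := by funext j k l; simp [smul_sub]

/-- Multiplication of distributions in `z, w, x` by `w - x`. -/
def wSubX₃ : Module.End ℂ (ℤ → ℤ → ℤ → U) where
  toFun f := fun j k l => f j (k - 1) l - f j k (l - 1)
  map_add' a b := by funext j k l; simp only [Pi.add_apply]; abel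
  map_smul' c a := by funext j k l; simp [smul_sub]

theorem zSubW₃_pow_apply (n : ℕ) (f : ℤ → ℤ → ℤ → U) (j k l : ℤ) :
    (zSubW₃ ^ n) f j k l = (zSubW ^ n) (fun j k => f j k l) j k := by
  induction n generalizing j k with
  | zero => rfl
  | succ n ih =>
    simp only [pow_succ', Module.End.mul_apply, zSubW_apply, ← ih]; rfl

theorem zSubX₃_pow_apply (n : ℕ) (f : ℤ → ℤ → ℤ → U) (j k l : ℤ) :
    (zSubX₃ ^ n) f j k l = (zSubW ^ n) (fun j l => f j k l) j l := by
  induction n generalizing j l with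
  | zero => rfl
  | succ n ih =>
    simp only [pow_succ', Module.End.mul_apply, zSubW_apply, ← ih]; rfl

theorem wSubX₃_pow_apply (n : ℕ) (f : ℤ → ℤ → ℤ → U) (j k l : ℤ) :
    (wSubX₃ ^ n) f j k l = (zSubW ^ n) (fun k l => f j k l) k l := by
  induction n generalizing k l with
  | zero => rfl
  | succ n ih =>
    simp only [pow_succ', Module.End.mul_apply, zSubW_apply, ← ih]; rfl

theorem commute_zSubX₃_wSubX₃ : Commute (zSubX₃ (U := U)) wSubX₃ := by
  refine LinearMap.ext fun f => ?_
  funext j k l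
  simp only [Module.End.mul_apply, zSubX₃, wSubX₃, LinearMap.coe_mk, AddHom.coe_mk]
  abel

theorem commute_zSubX₃_zSubW₃ : Commute (zSubX₃ (U := U)) zSubW₃ := by
  refine LinearMap.ext fun f => ?_
  funext j k l
  simp only [Module.End.mul_apply, zSubX₃, zSubW₃, LinearMap.coe_mk, AddHom.coe_mk]
  abel

theorem commute_wSubX₃_zSubW₃ : Commute (wSubX₃ (U := U)) zSubW₃ := by
  refine LinearMap.ext fun f => ?_
  funext j k l
  simp only [Module.End.mul_apply, wSubX₃, zSubW₃, LinearMap.coe_mk, AddHom.coe_mk]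
  abel

theorem wSubX₃_eq : wSubX₃ (U := U) = zSubX₃ + (-1 : ℂ) • zSubW₃ := by
  refine LinearMap.ext fun f => ?_
  funext j k l
  simp only [zSubX₃, zSubW₃, wSubX₃, LinearMap.add_apply, LinearMap.smul_apply, LinearMap.coe_mk,
    AddHom.coe_mk, Pi.add_apply, neg_one_smul, Pi.neg_apply]
  abel

theorem pow_apply_eq_zero_of_le {M : Type*} [AddCommGroup M] [Module ℂ M] {A : Module.End ℂ M}
    {f : M} {m n : ℕ} (hmn : m ≤ n) (h : (A ^ m) f = 0) : (A ^ n) f = 0 := by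
  rw [← Nat.sub_add_cancel hmn, pow_add, Module.End.mul_apply, h, map_zero]

/-- The algebraic core of Dong's lemma. -/
theorem wSubX₃_pow_eq_zero {r s : ℕ} {f : ℤ → ℤ → ℤ → U}
    (h₁ : (wSubX₃ ^ r) ((zSubX₃ ^ r) f) = 0) (h₂ : (zSubW₃ ^ s) f = 0) :
    (wSubX₃ ^ (r + s + r)) f = 0 := by
  rw [pow_add, Module.End.mul_apply]
  set g := (wSubX₃ ^ r) f with hg
  have h₁' : (zSubX₃ ^ r) g = 0 := by
    rw [hg, ← Module.End.mul_apply, (commute_zSubX₃_wSubX₃.pow_pow r r).eq]; exact h₁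
  have h₂' : (((-1 : ℂ) • zSubW₃) ^ s) g = 0 := by
    have : Commute (((-1 : ℂ) • zSubW₃ (U := U)) ^ s) (wSubX₃ ^ r) :=
      (commute_wSubX₃_zSubW₃.symm.smul_left (-1 : ℂ)).pow_pow s r
    rw [hg, ← Module.End.mul_apply, this.eq, Module.End.mul_apply, smul_pow,
      LinearMap.smul_apply, h₂, smul_zero, map_zero]
  have hc : Commute (zSubX₃ (U := U)) ((-1 : ℂ) • zSubW₃) :=
    commute_zSubX₃_zSubW₃.smul_right (-1 : ℂ)
  -- Expand w - x = (z - x) - (z - w) to the power r + s: each term contains (z - x)^r or (z - w)^s.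
  rw [wSubX₃_eq, hc.add_pow, LinearMap.sum_apply]
  refine Finset.sum_eq_zero fun m hm => ?_
  have hnat : ∀ h : ℤ → ℤ → ℤ → U,
      (((r + s).choose m : ℕ) : Module.End ℂ (ℤ → ℤ → ℤ → U)) h = ((r + s).choose m) • h :=
    fun h => by rw [Module.End.natCast_apply]
  rw [Module.End.mul_apply, hnat, map_nsmul]
  rcases le_or_gt r m with h | h
  · rw [(hc.pow_pow m _).eq, Module.End.mul_apply, pow_apply_eq_zero_of_le h h₁', map_zero,
      smul_zero]
  · rw [Module.End.mul_apply, pow_apply_eq_zero_of_le (by omega) h₂', map_zero, smul_zero]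

end EvenCalculus

/-! ### Dong's lemma and translation covariance for operator-valued distributions -/

section Locality

variable {V : Type*} [AddCommGroup V] [Module ℂ V]

/-- `(z - w)^n (α(z) β(w) - ε β(w) α(z)) = 0` for some `n`. -/
def Loc (ε : ℂ) (α β : ℤ → Module.End ℂ V) : Prop :=
  ∃ n : ℕ, (zSubW ^ n) (fun j k => α j * β k - ε • (β k * α j)) = 0

/-- `α(z) v ∈ V((z))` for all `v`. -/
def IsField (α : ℤ → Module.End ℂ V) : Prop := ∀ v, ∃ n₀ : ℤ, ∀ n < n₀, α n v = 0

/-- `[T, α(z)] = ∂_z α(z)` -/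
def TCov (T : Module.End ℂ V) (α : ℤ → Module.End ℂ V) : Prop :=
  ∀ n, T * α n - α n * T = ((n : ℂ) + 1) • α (n + 1)

/-- `[T, P(z, w)] = (∂_z + ∂_w) P(z, w)` -/
def TCov₂ (T : Module.End ℂ V) (P : ℤ → ℤ → Module.End ℂ V) : Prop :=
  (fun j k => T * P j k - P j k * T) = dzAddDw P

theorem TCov.mul {T : Module.End ℂ V} {α β : ℤ → Module.End ℂ V} (hα : TCov T α)
    (hβ : TCov T β) : TCov₂ T fun j k => α j * β k := by
  funext j k
  rw [dzAddDw_apply, ← smul_mul_assoc, ← mul_smul_comm, ← hα j, ← hβ k]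
  noncomm_ring

theorem TCov₂.swap {T : Module.End ℂ V} {P : ℤ → ℤ → Module.End ℂ V} (h : TCov₂ T P) :
    TCov₂ T fun j k => P k j := by
  funext j k
  have := congrFun (congrFun h k) j
  rw [dzAddDw_apply] at this ⊢
  rw [this, add_comm]

theorem TCov₂.add_smul {T : Module.End ℂ V} {P Q : ℤ → ℤ → Module.End ℂ V} (hP : TCov₂ T P)
    (hQ : TCov₂ T Q) (ε : ℂ) : TCov₂ T fun j k => P j k + ε • Q j k := by
  have : (fun j k => P j k + ε • Q j k) = P + ε • Q := rfl
  unfold TCov₂ at *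
  rw [this, map_add, map_smul, ← hP, ← hQ]
  funext j k
  simp only [Pi.add_apply, Pi.smul_apply, mul_add, add_mul, mul_smul_comm, smul_mul_assoc, smul_sub]
  abel

theorem TCov₂.zSubW_pow {T : Module.End ℂ V} {P : ℤ → ℤ → Module.End ℂ V} (h : TCov₂ T P)
    (n : ℕ) : TCov₂ T ((zSubW ^ n) P) := by
  unfold TCov₂ at *
  rw [← zSubW_pow_dzAddDw, ← h]
  funext j k
  exact (zSubW_pow_map (LinearMap.mulLeft ℂ T - LinearMap.mulRight ℂ T) n P j k).symm

/-- Dong's lemma yields a relation in z, w, x that involves only powers of w - x, so it holds in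
particular for the coefficient of z^{-1}. -/
theorem Loc.of_residue {P : ℤ → ℤ → Module.End ℂ V} {γ : ℤ → Module.End ℂ V} {ε : ℂ} {r s : ℕ}
    (h₁ : (wSubX₃ ^ r) ((zSubX₃ ^ r) fun j k l => P j k * γ l - ε • (γ l * P j k)) = 0)
    (h₂ : (zSubW ^ s) P = 0) : Loc ε (P (-1)) γ := by
  refine ⟨r + s + r, ?_⟩
  have h := wSubX₃_pow_eq_zero (s := s) h₁ (by
    funext j k l
    rw [zSubW₃_pow_apply]
    have := zSubW_pow_map (LinearMap.mulRight ℂ (γ l) - ε • LinearMap.mulLeft ℂ (γ l)) s P j k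
    rw [h₂] at this
    simpa using this)
  funext k l
  have := congrFun (congrFun (congrFun h (-1)) k) l
  rwa [wSubX₃_pow_apply] at this

/-- Write the commutator with γ as α[β, γ] + ε₂[α, γ]β; the first term is killed by (w - x)^r, the
second by (z - x)^r. -/
theorem triple_comm_eq_zero {α β γ : ℤ → Module.End ℂ V} {ε₁ ε₂ : ℂ} {r : ℕ}
    (h₁ : (zSubW ^ r) (fun j k => α j * γ k - ε₁ • (γ k * α j)) = 0)
    (h₂ : (zSubW ^ r) (fun j k => β j * γ k - ε₂ • (γ k * β j)) = 0) :
    (wSubX₃ ^ r) ((zSubX₃ ^ r) fun j k l =>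
      α j * β k * γ l - (ε₁ * ε₂) • (γ l * (α j * β k))) = 0 := by
  have hsplit : (fun j k l => α j * β k * γ l - (ε₁ * ε₂) • (γ l * (α j * β k))) =
      (fun j k l => α j * (β k * γ l - ε₂ • (γ l * β k))) +
      fun j k l => ε₂ • ((α j * γ l - ε₁ • (γ l * α j)) * β k) := by
    funext j k l
    simp only [Pi.add_apply, mul_sub, sub_mul, mul_smul_comm, smul_mul_assoc, smul_sub, smul_smul,
      mul_assoc, mul_comm ε₁ ε₂]
    abel
  have hA : (wSubX₃ ^ r) (fun j k l => α j * (β k * γ l - ε₂ • (γ l * β k))) = 0 := by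
    funext j k l
    rw [wSubX₃_pow_apply]
    have := zSubW_pow_map (LinearMap.mulLeft ℂ (α j)) r
      (fun k l => β k * γ l - ε₂ • (γ l * β k)) k l
    rw [h₂] at this
    simpa using this
  have hB : (zSubX₃ ^ r) (fun j k l => ε₂ • ((α j * γ l - ε₁ • (γ l * α j)) * β k)) = 0 := by
    funext j k l
    rw [zSubX₃_pow_apply]
    have := zSubW_pow_map (ε₂ • LinearMap.mulRight ℂ (β k)) r
      (fun j l => α j * γ l - ε₁ • (γ l * α j)) j l
    rw [h₁] at this
    simpa using this
  rw [hsplit, map_add, hB, add_zero, ← Module.End.mul_apply,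
    ← (commute_zSubX₃_wSubX₃.pow_pow r r).eq, Module.End.mul_apply, hA, map_zero]

theorem triple_comm_swap_eq_zero {α β γ : ℤ → Module.End ℂ V} {ε₁ ε₂ : ℂ} {r : ℕ}
    (h₁ : (zSubW ^ r) (fun j k => α j * γ k - ε₁ • (γ k * α j)) = 0)
    (h₂ : (zSubW ^ r) (fun j k => β j * γ k - ε₂ • (γ k * β j)) = 0) :
    (wSubX₃ ^ r) ((zSubX₃ ^ r) fun j k l =>
      β k * α j * γ l - (ε₁ * ε₂) • (γ l * (β k * α j))) = 0 := by
  have h := triple_comm_eq_zero h₂ h₁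
  rw [← Module.End.mul_apply, (commute_zSubX₃_wSubX₃.symm.pow_pow r r).eq, Module.End.mul_apply]
  funext j k l
  have := congrFun (congrFun (congrFun h k) j) l
  rw [wSubX₃_pow_apply] at this
  rw [zSubX₃_pow_apply]
  simp only [zSubX₃_pow_apply, wSubX₃_pow_apply, mul_comm ε₂ ε₁] at this ⊢
  exact this

/-- `α(z) i_{z,w}(z - w)^{-1} β(w)` -/
def ordL (α β : ℤ → Module.End ℂ V) : ℤ → ℤ → Module.End ℂ V := fun j k =>
  locSum fun m => if 0 ≤ m then α (j + 1 + m) * β (k - m) else 0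

theorem locFinite_ordL (α : ℤ → Module.End ℂ V) {β : ℤ → Module.End ℂ V} (hβ : IsField β)
    (j k : ℤ) : LocFinite fun m : ℤ => if 0 ≤ m then α (j + 1 + m) * β (k - m) else 0 := by
  intro v
  obtain ⟨n₀, h⟩ := hβ v
  refine (Set.finite_Icc (0 : ℤ) (k - n₀)).subset fun m hm => ?_
  by_contra hc
  apply hm
  by_cases h0 : 0 ≤ m
  · have : k - m < n₀ := by
      by_contra h'
      exact hc ⟨h0, by omega⟩
    simp [h0, h _ this]
  · simp [h0]

theorem locSum_apply {f : ℤ → Module.End ℂ V} (h : LocFinite f) (v : V) :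
    locSum f v = ∑ᶠ m, f m v := by
  simp [locSum, h]

theorem ordL_apply (α : ℤ → Module.End ℂ V) {β : ℤ → Module.End ℂ V} (hβ : IsField β) (j k : ℤ)
    (v : V) : ordL α β j k v = ∑ᶠ m : ℤ, if 0 ≤ m then α (j + 1 + m) (β (k - m) v) else 0 := by
  rw [ordL, locSum_apply (locFinite_ordL α hβ j k)]
  congr 1
  funext m
  split_ifs <;> rfl

theorem ordL_apply_eq_zero (α : ℤ → Module.End ℂ V) {β : ℤ → Module.End ℂ V} (hβ : IsField β)
    (j k : ℤ) {v : V} (h : ∀ n ≤ k, β n v = 0) : ordL α β j k v = 0 := by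
  rw [ordL_apply α hβ]
  refine finsum_eq_zero_of_forall_eq_zero fun m => ?_
  split_ifs with h0
  · rw [h _ (by omega), map_zero]
  · rfl

theorem ordL_mem (α : ℤ → Module.End ℂ V) {β : ℤ → Module.End ℂ V} (hβ : IsField β)
    (j k : ℤ) {v : V} (W : Submodule ℂ V) (h : ∀ m n, α m (β n v) ∈ W) : ordL α β j k v ∈ W := by
  rw [ordL_apply α hβ]
  refine finsum_induction (· ∈ W) W.zero_mem (fun _ _ => W.add_mem) fun m => ?_
  split_ifs
  · exact h _ _
  · exact W.zero_mem

/-- The two sums are shifts of each other by one and differ only in the term m = 0. -/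
theorem zSubW_ordL (α : ℤ → Module.End ℂ V) {β : ℤ → Module.End ℂ V} (hβ : IsField β) :
    zSubW (ordL α β) = fun j k => α j * β k := by
  funext j k
  refine LinearMap.ext fun v => ?_
  rw [zSubW_apply, LinearMap.sub_apply, ordL_apply α hβ, ordL_apply α hβ, Module.End.mul_apply]
  set g : ℤ → V := fun m => if 0 ≤ m then α (j + 1 + m) (β (k - 1 - m) v) else 0 with hg
  have hfin : (Function.support g).Finite := by
    refine (locFinite_ordL α hβ j (k - 1) v).subset fun m hm => ?_
    simp only [Function.mem_support, hg] at hm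
    simp only [Set.mem_ofPred_eq]
    split_ifs at hm ⊢ with h0
    · exact hm
    · exact absurd rfl hm
  have hfin' : (Function.support (g ∘ Equiv.subRight (1 : ℤ))).Finite := by
    rw [Function.support_comp_eq_preimage]
    exact hfin.preimage (Equiv.injective _).injOn
  have hshift : (fun m : ℤ => if 0 ≤ m then α (j - 1 + 1 + m) (β (k - m) v) else 0) =
      fun m => (g ∘ Equiv.subRight (1 : ℤ)) m + if m = 0 then α j (β k v) else 0 := by
    funext m
    simp only [hg, Function.comp, Equiv.subRight_apply]
    rcases lt_trichotomy m 0 with h | h | h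
    · rw [if_neg (by omega), if_neg (by omega), if_neg (by omega), add_zero]
    · subst h; simp
    · rw [if_pos (by omega), if_pos (by omega), if_neg (by omega), add_zero,
        show j - 1 + 1 + m = j + 1 + (m - 1) by ring, show k - m = k - 1 - (m - 1) by ring]
  rw [hshift, finsum_add_distrib hfin' (Set.Finite.subset (Set.finite_singleton 0) (by
    intro m hm
    by_contra h
    exact hm (if_neg h))),
    show ∑ᶠ m, (g ∘ Equiv.subRight (1 : ℤ)) m = finsum g from finsum_comp_equiv _, finsum_eq_single _ (0 : ℤ) (fun m hm => if_neg hm)]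
  simp

/-- The defect of covariance is killed by z - w, since the product is covariant. On each vector it
is bounded below in w, hence zero. -/
theorem TCov₂.ordL {T : Module.End ℂ V} {α β : ℤ → Module.End ℂ V} (hβf : IsField β)
    (hα : TCov T α) (hβ : TCov T β) : TCov₂ T (ordL α β) := by
  have h0 := hα.mul hβ
  unfold TCov₂ at *
  rw [← sub_eq_zero]
  funext j k
  refine LinearMap.ext fun v => ?_
  obtain ⟨n₁, h₁⟩ := hβf v
  obtain ⟨n₂, h₂⟩ := hβf (T v)
  set H := (fun j k => T * SUSYW.ordL α β j k - SUSYW.ordL α β j k * T) -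
    dzAddDw (SUSYW.ordL α β) with hH
  have hz : zSubW H = 0 := by
    rw [hH, map_sub, zSubW_dzAddDw, zSubW_ordL α hβf, ← h0]
    rw [sub_eq_zero]
    funext j k
    have := zSubW_map (LinearMap.mulLeft ℂ T - LinearMap.mulRight ℂ T) (SUSYW.ordL α β) j k
    rw [zSubW_ordL α hβf] at this
    exact this
  -- The bound has to serve v and T v, and the derivative in w looks at index k + 1, whence the
  -- extra -1.
  have := eq_zero_of_zSubW (f := fun j k => H j k v) (n₀ := min n₁ n₂ - 1) (by
    funext j k
    have := zSubW_map (LinearMap.applyₗ v) H j k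
    rw [hz] at this
    exact this) (by
    intro j k hk
    have hl := min_le_left n₁ n₂
    have hr := min_le_right n₁ n₂
    simp only [hH, Pi.sub_apply, dzAddDw_apply, LinearMap.sub_apply, Module.End.mul_apply,
      LinearMap.add_apply, LinearMap.smul_apply]
    rw [ordL_apply_eq_zero α hβf _ _ (fun n hn => h₁ n (by omega)),
      ordL_apply_eq_zero α hβf _ _ (fun n hn => h₂ n (by omega)),
      ordL_apply_eq_zero α hβf _ _ (fun n hn => h₁ n (by omega)),
      ordL_apply_eq_zero α hβf _ _ (fun n hn => h₁ n (by omega))]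
    simp)
  exact congrFun (congrFun this j) k

/-- Multiplication by z - w turns the claim into the hypothesis, and z - w may be cancelled because
everything is bounded below in w on each vector. -/
theorem ordL_triple_eq_zero {α β γ : ℤ → Module.End ℂ V} (hβ : IsField β) {ε : ℂ} {r : ℕ}
    (h : (wSubX₃ ^ r) ((zSubX₃ ^ r) fun j k l =>
      α j * β k * γ l - ε • (γ l * (α j * β k))) = 0) :
    (wSubX₃ ^ r) ((zSubX₃ ^ r) fun j k l =>
      ordL α β j k * γ l - ε • (γ l * ordL α β j k)) = 0 := by
  set F := fun j k l => ordL α β j k * γ l - ε • (γ l * ordL α β j k) with hF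
  have hzF : zSubW₃ F = fun j k l => α j * β k * γ l - ε • (γ l * (α j * β k)) := by
    funext j k l
    have := zSubW_map (LinearMap.mulRight ℂ (γ l) - ε • LinearMap.mulLeft ℂ (γ l)) (ordL α β) j k
    rw [zSubW_ordL α hβ] at this
    exact this
  have hz : zSubW₃ ((wSubX₃ ^ r) ((zSubX₃ ^ r) F)) = 0 := by
    rw [← h, ← hzF, ← Module.End.mul_apply, ← (commute_wSubX₃_zSubW₃.pow_left r).eq,
      Module.End.mul_apply, ← Module.End.mul_apply zSubW₃,
      ← (commute_zSubX₃_zSubW₃.pow_left r).eq, Module.End.mul_apply]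
  have hb : ∀ v l, ∃ n₀ : ℤ, ∀ j, ∀ k < n₀, F j k l v = 0 := by
    intro v l
    obtain ⟨n₁, h₁⟩ := hβ v
    obtain ⟨n₂, h₂⟩ := hβ (γ l v)
    refine ⟨min n₁ n₂, fun j k hk => ?_⟩
    have hl := min_le_left n₁ n₂
    have hr := min_le_right n₁ n₂
    simp only [hF, LinearMap.sub_apply, LinearMap.smul_apply, Module.End.mul_apply]
    rw [ordL_apply_eq_zero α hβ _ _ (fun n hn => h₁ n (by omega)),
      ordL_apply_eq_zero α hβ _ _ (fun n hn => h₂ n (by omega))]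
    simp
  -- Multiplication by z - x or w - x preserves boundedness in w for fixed v and l; only the bounds
  -- for l and l - 1 enter.
  have stepZ : ∀ G : ℤ → ℤ → ℤ → Module.End ℂ V,
      (∀ v l, ∃ n₀ : ℤ, ∀ j, ∀ k < n₀, G j k l v = 0) →
      ∀ v l, ∃ n₀ : ℤ, ∀ j, ∀ k < n₀, zSubX₃ G j k l v = 0 := by
    intro G hG v l
    obtain ⟨n₁, h₁⟩ := hG v l
    obtain ⟨n₂, h₂⟩ := hG v (l - 1)
    refine ⟨min n₁ n₂, fun j k hk => ?_⟩
    have hl := min_le_left n₁ n₂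
    have hr := min_le_right n₁ n₂
    change G (j - 1) k l v - G j k (l - 1) v = 0
    rw [h₁ _ _ (by omega), h₂ _ _ (by omega), sub_zero]
  have stepW : ∀ G : ℤ → ℤ → ℤ → Module.End ℂ V,
      (∀ v l, ∃ n₀ : ℤ, ∀ j, ∀ k < n₀, G j k l v = 0) →
      ∀ v l, ∃ n₀ : ℤ, ∀ j, ∀ k < n₀, wSubX₃ G j k l v = 0 := by
    intro G hG v l
    obtain ⟨n₁, h₁⟩ := hG v l
    obtain ⟨n₂, h₂⟩ := hG v (l - 1)
    refine ⟨min n₁ n₂, fun j k hk => ?_⟩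
    have hl := min_le_left n₁ n₂
    have hr := min_le_right n₁ n₂
    change G j (k - 1) l v - G j k (l - 1) v = 0
    rw [h₁ _ _ (by omega), h₂ _ _ (by omega), sub_zero]
  have hb1 : ∀ n : ℕ, ∀ v l, ∃ n₀ : ℤ, ∀ j, ∀ k < n₀, (zSubX₃ ^ n) F j k l v = 0 := by
    intro n
    induction n with
    | zero => exact hb
    | succ n ih =>
      rw [pow_succ', Module.End.mul_apply]
      exact stepZ _ ih
  have hb2 : ∀ n : ℕ, ∀ v l, ∃ n₀ : ℤ, ∀ j, ∀ k < n₀,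
      (wSubX₃ ^ n) ((zSubX₃ ^ r) F) j k l v = 0 := by
    intro n
    induction n with
    | zero => exact hb1 r
    | succ n ih =>
      rw [pow_succ', Module.End.mul_apply]
      exact stepW _ ih
  funext j k l
  refine LinearMap.ext fun v => ?_
  obtain ⟨n₀, hn₀⟩ := hb2 r v l
  have := eq_zero_of_zSubW (f := fun j k => (wSubX₃ ^ r) ((zSubX₃ ^ r) F) j k l v) (by
    funext j k
    have := congrFun (congrFun (congrFun hz j) k) l
    exact LinearMap.congr_fun this v) hn₀
  exact congrFun (congrFun this j) k

end Locality

/-! ### Parities of operators -/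

section Parity

theorem ksign_comm (p q : ZMod 2) : ksign p q = ksign q p := by
  simp [ksign, mul_comm]

@[simp] theorem ksign_zero_left (p : ZMod 2) : ksign 0 p = 1 := by simp [ksign]
@[simp] theorem ksign_zero_right (p : ZMod 2) : ksign p 0 = 1 := by simp [ksign]

@[simp] theorem ksign_one_one : ksign 1 1 = -1 := by
  rw [ksign, show (1 : ZMod 2).val = 1 from rfl]; norm_num

theorem zmod2_cases (p : ZMod 2) : p = 0 ∨ p = 1 := by
  revert p; decide

theorem ksign_add_left (p q r : ZMod 2) : ksign (p + q) r = ksign p r * ksign q r := by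
  have h : (1 + 1 : ZMod 2) = 0 := rfl
  rcases zmod2_cases p with rfl | rfl <;> rcases zmod2_cases q with rfl | rfl <;>
    rcases zmod2_cases r with rfl | rfl <;> simp [h]

theorem ksign_add_right (p q r : ZMod 2) : ksign r (p + q) = ksign r p * ksign r q := by
  rw [ksign_comm, ksign_add_left, ksign_comm p, ksign_comm q]

theorem ksign_mul_self (p q : ZMod 2) : ksign p q * ksign p q = 1 := by
  rw [ksign, ← mul_pow]; simp

theorem ksign_natCast (n m : ℕ) : ksign (n : ZMod 2) (m : ZMod 2) = (-1) ^ (n * m) := by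
  rw [ksign, ZMod.val_natCast, ZMod.val_natCast]
  rw [neg_one_pow_eq_pow_mod_two, Nat.mul_mod, Nat.mod_mod, Nat.mod_mod, ← Nat.mul_mod,
    ← neg_one_pow_eq_pow_mod_two]

theorem negOne_pow_eq_ksign (n : ℕ) : (-1 : ℂ) ^ n = ksign (n : ZMod 2) 1 := by
  have := ksign_natCast n 1
  simpa using this.symm

theorem zmod2_sum {M : Type*} [AddCommMonoid M] (f : ZMod 2 → M) : ∑ p, f p = f 0 + f 1 :=
  Fin.sum_univ_two f

variable {V : Type*} [AddCommGroup V] [Module ℂ V]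
  (𝒱 : ZMod 2 → Submodule ℂ V)

/-- Operators of parity `r`. -/
def IsOp (r : ZMod 2) (A : Module.End ℂ V) : Prop := ∀ q, ∀ v ∈ 𝒱 q, A v ∈ 𝒱 (r + q)

variable {𝒱}

theorem IsOp.mul {r s : ZMod 2} {A B : Module.End ℂ V} (hA : IsOp 𝒱 r A) (hB : IsOp 𝒱 s B) :
    IsOp 𝒱 (r + s) (A * B) := fun q v hv => by
  rw [add_assoc]; exact hA _ _ (hB _ _ hv)

theorem IsOp.smul {r : ZMod 2} {A : Module.End ℂ V} (hA : IsOp 𝒱 r A) (c : ℂ) :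
    IsOp 𝒱 r (c • A) := fun _ _ hv => Submodule.smul_mem _ c (hA _ _ hv)

theorem IsOp.sub {r : ZMod 2} {A B : Module.End ℂ V} (hA : IsOp 𝒱 r A) (hB : IsOp 𝒱 r B) :
    IsOp 𝒱 r (A - B) := fun _ _ hv => Submodule.sub_mem _ (hA _ _ hv) (hB _ _ hv)

variable (𝒱) [DirectSum.Decomposition 𝒱]

theorem proj_of_mem {q : ZMod 2} {v : V} (hv : v ∈ 𝒱 q) (p : ZMod 2) :
    proj 𝒱 p v = if p = q then v else 0 := by
  change ((DirectSum.decompose 𝒱 v p : 𝒱 p) : V) = _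
  rw [DirectSum.decompose_of_mem 𝒱 hv, DirectSum.coe_of_apply]
  by_cases h : p = q
  · subst h; simp
  · simp [h, Ne.symm h]

theorem proj_mem (p : ZMod 2) (v : V) : proj 𝒱 p v ∈ 𝒱 p :=
  (DirectSum.decompose 𝒱 v p : 𝒱 p).2

theorem sum_proj (v : V) : ∑ p : ZMod 2, proj 𝒱 p v = v := by
  classical
  conv_rhs => rw [← DirectSum.sum_support_decompose 𝒱 v]
  symm
  refine Finset.sum_subset (Finset.subset_univ _) fun p _ hp => ?_
  simpa using hp

variable {𝒱}

theorem opPart_of_isOp {s : ZMod 2} {A : Module.End ℂ V} (hA : IsOp 𝒱 s A) (r : ZMod 2) :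
    opPart 𝒱 r A = if r = s then A else 0 := by
  refine LinearMap.ext fun v => ?_
  simp only [opPart, LinearMap.sum_apply, Module.End.mul_apply]
  have h : ∀ p, proj 𝒱 (p + r) (A (proj 𝒱 p v)) = if r = s then A (proj 𝒱 p v) else 0 := by
    intro p
    rw [proj_of_mem 𝒱 (hA p _ (proj_mem 𝒱 p v)), add_comm p r]
    simp only [add_left_inj]
  simp only [h]
  split_ifs
  · rw [← map_sum, sum_proj]
  · simp

theorem koszul_of_isOp {s : ZMod 2} {A : Module.End ℂ V} (hA : IsOp 𝒱 s A) (k : ℕ) :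
    koszul 𝒱 k A = ksign (k : ZMod 2) s • A := by
  rw [koszul, opPart_of_isOp hA, opPart_of_isOp hA, negOne_pow_eq_ksign]
  rcases zmod2_cases s with rfl | rfl <;> simp

theorem ext_of_homogeneous {U : Type*} [AddCommGroup U] [Module ℂ U] {A B : V →ₗ[ℂ] U}
    (h : ∀ q, ∀ v ∈ 𝒱 q, A v = B v) : A = B := by
  refine LinearMap.ext fun v => ?_
  rw [← sum_proj 𝒱 v, map_sum, map_sum]
  exact Finset.sum_congr rfl fun p _ => h p _ (proj_mem 𝒱 p v)

end Parity

/-! ### The axioms written for homogeneous vectors and single components -/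

namespace SUSYVertexAlgebra

variable {N : ℕ} {V : Type*} [AddCommGroup V] [Module ℂ V]
  {𝒱 : ZMod 2 → Submodule ℂ V} [DirectSum.Decomposition 𝒱] (X : SUSYVertexAlgebra N 𝒱)

theorem field_add (a b : V) : X.field (a + b) = X.field a + X.field b := by
  simp [SUSYVertexAlgebra.field]

theorem field_smul (c : ℂ) (a : V) : X.field (c • a) = c • X.field a := by
  simp [SUSYVertexAlgebra.field]

/-- The linear map `a ↦ Y(a, Z)_{n|I}`. -/
def coeff (n : ℤ) (I : Finset (Fin N)) : V →ₗ[ℂ] Module.End ℂ V where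
  toFun a := X.field a n I
  map_add' a b := by rw [field_add]; rfl
  map_smul' c a := by rw [field_smul]; rfl

theorem coeff_apply (n : ℤ) (I : Finset (Fin N)) (a : V) : X.coeff n I a = X.field a n I := rfl

theorem field_zero : X.field 0 = 0 := by
  simp [SUSYVertexAlgebra.field]

theorem field_sum {ι : Type*} (s : Finset ι) (f : ι → V) :
    X.field (∑ i ∈ s, f i) = ∑ i ∈ s, X.field (f i) := by
  simp [SUSYVertexAlgebra.field]

theorem isOp_field {p : ZMod 2} {a : V} (ha : a ∈ 𝒱 p) (n : ℤ) (I : Finset (Fin N)) :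
    IsOp 𝒱 (p + (I.card : ZMod 2)) (X.field a n I) :=
  fun q v hv => X.Y_parity p a ha n I q v hv

theorem isField_field (a : V) (I : Finset (Fin N)) : IsField fun n => X.field a n I := fun v => by
  obtain ⟨n₀, h⟩ := (X.Y a).2 v
  exact ⟨n₀, fun n hn => h n hn I⟩

/-- Both sides are linear in a, and for homogeneous a this is parity preservation. It turns each
bilinear extension from homogeneous fields into one from homogeneous vectors. -/
theorem distPart_field (p : ZMod 2) (a : V) :
    distPart 𝒱 p (X.field a) = X.field (proj 𝒱 p a) := by
  funext n I
  have hlin : ∀ b : V, opPart 𝒱 (p + (I.card : ZMod 2)) (X.field b n I) =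
      ∑ q, proj 𝒱 (q + (p + (I.card : ZMod 2))) * X.coeff n I b * proj 𝒱 q := fun b => rfl
  let L : V →ₗ[ℂ] Module.End ℂ V :=
    ∑ q, LinearMap.mulRight ℂ (proj 𝒱 q) ∘ₗ
      LinearMap.mulLeft ℂ (proj 𝒱 (q + (p + (I.card : ZMod 2)))) ∘ₗ X.coeff n I
  have hL : ∀ b, opPart 𝒱 (p + (I.card : ZMod 2)) (X.field b n I) = L b := by
    intro b; rw [hlin]; simp [L]
  have : L = X.coeff n I ∘ₗ proj 𝒱 p := by
    refine ext_of_homogeneous (𝒱 := 𝒱) fun q v hv => ?_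
    rw [← hL, opPart_of_isOp (X.isOp_field hv n I), LinearMap.comp_apply, proj_of_mem 𝒱 hv]
    simp only [add_left_inj]
    split_ifs <;> simp [coeff_apply, field_zero]
  change opPart 𝒱 (p + (I.card : ZMod 2)) (X.field a n I) = _
  rw [hL, this]; rfl

theorem sum_distPart_field (a : V) : ∑ p, distPart 𝒱 p (X.field a) = X.field a := by
  simp only [distPart_field, ← field_sum, sum_proj]

theorem tCov_field (a : V) (I : Finset (Fin N)) : TCov X.T fun n => X.field a n I := by
  intro n
  have hT : IsOp 𝒱 0 X.T := fun q v hv => by rw [zero_add]; exact X.T_even q v hv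
  have h := congrFun (congrFun (X.T_comm a) n) I
  change _ = ((n : ℂ) + 1) • X.field a (n + 1) I at h
  rw [← h]
  change _ = ∑ p : ZMod 2, ∑ q : ZMod 2,
    (koszul 𝒱 I.card (opPart 𝒱 p X.T) * distPart 𝒱 q (X.field a) n I -
      ksign p q • (distPart 𝒱 q (X.field a) n I * opPart 𝒱 p X.T))
  have h0 : koszul 𝒱 I.card (0 : Module.End ℂ V) = 0 := by simp [koszul, opPart]
  rw [zmod2_sum]
  simp only [opPart_of_isOp hT, one_ne_zero, if_true, if_false, h0, zero_mul, mul_zero, smul_zero,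
    sub_zero, Finset.sum_const_zero, add_zero, koszul_of_isOp hT, ksign_zero_right,
    ksign_zero_left, one_smul]
  have hs := congrFun (congrFun (X.sum_distPart_field a) n) I
  rw [Finset.sum_apply, Finset.sum_apply] at hs
  rw [Finset.sum_sub_distrib, ← Finset.mul_sum, ← Finset.sum_mul, hs]

theorem S_comm_field {p : ZMod 2} {a : V} (ha : a ∈ 𝒱 p) (i : Fin N) (n : ℤ)
    (I : Finset (Fin N)) :
    (-1 : ℂ) ^ I.card • (X.S i * X.field a n I) - ksign 1 p • (X.field a n I * X.S i) =
      if i ∈ I then 0 else eps i I • X.field a n (insert i I) := by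
  have hS : IsOp 𝒱 1 (X.S i) := fun q v hv => by rw [add_comm]; exact X.S_odd i q v hv
  have h := congrFun (congrFun (X.S_comm i a) n) I
  rw [dtheta_apply] at h
  change _ = if i ∈ I then 0 else eps i I • X.field a n (insert i I) at h
  rw [← h]
  change _ = ∑ p : ZMod 2, ∑ q : ZMod 2,
    (koszul 𝒱 I.card (opPart 𝒱 p (X.S i)) * distPart 𝒱 q (X.field a) n I -
      ksign p q • (distPart 𝒱 q (X.field a) n I * opPart 𝒱 p (X.S i)))
  have h0 : koszul 𝒱 I.card (0 : Module.End ℂ V) = 0 := by simp [koszul, opPart]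
  rw [zmod2_sum]
  simp only [opPart_of_isOp hS, zero_ne_one, if_true, if_false, h0, zero_mul, mul_zero, smul_zero,
    sub_zero, Finset.sum_const_zero, zero_add, koszul_of_isOp hS, distPart_field,
    ← negOne_pow_eq_ksign, proj_of_mem 𝒱 ha]
  rw [Finset.sum_eq_single p]
  · simp
  · intro q _ hq
    simp [hq, field_zero]
  · simp

/-- The sign depending on the parity of a sits on the term with S^i|0⟩ = 0, so the relation is
linear in a and needs no homogeneity. -/
theorem S_vac_field (a : V) (i : Fin N) (n : ℤ) (I : Finset (Fin N)) :
    (-1 : ℂ) ^ I.card • X.S i (X.field a n I X.vac) =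
      if i ∈ I then 0 else eps i I • X.field a n (insert i I) X.vac := by
  have : (-1 : ℂ) ^ I.card • (X.S i ∘ₗ LinearMap.applyₗ X.vac ∘ₗ X.coeff n I) =
      if i ∈ I then 0 else eps i I • (LinearMap.applyₗ X.vac ∘ₗ X.coeff n (insert i I)) := by
    refine ext_of_homogeneous (𝒱 := 𝒱) fun q v hv => ?_
    have h := LinearMap.congr_fun (X.S_comm_field hv i n I) X.vac
    simp only [LinearMap.sub_apply, LinearMap.smul_apply, Module.End.mul_apply, X.S_vac, map_zero,
      smul_zero, sub_zero] at h
    simp only [LinearMap.smul_apply, LinearMap.comp_apply, LinearMap.applyₗ_apply_apply,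
      coeff_apply, h]
    split_ifs <;> simp [coeff_apply]
  have h := LinearMap.congr_fun this a
  simp only [LinearMap.smul_apply, LinearMap.comp_apply, LinearMap.applyₗ_apply_apply,
      coeff_apply] at h
  rw [h]
  split_ifs <;> simp [coeff_apply]

theorem T_vac_field (a : V) (n : ℤ) (I : Finset (Fin N)) :
    X.T (X.field a n I X.vac) = ((n : ℂ) + 1) • X.field a (n + 1) I X.vac := by
  have h := LinearMap.congr_fun (X.tCov_field a I n) X.vac
  simpa [X.T_vac] using h

theorem superComm_homogeneous {p q : ZMod 2} {a b : V} (ha : a ∈ 𝒱 p) (hb : b ∈ 𝒱 q) :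
    superComm 𝒱 (X.field a) (X.field b) =
      prodZW 𝒱 (X.field a) (X.field b) - ksign p q • prodWZ 𝒱 (X.field b) (X.field a) := by
  have hz : ∀ p' q' : ZMod 2, (p' ≠ p ∨ q' ≠ q) →
      (prodZW 𝒱 (distPart 𝒱 p' (X.field a)) (distPart 𝒱 q' (X.field b)) -
      ksign p' q' • prodWZ 𝒱 (distPart 𝒱 q' (X.field b)) (distPart 𝒱 p' (X.field a))) = 0 := by
    intro p' q' h
    have h0 : ∀ k, koszul 𝒱 k (0 : Module.End ℂ V) = 0 := by simp [koszul, opPart]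
    rw [distPart_field, distPart_field, proj_of_mem 𝒱 ha, proj_of_mem 𝒱 hb]
    funext j J k K
    rcases h with h | h <;> simp [h, field_zero, prodZW, prodWZ, h0]
  unfold superComm
  rw [Finset.sum_eq_single p (fun p' _ h => Finset.sum_eq_zero fun q' _ => hz p' q' (Or.inl h))
    (by simp), Finset.sum_eq_single q (fun q' _ h => hz p q' (Or.inr h)) (by simp)]
  rw [distPart_field, distPart_field, proj_of_mem 𝒱 ha, proj_of_mem 𝒱 hb, if_pos rfl, if_pos rfl]

theorem superComm_eq_sum (a b : V) : superComm 𝒱 (X.field a) (X.field b) =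
    ∑ p : ZMod 2, ∑ q : ZMod 2,
      superComm 𝒱 (X.field (proj 𝒱 p a)) (X.field (proj 𝒱 q b)) := by
  refine Finset.sum_congr rfl fun p _ => Finset.sum_congr rfl fun q _ => ?_
  rw [X.superComm_homogeneous (proj_mem 𝒱 p a) (proj_mem 𝒱 q b), distPart_field, distPart_field]

/-- The supercommutator of homogeneous fields in components. -/
theorem superComm_field {p q : ZMod 2} {a b : V} (ha : a ∈ 𝒱 p) (hb : b ∈ 𝒱 q) (j : ℤ)
    (J : Finset (Fin N)) (k : ℤ) (K : Finset (Fin N)) :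
    superComm 𝒱 (X.field a) (X.field b) j J k K =
      ksign (K.card : ZMod 2) (p + (J.card : ZMod 2)) • (X.field a j J * X.field b k K -
        ksign (p + (J.card : ZMod 2)) (q + (K.card : ZMod 2)) •
          (X.field b k K * X.field a j J)) := by
  rw [X.superComm_homogeneous ha hb]
  simp only [Pi.sub_apply, Pi.smul_apply, prodZW, prodWZ, koszul_of_isOp (X.isOp_field ha j J),
    koszul_of_isOp (X.isOp_field hb k K), smul_sub, smul_mul_assoc, smul_smul]
  congr 2
  rw [← ksign_natCast]
  simp only [ksign_add_left, ksign_add_right]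
  rw [ksign_comm (K.card : ZMod 2) p, ksign_comm (K.card : ZMod 2) (J.card : ZMod 2)]
  linear_combination (-ksign p q * ksign (J.card : ZMod 2) q * ksign (J.card : ZMod 2) (K.card : ZMod 2) *
    ksign (J.card : ZMod 2) (K.card : ZMod 2)) * ksign_mul_self p (K.card : ZMod 2)

/-- The factor (z - w)^n does not mix the odd components, so locality can be read off component by
component, up to an invertible sign. -/
theorem loc_field {p q : ZMod 2} {a b : V} (ha : a ∈ 𝒱 p) (hb : b ∈ 𝒱 q)
    (J K : Finset (Fin N)) :
    Loc (ksign (p + (J.card : ZMod 2)) (q + (K.card : ZMod 2))) (fun n => X.field a n J)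
      (fun n => X.field b n K) := by
  obtain ⟨n, hn⟩ := X.locality a b
  refine ⟨n, ?_⟩
  funext j k
  have h := congrFun (congrFun (congrFun (congrFun hn j) J) k) K
  rw [mulZsubW_pow_apply] at h
  change (zSubW ^ n) (fun j k => superComm 𝒱 (X.field a) (X.field b) j J k K) j k = 0 at h
  simp only [X.superComm_field ha hb] at h
  have h2 := zSubW_pow_map (ksign (K.card : ZMod 2) (p + (J.card : ZMod 2)) •
    (LinearMap.id : Module.End ℂ V →ₗ[ℂ] Module.End ℂ V)) n
    (fun j k => X.field a j J * X.field b k K -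
        ksign (p + (J.card : ZMod 2)) (q + (K.card : ZMod 2)) •
          (X.field b k K * X.field a j J)) j k
  simp only [LinearMap.smul_apply, LinearMap.id_apply] at h2
  rw [h2] at h
  exact (smul_eq_zero.mp h).resolve_left (fun h0 => by
    have := ksign_mul_self (K.card : ZMod 2) (p + (J.card : ZMod 2))
    rw [h0] at this; simp at this)

end SUSYVertexAlgebra

namespace SUSYVertexAlgebra

variable {N : ℕ} {V : Type*} [AddCommGroup V] [Module ℂ V]
  {𝒱 : ZMod 2 → Submodule ℂ V} [DirectSum.Decomposition 𝒱] (X : SUSYVertexAlgebra N 𝒱)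

/-! ### The underlying vertex superalgebra `a ↦ Y(a, Z)|_{θ = 0}` -/

/-- The value of `Y(a, Z)` at `θ = 0`. -/
def evenField (a : V) : ℤ → Module.End ℂ V := fun n => X.field a n ∅

theorem evenField_def (a : V) (n : ℤ) : X.evenField a n = X.field a n ∅ := rfl

theorem isOp_evenField {p : ZMod 2} {a : V} (ha : a ∈ 𝒱 p) (n : ℤ) :
    IsOp 𝒱 p (X.evenField a n) := by
  have h := X.isOp_field ha n ∅
  rwa [Finset.card_empty, Nat.cast_zero, add_zero] at h

theorem isField_evenField (a : V) : IsField (X.evenField a) := X.isField_field a ∅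

theorem tCov_evenField (a : V) : TCov X.T (X.evenField a) := X.tCov_field a ∅

theorem evenField_vac_of_neg (a : V) {n : ℤ} (hn : n < 0) : X.evenField a n X.vac = 0 :=
  X.vacuum_regular a n hn ∅

theorem evenField_vac_zero (a : V) : X.evenField a 0 X.vac = a := X.vacuum_value a

theorem loc_evenField {p q : ZMod 2} {a b : V} (ha : a ∈ 𝒱 p) (hb : b ∈ 𝒱 q) :
    Loc (ksign p q) (X.evenField a) (X.evenField b) := by
  have h := X.loc_field ha hb ∅ ∅
  rwa [Finset.card_empty, Nat.cast_zero, add_zero, add_zero] at h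

/-- Fields of parity `r` that are local with respect to all `Y(c, Z)|_{θ = 0}` and
translation covariant on the vacuum. -/
structure IsLocalField (r : ZMod 2) (β : ℤ → Module.End ℂ V) : Prop where
  isOp : ∀ n, IsOp 𝒱 r (β n)
  vac_of_neg : ∀ n < 0, β n X.vac = 0
  T_vac : ∀ n, X.T (β n X.vac) = ((n : ℂ) + 1) • β (n + 1) X.vac
  loc : ∀ p, ∀ c ∈ 𝒱 p, Loc (ksign r p) β (X.evenField c)

variable {X}

/-- T determines the coefficient at n + 1 from the one at n, as n + 1 ≠ 0 for n ≥ 0. -/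
theorem vac_eq_of_T_vac {β γ : ℤ → V} (hβ : ∀ n < 0, β n = 0) (hγ : ∀ n < 0, γ n = 0)
    (hTβ : ∀ n, X.T (β n) = ((n : ℂ) + 1) • β (n + 1))
    (hTγ : ∀ n, X.T (γ n) = ((n : ℂ) + 1) • γ (n + 1)) (h0 : β 0 = γ 0) : β = γ := by
  have key : ∀ n : ℕ, β n = γ n := by
    intro n
    induction n with
    | zero => exact h0
    | succ n ih =>
      have h1 := hTβ n
      have h2 := hTγ n
      rw [ih, h2] at h1
      have hne : (((n : ℤ) : ℂ) + 1) ≠ 0 := by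
        push_cast
        exact Nat.cast_add_one_ne_zero n
      have := smul_right_injective V hne h1
      push_cast
      exact this.symm
  funext n
  rcases lt_or_ge n 0 with hn | hn
  · rw [hβ n hn, hγ n hn]
  · lift n to ℕ using hn
    exact key n

/-- Goddard's uniqueness theorem. -/
theorem IsLocalField.eq_evenField {r : ZMod 2} {β : ℤ → Module.End ℂ V}
    (h : X.IsLocalField r β) (n : ℤ) : β n = X.evenField (β 0 X.vac) n := by
  set u := β 0 X.vac with hu
  have hur : u ∈ 𝒱 r := by
    have := h.isOp 0 0 X.vac X.vac_even
    rwa [add_zero] at this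
  have hvac : ∀ j, β j X.vac = X.evenField u j X.vac := fun j =>
    congrFun (vac_eq_of_T_vac (X := X) (β := fun n => β n X.vac)
      (γ := fun n => X.evenField u n X.vac) h.vac_of_neg
      (fun n hn => X.evenField_vac_of_neg u hn) h.T_vac (fun n => X.T_vac_field u n ∅)
      (X.evenField_vac_zero u).symm) j
  refine ext_of_homogeneous (𝒱 := 𝒱) fun p c hc => ?_
  obtain ⟨m₁, h₁⟩ := h.loc p c hc
  obtain ⟨m₂, h₂⟩ := X.loc_evenField hur hc
  set m := max m₁ m₂
  have h₁' := pow_apply_eq_zero_of_le (le_max_left m₁ m₂) h₁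
  have h₂' := pow_apply_eq_zero_of_le (le_max_right m₁ m₂) h₂
  have h3 := zSubW_pow_map (LinearMap.applyₗ X.vac) m
    (fun j k => (β j * X.evenField c k - ksign r p • (X.evenField c k * β j)) -
      (X.evenField u j * X.evenField c k - ksign r p • (X.evenField c k * X.evenField u j)))
  have hsub : (zSubW ^ m)
    (fun j k => (β j * X.evenField c k - ksign r p • (X.evenField c k * β j)) -
      (X.evenField u j * X.evenField c k - ksign r p • (X.evenField c k * X.evenField u j))) = 0 := by
    have e := map_sub (zSubW ^ m)
      (fun j k => (β j * X.evenField c k - ksign r p • (X.evenField c k * β j)))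
      (fun j k => (X.evenField u j * X.evenField c k -
        ksign r p • (X.evenField c k * X.evenField u j)))
    rw [h₁', h₂', sub_zero] at e
    exact e
  have hreg := zSubW_pow_of_regular_right
    (f := fun j k => (β j - X.evenField u j) (X.evenField c k X.vac)) (fun j k hk => by
      rw [X.evenField_vac_of_neg c hk, map_zero]) m
  -- At w = 0 the factor (z - w)^m is z^m and Y(c, w)|0⟩ is c; the index n + m undoes the shift by
  -- m.
  have h4 := hreg.2 (n + m)
  -- The terms in which c acts last cancel, because both fields agree on the vacuum.
  have heq : (fun j k => (β j - X.evenField u j) (X.evenField c k X.vac)) = fun j k =>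
      (LinearMap.applyₗ X.vac : Module.End ℂ V →ₗ[ℂ] V)
      ((β j * X.evenField c k - ksign r p • (X.evenField c k * β j)) -
      (X.evenField u j * X.evenField c k - ksign r p • (X.evenField c k * X.evenField u j))) := by
    funext j k
    simp [hvac j]
  rw [heq, h3, hsub] at h4
  simp only [add_sub_cancel_right] at h4
  simp only [X.evenField_vac_zero] at h4
  simp only [Pi.zero_apply, map_zero, LinearMap.sub_apply] at h4
  exact (sub_eq_zero.mp h4.symm)

theorem isLocalField_field {p : ZMod 2} {a : V} (ha : a ∈ 𝒱 p) (I : Finset (Fin N)) :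
    X.IsLocalField (p + (I.card : ZMod 2)) fun n => X.field a n I where
  isOp n := X.isOp_field ha n I
  vac_of_neg n hn := X.vacuum_regular a n hn I
  T_vac n := X.T_vac_field a n I
  loc q c hc := by
    have h := X.loc_field ha hc I ∅
    rwa [Finset.card_empty, Nat.cast_zero, add_zero] at h

variable (X)

/-- `Y(a, Z)_{0|I} |0⟩`, the `θ^I`-coefficient of `Y(a, Z)|0⟩` at `z = 0`. -/
def vacCoeff (I : Finset (Fin N)) : V →ₗ[ℂ] V := LinearMap.applyₗ X.vac ∘ₗ X.coeff 0 I

theorem vacCoeff_apply (I : Finset (Fin N)) (a : V) :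
    X.vacCoeff I a = X.field a 0 I X.vac := rfl

theorem vacCoeff_empty (a : V) : X.vacCoeff ∅ a = a := X.vacuum_value a

theorem vacCoeff_mem {p : ZMod 2} {a : V} (ha : a ∈ 𝒱 p) (I : Finset (Fin N)) :
    X.vacCoeff I a ∈ 𝒱 (p + (I.card : ZMod 2)) := by
  have := X.isOp_field ha 0 I 0 _ X.vac_even
  rwa [add_zero] at this

/-- Goddard's theorem applied to each odd component: the superfield carries no operators beyond
those at θ = 0. -/
theorem field_eq_evenField (a : V) (n : ℤ) (I : Finset (Fin N)) :
    X.field a n I = X.evenField (X.vacCoeff I a) n := by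
  have : X.coeff n I = X.coeff n ∅ ∘ₗ X.vacCoeff I :=
    ext_of_homogeneous (𝒱 := 𝒱) fun p c hc => (isLocalField_field hc I).eq_evenField n
  exact LinearMap.congr_fun this a

theorem evenField_T (a : V) (n : ℤ) :
    X.evenField (X.T a) n = ((n : ℂ) + 1) • X.evenField a (n + 1) := by
  have : X.coeff n ∅ ∘ₗ X.T = ((n : ℂ) + 1) • X.coeff (n + 1) ∅ := by
    refine ext_of_homogeneous (𝒱 := 𝒱) fun p a ha => ?_
    have hl : X.IsLocalField p fun n : ℤ => ((n : ℂ) + 1) • X.evenField a (n + 1) :=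
      { isOp := fun n => (X.isOp_evenField ha _).smul _
        -- For n = -1 the coefficient on the vacuum need not vanish, but the factor n + 1 does.
        vac_of_neg := fun n hn => by
          rcases lt_or_eq_of_le (show n ≤ -1 by omega) with h | rfl
          · rw [LinearMap.smul_apply, X.evenField_vac_of_neg a (by omega), smul_zero]
          · simp
        T_vac := fun n => by
          have := X.T_vac_field a (n + 1) ∅
          rw [LinearMap.smul_apply, map_smul, X.evenField_def, this, LinearMap.smul_apply,
            X.evenField_def]
        loc := fun q c hc => by
          obtain ⟨m, hm⟩ := X.loc_evenField ha hc
          refine ⟨m + 1, ?_⟩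
          have hd : (fun j k => (((j : ℤ) : ℂ) + 1) • X.evenField a (j + 1) * X.evenField c k -
              ksign p q • (X.evenField c k * (((j : ℤ) : ℂ) + 1) • X.evenField a (j + 1))) =
              dzEven fun j k => X.evenField a j * X.evenField c k -
                ksign p q • (X.evenField c k * X.evenField a j) := by
            funext j k
            simp only [dzEven, LinearMap.coe_mk, AddHom.coe_mk, smul_sub, smul_mul_assoc,
              mul_smul_comm]
            rw [smul_comm (ksign p q)]
          rw [hd, zSubW_pow_dzEven, pow_succ', Module.End.mul_apply, hm]
          simp }
    have h := hl.eq_evenField n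
    have h0 : (((0 : ℤ) : ℂ) + 1) • X.evenField a (0 + 1) X.vac = X.T a := by
      have := X.T_vac_field a 0 ∅
      rw [show X.field a 0 ∅ X.vac = a from X.vacuum_value a] at this
      exact this.symm
    simp only [LinearMap.smul_apply] at h
    rw [h0] at h
    exact h.symm
  exact LinearMap.congr_fun this a

/-- The residue of a translation covariant local distribution `P(z, w)` that is built from two
fields and their supercommutator is again a local field. -/
theorem isLocalField_residue {p q : ZMod 2} {P : ℤ → ℤ → Module.End ℂ V} {s : ℕ}
    (hop : ∀ k, IsOp 𝒱 (p + q) (P (-1) k)) (hvac : ∀ k < 0, P (-1) k X.vac = 0)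
    (hT : TCov₂ X.T P) (hs : (zSubW ^ s) P = 0)
    (hloc : ∀ t, ∀ c ∈ 𝒱 t, ∃ r : ℕ, (wSubX₃ ^ r) ((zSubX₃ ^ r) fun j k l =>
      P j k * X.evenField c l - (ksign p t * ksign q t) • (X.evenField c l * P j k)) = 0) :
    X.IsLocalField (p + q) (P (-1)) where
  isOp := hop
  vac_of_neg := hvac
  T_vac k := by
    -- At j = -1 the contribution of ∂_z has the factor j + 1 = 0: a residue kills total
    -- derivatives.
    have h := LinearMap.congr_fun (congrFun (congrFun hT (-1)) k) X.vac
    simpa [dzAddDw_apply, X.T_vac] using h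
  loc t c hc := by
    obtain ⟨r, hr⟩ := hloc t c hc
    rw [ksign_add_left]
    exact Loc.of_residue hr hs

variable {X}

theorem exists_common_locality {p q t : ZMod 2} {a b c : V} (ha : a ∈ 𝒱 p) (hb : b ∈ 𝒱 q)
    (hc : c ∈ 𝒱 t) : ∃ r : ℕ,
    (zSubW ^ r) (fun j k => X.evenField a j * X.evenField c k -
      ksign p t • (X.evenField c k * X.evenField a j)) = 0 ∧
    (zSubW ^ r) (fun j k => X.evenField b j * X.evenField c k -
      ksign q t • (X.evenField c k * X.evenField b j)) = 0 := by
  obtain ⟨m₁, h₁⟩ := X.loc_evenField ha hc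
  obtain ⟨m₂, h₂⟩ := X.loc_evenField hb hc
  exact ⟨max m₁ m₂, pow_apply_eq_zero_of_le (le_max_left m₁ m₂) h₁,
    pow_apply_eq_zero_of_le (le_max_right m₁ m₂) h₂⟩

theorem tCov_comm (a b : V) (ε : ℂ) : TCov₂ X.T fun j k =>
    X.evenField a j * X.evenField b k - ε • (X.evenField b k * X.evenField a j) := by
  have := ((X.tCov_evenField a).mul (X.tCov_evenField b)).add_smul
    ((X.tCov_evenField b).mul (X.tCov_evenField a)).swap (-ε)
  simpa only [neg_smul, ← sub_eq_add_neg] using this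

/-- `(Y(a, z)_{(n)} Y(b, z)) = Y(a_{(n)} b, z)` for `n ≥ 0`. -/
theorem evenField_residue {p q : ZMod 2} {a b : V} (ha : a ∈ 𝒱 p) (hb : b ∈ 𝒱 q) (n : ℕ)
    (k : ℤ) : (zSubW ^ n) (fun j k => X.evenField a j * X.evenField b k -
      ksign p q • (X.evenField b k * X.evenField a j)) (-1) k =
    X.evenField (X.evenField a (-1 - n) b) k := by
  set P₀ : ℤ → ℤ → Module.End ℂ V := fun j k => X.evenField a j * X.evenField b k -
      ksign p q • (X.evenField b k * X.evenField a j) with hP₀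
  have hvac : ∀ j k, (zSubW ^ n) P₀ j k X.vac =
      (zSubW ^ n) (fun j k => X.evenField a j (X.evenField b k X.vac)) j k -
      (zSubW ^ n) (fun j k => ksign p q • X.evenField b k (X.evenField a j X.vac)) j k := by
    intro j k
    have h1 := zSubW_pow_map (LinearMap.applyₗ X.vac) n P₀ j k
    have h2 := congrFun (congrFun (map_sub (zSubW ^ n)
      (fun j k => X.evenField a j (X.evenField b k X.vac))
      (fun j k => ksign p q • X.evenField b k (X.evenField a j X.vac))) j) k
    exact h1.symm.trans h2
  have hr1 := zSubW_pow_of_regular_right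
    (f := fun j k => X.evenField a j (X.evenField b k X.vac))
    (fun j k hk => by rw [X.evenField_vac_of_neg b hk, map_zero]) n
  have hr2 := zSubW_pow_of_regular_left
    (f := fun j k => ksign p q • X.evenField b k (X.evenField a j X.vac))
    (fun k j hj => by rw [X.evenField_vac_of_neg a hj, map_zero, smul_zero]) n
  have hl : X.IsLocalField (p + q) ((zSubW ^ n) P₀ (-1)) := by
    obtain ⟨s, hs⟩ := X.loc_evenField ha hb
    refine X.isLocalField_residue (s := s) ?_ ?_ ((tCov_comm a b _).zSubW_pow n) ?_ ?_
    · have : ∀ (n : ℕ) j k, IsOp 𝒱 (p + q) ((zSubW ^ n) P₀ j k) := by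
        intro n
        induction n with
        | zero =>
          intro j k
          refine IsOp.sub ((X.isOp_evenField ha j).mul (X.isOp_evenField hb k)) ?_
          rw [add_comm]
          exact ((X.isOp_evenField hb k).mul (X.isOp_evenField ha j)).smul _
        | succ n ih =>
          intro j k
          rw [pow_succ', Module.End.mul_apply, zSubW_apply]
          exact (ih _ _).sub (ih _ _)
      exact this n (-1)
    · intro k hk
      rw [hvac, hr1.1 _ k hk, hr2 k (-1) (by norm_num), sub_zero]
    · rw [← Module.End.mul_apply, ← pow_add, add_comm, pow_add, Module.End.mul_apply, hs, map_zero]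
    · intro t c hc
      obtain ⟨r, h₁, h₂⟩ := exists_common_locality (X := X) ha hb hc
      refine ⟨r, ?_⟩
      have hA := triple_comm_eq_zero h₁ h₂
      have hB := triple_comm_swap_eq_zero h₁ h₂
      set ε := ksign p t * ksign q t with hε
      -- The factor (z - w)^n is pulled out of the commutator with c; what remains is a combination
      -- of the two orderings treated by `triple_comm_eq_zero` and its swap.
      have hF : (fun j k l => (zSubW ^ n) P₀ j k * X.evenField c l -
          ε • (X.evenField c l * (zSubW ^ n) P₀ j k)) = (zSubW₃ ^ n)
          ((fun j k l => X.evenField a j * X.evenField b k * X.evenField c l -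
            ε • (X.evenField c l * (X.evenField a j * X.evenField b k))) -
          ksign p q • fun j k l => X.evenField b k * X.evenField a j * X.evenField c l -
            ε • (X.evenField c l * (X.evenField b k * X.evenField a j))) := by
        funext j k l
        rw [zSubW₃_pow_apply]
        have := zSubW_pow_map (LinearMap.mulRight ℂ (X.evenField c l) -
          ε • LinearMap.mulLeft ℂ (X.evenField c l)) n P₀ j k
        refine this.symm.trans (congrFun (congrFun (congrArg _ ?_) j) k)
        funext j k
        simp only [hP₀, LinearMap.sub_apply, LinearMap.smul_apply, LinearMap.mulRight_apply,
          LinearMap.mulLeft_apply, Pi.sub_apply, Pi.smul_apply, mul_sub, sub_mul, mul_smul_comm,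
          smul_mul_assoc, smul_sub]
        rw [smul_comm ε (ksign p q)]
        abel
      rw [hF, ← Module.End.mul_apply (zSubX₃ ^ r), (commute_zSubX₃_zSubW₃.pow_pow r n).eq,
        Module.End.mul_apply, ← Module.End.mul_apply (wSubX₃ ^ r),
        (commute_wSubX₃_zSubW₃.pow_pow r n).eq, Module.End.mul_apply, map_sub, map_sub, map_smul,
        map_smul, hA, hB]
      simp
  have h := hl.eq_evenField k
  rw [h]
  congr 1
  -- On the vacuum the swapped product has no negative powers of z, hence no residue. The other
  -- product at w = 0 is z^n Y(a, z)b.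
  rw [hvac, hr1.2, hr2 0 (-1) (by norm_num), sub_zero, X.evenField_vac_zero]

/-- `:Y(a, z) Y(b, z): = Y(a_{(-1)} b, z)` -/
theorem evenField_normalOrd {p q : ZMod 2} {a b : V} (ha : a ∈ 𝒱 p) (hb : b ∈ 𝒱 q) (k : ℤ) :
    ordL (X.evenField a) (X.evenField b) (-1) k +
      ksign p q • ordL (X.evenField b) (X.evenField a) k (-1) =
    X.evenField (X.evenField a 0 b) k := by
  have fa := X.isField_evenField a
  have fb := X.isField_evenField b
  -- The supercommutator with (z - w)^{-1} inserted, expanded in the domain belonging to each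
  -- ordering. Its residue in z is the normally ordered product, and multiplication by z - w gives
  -- back the supercommutator.
  set P : ℤ → ℤ → Module.End ℂ V := fun j k => ordL (X.evenField a) (X.evenField b) j k +
      ksign p q • ordL (X.evenField b) (X.evenField a) k j with hP
  have hzP : zSubW P = fun j k => X.evenField a j * X.evenField b k -
      ksign p q • (X.evenField b k * X.evenField a j) := by
    have : P = ordL (X.evenField a) (X.evenField b) +
      ksign p q • fun j k => ordL (X.evenField b) (X.evenField a) k j := rfl
    rw [this, map_add, map_smul, zSubW_ordL _ fb,
      zSubW_swap (ordL (X.evenField b) (X.evenField a)), zSubW_ordL _ fa]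
    funext j k
    simp [sub_eq_add_neg]
  have hl : X.IsLocalField (p + q) (P (-1)) := by
    obtain ⟨s, hs⟩ := X.loc_evenField ha hb
    refine X.isLocalField_residue (s := s + 1) ?_ ?_ ?_ ?_ ?_
    · intro k t v hv
      have ho : ∀ m n, X.evenField b m (X.evenField a n v) ∈ 𝒱 (p + q + t) := fun m n => by
        rw [add_comm p q]
        exact ((X.isOp_evenField hb m).mul (X.isOp_evenField ha n)) _ _ hv
      exact Submodule.add_mem _ (ordL_mem _ fb _ _ _ fun m n =>
          ((X.isOp_evenField ha m).mul (X.isOp_evenField hb n)) _ _ hv)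
        (Submodule.smul_mem _ _ (ordL_mem _ fa _ _ _ ho))
    · intro k hk
      simp only [hP, LinearMap.add_apply, LinearMap.smul_apply]
      rw [ordL_apply_eq_zero _ fb _ _ (fun n hn => X.evenField_vac_of_neg b (by omega)),
        ordL_apply_eq_zero _ fa _ _ (fun n hn => X.evenField_vac_of_neg a (by omega))]
      simp
    · exact (TCov₂.ordL fb (X.tCov_evenField a) (X.tCov_evenField b)).add_smul
        (TCov₂.ordL fa (X.tCov_evenField b) (X.tCov_evenField a)).swap _
    · rw [pow_succ, Module.End.mul_apply, hzP, hs]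
    · intro t c hc
      obtain ⟨r, h₁, h₂⟩ := exists_common_locality (X := X) ha hb hc
      refine ⟨r, ?_⟩
      have hA := ordL_triple_eq_zero fb (triple_comm_eq_zero h₁ h₂)
      have hB := ordL_triple_eq_zero fa (triple_comm_eq_zero h₂ h₁)
      set ε := ksign p t * ksign q t with hε
      have hB' : (wSubX₃ ^ r) ((zSubX₃ ^ r) fun j k l =>
          ordL (X.evenField b) (X.evenField a) k j * X.evenField c l -
          ε • (X.evenField c l * ordL (X.evenField b) (X.evenField a) k j)) = 0 := by
        rw [← Module.End.mul_apply, (commute_zSubX₃_wSubX₃.symm.pow_pow r r).eq,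
          Module.End.mul_apply]
        funext j k l
        have := congrFun (congrFun (congrFun hB k) j) l
        rw [wSubX₃_pow_apply] at this
        rw [zSubX₃_pow_apply]
        simp only [zSubX₃_pow_apply, wSubX₃_pow_apply, mul_comm (ksign q t)] at this ⊢
        exact this
      have hF : (fun j k l => P j k * X.evenField c l - ε • (X.evenField c l * P j k)) =
          (fun j k l => ordL (X.evenField a) (X.evenField b) j k * X.evenField c l -
            ε • (X.evenField c l * ordL (X.evenField a) (X.evenField b) j k)) +
          ksign p q • fun j k l => ordL (X.evenField b) (X.evenField a) k j * X.evenField c l -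
            ε • (X.evenField c l * ordL (X.evenField b) (X.evenField a) k j) := by
        funext j k l
        simp only [hP, Pi.add_apply, Pi.smul_apply, mul_add, add_mul, mul_smul_comm,
          smul_mul_assoc, smul_sub, smul_add]
        rw [smul_comm ε (ksign p q)]
        abel
      rw [hF, map_add, map_add, map_smul, map_smul, hA, hB']
      simp
  have h := hl.eq_evenField k
  change P (-1) k = _
  rw [h]
  congr 1
  -- The telescoping identity at (0, 0) evaluates the only surviving term on the vacuum, since
  -- negative powers of w vanish there.
  have hrec := LinearMap.congr_fun (congrFun (congrFun
    (zSubW_ordL (X.evenField a) fb) 0) 0) X.vac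
  simp only [zSubW_apply, LinearMap.sub_apply, zero_sub, Module.End.mul_apply] at hrec
  rw [ordL_apply_eq_zero _ fb 0 (-1) (fun n hn => X.evenField_vac_of_neg b (by omega)), sub_zero,
    X.evenField_vac_zero] at hrec
  simp only [hP, LinearMap.add_apply, LinearMap.smul_apply]
  rw [hrec, ordL_apply_eq_zero _ fa 0 (-1) (fun n hn => X.evenField_vac_of_neg a (by omega)),
    smul_zero, add_zero]

end SUSYVertexAlgebra

/-! ### Scaling and reindexing locally finite sums -/

section LocSum

variable {V : Type*} [AddCommGroup V] [Module ℂ V]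

theorem LocFinite.smul {f : ℤ → Module.End ℂ V} (hf : LocFinite f) (c : ℂ) :
    LocFinite fun m => c • f m := fun v =>
  (hf v).subset fun m hm h0 => hm (by simp [h0])

theorem locSum_smul {f : ℤ → Module.End ℂ V} (hf : LocFinite f) (c : ℂ) :
    locSum (fun m => c • f m) = c • locSum f := by
  refine LinearMap.ext fun v => ?_
  rw [locSum_apply (hf.smul c), LinearMap.smul_apply, locSum_apply hf, smul_finsum' c (hf v)]
  rfl

theorem locSum_comp_equiv {f : ℤ → Module.End ℂ V} (hf : LocFinite f) (e : ℤ ≃ ℤ) :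
    locSum (fun m => f (e m)) = locSum f := by
  have he : LocFinite fun m => f (e m) := fun v => (hf v).preimage e.injective.injOn
  refine LinearMap.ext fun v => ?_
  rw [locSum_apply hf, locSum_apply he]
  exact finsum_comp_equiv (f := fun m => f m v) e

end LocSum

namespace SUSYVertexAlgebra

variable {N : ℕ} {V : Type*} [AddCommGroup V] [Module ℂ V]
  {𝒱 : ZMod 2 → Submodule ℂ V} [DirectSum.Decomposition 𝒱] (X : SUSYVertexAlgebra N 𝒱)

/-! ### Uniqueness of superfields, and derivatives -/

theorem S_vacCoeff (a : V) {i : Fin N} {I : Finset (Fin N)} (hi : i ∉ I) :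
    X.S i (X.vacCoeff I a) = ((-1 : ℂ) ^ I.card * eps i I) • X.vacCoeff (insert i I) a := by
  have h := X.S_vac_field a i 0 I
  rw [if_neg hi] at h
  rw [mul_smul, vacCoeff_apply, vacCoeff_apply, ← h, smul_smul, negOne_pow_sq, one_smul]

/-- A superfield with components `Y(u_K, Z)|_{θ = 0}` is `Y(u_∅, Z)` if it is `S`-covariant on the
vacuum. -/
theorem eq_field_of_components {B : FormalDist N (Module.End ℂ V)} (u : Finset (Fin N) → V)
    (hB : ∀ n K, B n K = X.evenField (u K) n)
    (hS : ∀ i K, i ∉ K → (-1 : ℂ) ^ K.card • X.S i (u K) = eps i K • u (insert i K)) :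
    B = X.field (u ∅) := by
  -- The S-relation expresses u at `insert i K` through u at K, and the vacuum coefficients obey the
  -- same recursion.
  have hu : ∀ K, u K = X.vacCoeff K (u ∅) := by
    intro K
    induction K using Finset.induction_on with
    | empty => exact (X.vacCoeff_empty _).symm
    | insert i K hi ih =>
      have h := hS i K hi
      rw [ih, X.S_vacCoeff _ hi, smul_smul, ← mul_assoc, negOne_pow_sq, one_mul] at h
      exact (smul_right_injective V (eps_ne_zero i K) h).symm
  funext n K
  rw [hB, X.field_eq_evenField, ← hu]

theorem field_T (a : V) : X.field (X.T a) = dz (X.field a) := by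
  have h := X.eq_field_of_components (B := dz (X.field a)) (fun K => X.T (X.vacCoeff K a))
    (fun n K => by
      rw [evenField_T, ← field_eq_evenField]; rfl)
    (fun i K hi => by
      rw [vacCoeff_apply, vacCoeff_apply, X.T_vac_field, X.T_vac_field]
      -- T moves the value at z = 0 to the coefficient of z, where the S-relation is applied.
      have := X.S_vac_field a i 1 K
      rw [if_neg hi] at this
      simpa using this)
  rw [h, vacCoeff_empty]

theorem field_S (i : Fin N) (a : V) : X.field (X.S i a) = dtheta i (X.field a) := by
  have h := X.eq_field_of_components (B := dtheta i (X.field a))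
    (fun K => if i ∈ K then 0 else eps i K • X.vacCoeff (insert i K) a)
    (fun n K => by
      rw [dtheta_apply]
      split_ifs
      · rw [evenField_def, field_zero]; rfl
      · rw [evenField_def, field_smul, X.field_eq_evenField]; rfl)
    (fun j K hj => by
      by_cases hi : i ∈ K
      · simp [hi]
      · by_cases hij : i = j
        · subst hij
          have h0 : X.S i (X.vacCoeff (insert i K) a) = 0 := by
            rw [vacCoeff_apply]
            have := X.S_vac_field a i 0 (insert i K)
            rw [if_pos (Finset.mem_insert_self _ _)] at this
            exact (smul_eq_zero.mp this).resolve_left (by simp)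
          simp [hi, h0]
        · have hj' : j ∉ insert i K := by simp [hj, Ne.symm hij]
          rw [if_neg hi, if_neg (by simp [hi, hij]), map_smul, X.S_vacCoeff _ hj',
            Finset.card_insert_of_notMem hi, smul_smul, smul_smul, smul_smul, Finset.insert_comm,
            eps_insert hi, eps_insert hj, eps_swap hij, pow_succ]
          congr 1
          linear_combination ((if i < j then (-1 : ℂ) else 1) * -eps i K * eps j K) *
            negOne_pow_sq K.card)
  rw [h, if_neg (by simp), eps_empty, one_smul]
  congr 1
  have := X.S_vacCoeff a (i := i) (I := ∅) (by simp)
  rw [vacCoeff_empty] at this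
  simpa using this

/-- Iterates parts 3 and 4. The vector a' stays implicit: only one coefficient of its field is used
later. -/
theorem exists_dDiv_field (m : ℕ) (K : Finset (Fin N)) (a : V) :
    ∃ a', dDiv m K (X.field a) = X.field a' := by
  have h1 : ∀ (l : List (Fin N)) (a : V), ∃ a', (l.map dtheta).prod (X.field a) = X.field a' := by
    intro l
    induction l with
    | nil => exact fun a => ⟨a, rfl⟩
    | cons i l ih =>
      intro a
      obtain ⟨a', h⟩ := ih a
      refine ⟨X.S i a', ?_⟩
      rw [List.map_cons, List.prod_cons, Module.End.mul_apply, h, field_S]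
  have h2 : ∀ (m : ℕ) (a : V), ∃ a', (dz ^ m) (X.field a) = X.field a' := by
    intro m
    induction m with
    | zero => exact fun a => ⟨a, rfl⟩
    | succ m ih =>
      intro a
      obtain ⟨a', h⟩ := ih a
      refine ⟨X.T a', ?_⟩
      rw [pow_succ', Module.End.mul_apply, h, field_T]
  obtain ⟨a₁, h₁⟩ := h1 (K.sort (· ≤ ·)) a
  obtain ⟨a₂, h₂⟩ := h2 m a₁
  refine ⟨((-1 : ℂ) ^ (K.card * (K.card + 1) / 2) / (m.factorial : ℂ)) • a₂, ?_⟩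
  rw [field_smul, ← h₂, ← h₁]
  rfl

/-! ### The normally ordered product -/

theorem mulSame_posPart_field {p : ZMod 2} {a : V} (ha : a ∈ 𝒱 p) (b : V) (n : ℤ)
    (K : Finset (Fin N)) :
    mulSame 𝒱 (posPart (X.field a)) (X.field b) n K = ∑ A ∈ K.powerset,
      (sgn A (K \ A) * ksign ((K \ A).card : ZMod 2) (p + (A.card : ZMod 2))) •
        ordL (X.evenField (X.vacCoeff A a)) (X.evenField (X.vacCoeff (K \ A) b)) (-1) n := by
  refine Finset.sum_congr rfl fun A _ => ?_
  rw [mul_smul]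
  congr 1
  rw [ordL, ← locSum_smul (locFinite_ordL _ (X.isField_evenField _) _ _)]
  congr 1
  funext m
  rw [neg_add_cancel, zero_add, ← field_eq_evenField, ← field_eq_evenField]
  by_cases h : 0 ≤ m
  · simp only [posPart, if_pos h, koszul_of_isOp (X.isOp_field ha m A), smul_mul_assoc]
  · simp [posPart, h, koszul, opPart]

/-- Complements are taken so that A always indexes the odd variables of a. The shift of m by n + 1
turns the condition n - m < 0 into the range of `ordL`. -/
theorem mulSame_negPart_field {q : ZMod 2} (a : V) {b : V} (hb : b ∈ 𝒱 q) (n : ℤ)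
    (K : Finset (Fin N)) :
    mulSame 𝒱 (X.field b) (negPart (X.field a)) n K = ∑ A ∈ K.powerset,
      (sgn (K \ A) A * ksign (A.card : ZMod 2) (q + ((K \ A).card : ZMod 2))) •
        ordL (X.evenField (X.vacCoeff (K \ A) b)) (X.evenField (X.vacCoeff A a)) n (-1) := by
  have hmem : ∀ A ∈ K.powerset, K \ (K \ A) = A := fun A hA =>
    Finset.sdiff_sdiff_eq_self (Finset.mem_powerset.mp hA)
  refine Finset.sum_bij' (fun A _ => K \ A) (fun A _ => K \ A)
    (fun A _ => by simp) (fun A _ => by simp) hmem hmem fun B hB => ?_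
  rw [hmem B hB, mul_smul]
  congr 1
  have hf := locFinite_ordL (X.evenField (X.vacCoeff B b))
    (X.isField_evenField (X.vacCoeff (K \ B) a)) n (-1)
  rw [ordL, ← locSum_smul hf, ← locSum_comp_equiv (hf.smul _) (Equiv.subRight (n + 1))]
  congr 1
  funext m
  simp only [Equiv.subRight_apply]
  rw [show n + 1 + (m - (n + 1)) = m by ring, show -1 - (m - (n + 1)) = n - m by ring,
    ← field_eq_evenField, ← field_eq_evenField]
  by_cases h : n - m < 0
  · rw [if_pos (by omega)]
    simp only [negPart, if_pos h, koszul_of_isOp (X.isOp_field hb m B), smul_mul_assoc]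
  · rw [if_neg (by omega)]
    simp [negPart, h]

theorem S_field_apply {p : ZMod 2} {a : V} (ha : a ∈ 𝒱 p) {i : Fin N} (n : ℤ)
    {A : Finset (Fin N)} (hi : i ∉ A) (v : V) :
    X.S i (X.field a n A v) = ((-1 : ℂ) ^ A.card * ksign 1 p) • X.field a n A (X.S i v) +
      ((-1 : ℂ) ^ A.card * eps i A) • X.field a n (insert i A) v := by
  have h := LinearMap.congr_fun (X.S_comm_field ha i n A) v
  rw [if_neg hi] at h
  simp only [LinearMap.sub_apply, LinearMap.smul_apply, Module.End.mul_apply] at h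
  rw [mul_smul, mul_smul, ← smul_add, ← h, add_sub_cancel, smul_smul, negOne_pow_sq, one_smul]

/-- The even theorem is applied to every way of distributing θ^K over the two factors; the
S-relation of the resulting vectors is the Leibniz rule for S^i. -/
theorem normalOrd_homogeneous {p q : ZMod 2} {a b : V} (ha : a ∈ 𝒱 p) (hb : b ∈ 𝒱 q) :
    mulSame 𝒱 (posPart (X.field a)) (X.field b) +
      ksign p q • mulSame 𝒱 (X.field b) (negPart (X.field a)) = X.field (X.field a 0 ∅ b) := by
  set u : Finset (Fin N) → V := fun K => ∑ A ∈ K.powerset,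
    (sgn A (K \ A) * ksign ((K \ A).card : ZMod 2) (p + (A.card : ZMod 2))) •
      X.field a 0 A (X.vacCoeff (K \ A) b) with hu
  have h := X.eq_field_of_components (B := mulSame 𝒱 (posPart (X.field a)) (X.field b) +
      ksign p q • mulSame 𝒱 (X.field b) (negPart (X.field a))) u
    (fun n K => by
      rw [Pi.add_apply, Pi.add_apply, Pi.smul_apply, Pi.smul_apply, X.mulSame_posPart_field ha,
        X.mulSame_negPart_field a hb, Finset.smul_sum, ← Finset.sum_add_distrib, evenField_def,
        ← coeff_apply, hu, map_sum]
      refine Finset.sum_congr rfl fun A _ => ?_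
      rw [map_smul, coeff_apply, ← evenField_def, X.field_eq_evenField a,
        ← evenField_normalOrd (X.vacCoeff_mem ha A) (X.vacCoeff_mem hb (K \ A)), smul_add,
        smul_smul, smul_smul]
      congr 2
      rw [sgn_comm (A := A) (B := K \ A), ← ksign_natCast]
      simp only [ksign_add_left, ksign_add_right]
      rw [ksign_comm ((K \ A).card : ZMod 2) p, ksign_comm ((K \ A).card : ZMod 2) (A.card : ZMod 2)]
      linear_combination (-sgn A (K \ A) * ksign (A.card : ZMod 2) ((K \ A).card : ZMod 2) *
        ksign (A.card : ZMod 2) ((K \ A).card : ZMod 2) * ksign p q * ksign (A.card : ZMod 2) q) *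
          ksign_mul_self p ((K \ A).card : ZMod 2))
    (fun i K hi => by
      rw [hu]
      simp only
      -- Subsets without i correspond to S^i acting on the factor of b, subsets with i to S^i acting
      -- on the factor of a.
      rw [Finset.sum_powerset_insert hi, map_sum, Finset.smul_sum, smul_add, Finset.smul_sum,
        Finset.smul_sum, ← Finset.sum_add_distrib]
      refine Finset.sum_congr rfl fun A hA => ?_
      have hAK := Finset.mem_powerset.mp hA
      have hiA : i ∉ A := fun h => hi (hAK h)
      have hiB : i ∉ K \ A := fun h => hi (Finset.sdiff_subset h)
      have hd : Disjoint A (K \ A) := Finset.disjoint_sdiff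
      have hK : A ∪ (K \ A) = K := Finset.union_sdiff_of_subset hAK
      have e1 : insert i K \ A = insert i (K \ A) := Finset.insert_sdiff_of_notMem _ hiA
      have e2 : insert i K \ insert i A = K \ A := by
        ext x
        simp only [Finset.mem_sdiff, Finset.mem_insert, not_or]
        constructor
        · rintro ⟨h1 | h1, h2, h3⟩
          · exact absurd h1 h2
          · exact ⟨h1, h3⟩
        · rintro ⟨h1, h2⟩
          exact ⟨Or.inr h1, fun h => hi (h ▸ h1), h2⟩
      rw [e1, e2, map_smul, X.S_field_apply ha 0 hiA, X.S_vacCoeff b hiB, map_smul,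
        sgn_insert_left hiA hiB, sgn_insert_right hiA hiB, smul_add, smul_add]
      have hcK : (-1 : ℂ) ^ K.card = (-1) ^ A.card * (-1) ^ (K \ A).card := by
        rw [← pow_add, ← Finset.card_union_of_disjoint hd, hK]
      have heK : eps i K = eps i A * eps i (K \ A) := by rw [← eps_union hd, hK]
      rw [hcK, heK, Finset.card_insert_of_notMem hiA, Finset.card_insert_of_notMem hiB]
      simp only [smul_smul, Nat.cast_succ, ksign_add_left, ksign_add_right, negOne_pow_eq_ksign]
      have s1 := ksign_mul_self (A.card : ZMod 2) 1
      have s2 := ksign_mul_self ((K \ A).card : ZMod 2) 1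
      have s3 := eps_mul_self i A
      have s4 := eps_mul_self i (K \ A)
      rw [ksign_comm 1 (A.card : ZMod 2)]
      congr 2
      · linear_combination (sgn A (K \ A) * ksign ((K \ A).card : ZMod 2) p *
          ksign ((K \ A).card : ZMod 2) (A.card : ZMod 2) * ksign 1 p * eps i (K \ A)) *
          (ksign (A.card : ZMod 2) 1 * ksign (A.card : ZMod 2) 1 * s2 -
            ksign (A.card : ZMod 2) 1 * ksign (A.card : ZMod 2) 1 * s3)
      · linear_combination (sgn A (K \ A) * ksign ((K \ A).card : ZMod 2) p *
          ksign ((K \ A).card : ZMod 2) (A.card : ZMod 2) * ksign ((K \ A).card : ZMod 2) 1 *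
          eps i A) * (s1 - s4))
  rw [h, hu]
  simp [vacCoeff_empty]

theorem bilinear_proj {U : Type*} [AddCommGroup U] [Module ℂ U] (L : V →ₗ[ℂ] V →ₗ[ℂ] U)
    (a b : V) : ∑ p : ZMod 2, ∑ q : ZMod 2, L (proj 𝒱 p a) (proj 𝒱 q b) = L a b := by
  conv_rhs => rw [← sum_proj 𝒱 a, ← sum_proj 𝒱 b, map_sum]
  simp only [LinearMap.sum_apply, map_sum]
  exact Finset.sum_comm

theorem sum_field_field (n : ℤ) (I : Finset (Fin N)) (a b : V) :
    ∑ p : ZMod 2, ∑ q : ZMod 2, X.field (X.field (proj 𝒱 p a) n I (proj 𝒱 q b)) =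
      X.field (X.field a n I b) := by
  simp only [← field_sum]
  congr 1
  exact bilinear_proj (X.coeff n I) a b

/-- `:Y(a, Z) Y(b, Z): = Y(a_{(-1|N)} b, Z)` -/
theorem normalOrd_field (a b : V) :
    normalOrd 𝒱 (X.field a) (X.field b) = X.field (X.field a 0 ∅ b) := by
  rw [← X.sum_field_field]
  refine Finset.sum_congr rfl fun p _ => Finset.sum_congr rfl fun q _ => ?_
  rw [distPart_field, distPart_field]
  exact X.normalOrd_homogeneous (proj_mem 𝒱 p a) (proj_mem 𝒱 q b)

end SUSYVertexAlgebra

/-! ### Odd products at ζ = 0 and Taylor coefficients at Z = 0 -/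

section VacuumCalculus

variable {N : ℕ} {U : Type*} [AddCommGroup U] [Module ℂ U]

theorem eps_eq_one {i : Fin N} {A : Finset (Fin N)} (h : ∀ x ∈ A, i < x) : eps i A = 1 := by
  unfold eps
  rw [Finset.filter_false_of_mem (fun x hx => not_lt.mpr (h x hx).le)]; simp

theorem eps_eq_card {i : Fin N} {A : Finset (Fin N)} (h : ∀ x ∈ A, x < i) :
    eps i A = (-1) ^ A.card := by
  unfold eps
  rw [Finset.filter_true_of_mem h]

/-- `(θ - ζ)^J f = θ^J f` at `ζ = 0`. -/
theorem mulOdd_apply_empty (J : Finset (Fin N)) (f : FormalDist₂ N U) (p : ℤ)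
    (P : Finset (Fin N)) (q : ℤ) :
    mulOdd J f p P q ∅ = if J ⊆ P then sgn J (P \ J) • f p (P \ J) q ∅ else 0 := by
  induction J using induction_min generalizing P with
  | h0 => simp [mulOdd_empty]
  | h1 i J h ih =>
    have hiJ : i ∉ J := fun hi => lt_irrefl _ (h i hi)
    rw [mulOdd_insert_min h, mulChi_apply, Pi.sub_apply, Pi.sub_apply, Pi.sub_apply, Pi.sub_apply,
      mulZeta_apply, if_neg (Finset.notMem_empty i), sub_zero, mulTheta_apply, ih]
    by_cases hi : i ∈ P
    · by_cases hJ : J ⊆ P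
      · have h1 : J ⊆ P.erase i := fun x hx =>
          Finset.mem_erase.mpr ⟨fun e => hiJ (e ▸ hx), hJ hx⟩
        have h2 : P.erase i \ J = P \ insert i J := by
          ext x; simp only [Finset.mem_sdiff, Finset.mem_erase, Finset.mem_insert, not_or]; tauto
        have h3 : i ∉ P \ insert i J := by simp
        rw [if_pos hi, if_pos h1, if_pos (Finset.insert_subset hi hJ), h2, smul_smul,
          sgn_insert_left hiJ h3]
        congr 2
        have h4 : P = (P \ insert i J) ∪ insert i J :=
          (Finset.sdiff_union_of_subset (Finset.insert_subset hi hJ)).symm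
        conv_lhs => rw [h4]
        rw [eps_union Finset.sdiff_disjoint, eps_insert_self, eps_eq_one h, mul_one]
      · have h1 : ¬ J ⊆ P.erase i := fun h' => hJ (h'.trans (Finset.erase_subset _ _))
        have h2 : ¬ insert i J ⊆ P := fun h' => hJ ((Finset.subset_insert _ _).trans h')
        rw [if_pos hi, if_neg h1, if_neg h2, smul_zero]
    · have h2 : ¬ insert i J ⊆ P := fun h' => hi (h' (Finset.mem_insert_self _ _))
      rw [if_neg hi, if_neg h2]

theorem dz_pow_zero (m : ℕ) (a : FormalDist N U) (I : Finset (Fin N)) :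
    (dz ^ m) a 0 I = (m.factorial : ℂ) • a m I := by
  induction m generalizing a with
  | zero => simp
  | succ m ih =>
    rw [pow_succ, Module.End.mul_apply, ih, Nat.factorial_succ]
    change _ • ((((m : ℤ) : ℂ) + 1) • a ((m : ℤ) + 1) I) = _
    rw [smul_smul]
    push_cast
    rw [mul_comm]

/-- Evaluating the outermost derivative moves the minimum of K into I, which stays below the rest of
K; so the induction needs this general I, not only I = ∅. -/
theorem dtheta_prod_apply (K : Finset (Fin N)) (a : FormalDist N U) (n : ℤ)
    (I : Finset (Fin N)) (hI : ∀ x ∈ I, ∀ y ∈ K, x < y) :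
    ((K.sort (· ≤ ·)).map dtheta).prod a n I =
      (-1 : ℂ) ^ (I.card * K.card + K.card.choose 2) • a n (I ∪ K) := by
  induction K using induction_min generalizing I with
  | h0 => simp
  | h1 i K h ih =>
    have hiK : i ∉ K := fun hi => lt_irrefl _ (h i hi)
    have hlt : ∀ x ∈ I, x < i := fun x hx => hI x hx i (Finset.mem_insert_self _ _)
    have hi : i ∉ I := fun hi => lt_irrefl _ (hlt i hi)
    rw [Finset.sort_insert (r := (· ≤ ·)) (fun x hx => (h x hx).le) hiK, List.map_cons,
      List.prod_cons, Module.End.mul_apply, dtheta_apply, if_neg hi, ih _ (fun x hx y hy => by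
        rcases Finset.mem_insert.mp hx with rfl | hx
        · exact h y hy
        · exact (hlt x hx).trans (h y hy)), eps_eq_card hlt, smul_smul,
      Finset.card_insert_of_notMem hi, Finset.card_insert_of_notMem hiK, ← pow_add,
      Finset.insert_union, Finset.union_insert]
    congr 2
    rw [Nat.choose_succ_succ' K.card 1, Nat.choose_one_right]
    ring

/-- With k the size of K, k(k + 1)/2 is k + binom(k, 2). The normalisation thus cancels the
reordering sign and the factorial, and leaves (-1)^k. -/
theorem dDiv_apply_zero (m : ℕ) (K : Finset (Fin N)) (a : FormalDist N U) :
    dDiv m K a 0 ∅ = (-1 : ℂ) ^ K.card • a m K := by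
  unfold dDiv
  rw [LinearMap.smul_apply, Module.End.mul_apply, Pi.smul_apply, Pi.smul_apply, dz_pow_zero,
    dtheta_prod_apply K a m ∅ (by simp), Finset.empty_union, smul_smul, smul_smul]
  congr 1
  have hf : (m.factorial : ℂ) ≠ 0 := Nat.cast_ne_zero.mpr (Nat.factorial_ne_zero m)
  have hc : K.card * (K.card + 1) / 2 = K.card + K.card.choose 2 := by
    have h1 := Nat.choose_two_right (K.card + 1)
    rw [Nat.choose_succ_succ' K.card 1, Nat.choose_one_right, Nat.add_sub_cancel, mul_comm] at h1
    exact h1.symm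
  rw [hc, Finset.card_empty, zero_mul, zero_add, div_mul_cancel₀ _ hf, pow_add, mul_assoc,
    negOne_pow_sq, mul_one]

/-- Applying a linear map to the coefficients. -/
def mapCoeff {U' : Type*} [AddCommGroup U'] [Module ℂ U']
    (L : U →ₗ[ℂ] U') : FormalDist₂ N U →ₗ[ℂ] FormalDist₂ N U' where
  toFun f := fun j J k K => L (f j J k K)
  map_add' a b := by funext j J k K; simp
  map_smul' c a := by funext j J k K; simp

theorem mapCoeff_mulOdd {U' : Type*} [AddCommGroup U'] [Module ℂ U'] (L : U →ₗ[ℂ] U') (J : Finset (Fin N)) (f : FormalDist₂ N U) :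
    mapCoeff L (mulOdd J f) = mulOdd J (mapCoeff L f) := by
  have h := map_mulOdd 1 (mapCoeff L) (fun i f => by
    rw [one_smul]
    funext p P q Q
    simp only [mapCoeff, LinearMap.coe_mk, AddHom.coe_mk, mulChi_apply, Pi.sub_apply,
      mulTheta_apply, mulZeta_apply, map_sub]
    split_ifs <;> simp) J f
  rwa [one_pow, one_smul] at h

/-- The terms `z^j w^k` of a distribution. -/
def evenCoeff (j k : ℤ) :
    Module.End ℂ (FormalDist₂ N U) where
  toFun f := fun _ J _ K => f j J k K
  map_add' _ _ := rfl
  map_smul' _ _ := rfl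

theorem evenCoeff_mulOdd (j k : ℤ)
    (J : Finset (Fin N)) (f : FormalDist₂ N U) :
    evenCoeff j k (mulOdd J f) = mulOdd J (evenCoeff j k f) := by
  have h := map_mulOdd 1 (evenCoeff j k) (fun i f => by
    rw [one_smul]
    funext p P q Q
    simp only [evenCoeff, LinearMap.coe_mk, AddHom.coe_mk, mulChi_apply, Pi.sub_apply,
      mulTheta_apply, mulZeta_apply]) J f
  rwa [one_pow, one_smul] at h

end VacuumCalculus

namespace SUSYVertexAlgebra

variable {N : ℕ} {V : Type*} [AddCommGroup V] [Module ℂ V]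
  {𝒱 : ZMod 2 → Submodule ℂ V} [DirectSum.Decomposition 𝒱] (X : SUSYVertexAlgebra N 𝒱)

/-! ### The `(j|J)`-products with `j ≥ 0` -/

/-- Left multiplication by an odd operator `S` on distributions in `Z, W`. -/
def mulOddOp (S : Module.End ℂ V) : Module.End ℂ (FormalDist₂ N V) where
  toFun f := fun j J k K => (-1 : ℂ) ^ (J.card + K.card) • S (f j J k K)
  map_add' a b := by funext j J k K; simp
  map_smul' c a := by funext j J k K; simp [smul_comm c]

theorem mulOddOp_mulChi (S : Module.End ℂ V) (i : Fin N) (f : FormalDist₂ N V) :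
    mulOddOp S (mulChi i f) = - mulChi i (mulOddOp S f) := by
  have h1 : mulOddOp S (mulTheta i f) = - mulTheta i (mulOddOp S f) := by
    funext p P q Q
    simp only [mulOddOp, LinearMap.coe_mk, AddHom.coe_mk, Pi.neg_apply, mulTheta_apply]
    split_ifs with h
    · rw [map_smul, smul_smul, smul_smul, ← neg_smul, pow_add, pow_add, card_erase_sign h]
      congr 1; ring
    · simp
  have h2 : mulOddOp S (mulZeta i f) = - mulZeta i (mulOddOp S f) := by
    funext p P q Q
    simp only [mulOddOp, LinearMap.coe_mk, AddHom.coe_mk, Pi.neg_apply, mulZeta_apply]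
    split_ifs with h
    · rw [map_smul, smul_smul, smul_smul, ← neg_smul, pow_add, pow_add, card_erase_sign h]
      congr 1; ring
    · simp
  rw [mulChi_apply, mulChi_apply, map_sub, h1, h2]
  abel

/-- The odd analogue of (∂_z + ∂_w)(z - w) = 0. -/
theorem dtheta₂_add_dzeta₂_mulChi (i j : Fin N) (f : FormalDist₂ N V) :
    dtheta₂ i (mulChi j f) + dzeta₂ i (mulChi j f) =
      - mulChi j (dtheta₂ i f + dzeta₂ i f) := by
  simp only [mulChi_apply, map_sub, map_add, dtheta₂_mulTheta, dtheta₂_mulZeta, dzeta₂_mulTheta,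
    dzeta₂_mulZeta]
  abel

/-- The `θ^J ζ^K`-coefficient of `a(Z)_{n} b(W)|0⟩` at `w = 0`, where `a` has parity `p`. -/
def vacProd (p : ZMod 2) (a b : V) (n : ℤ) : FormalDist₂ N V := fun _ J _ K =>
  ksign (K.card : ZMod 2) (p + (J.card : ZMod 2)) • X.field a n J (X.vacCoeff K b)

/-- S^i passes both fields, differentiating each in its own odd variable, and then kills the vacuum.
-/
theorem S_vacProd {p : ZMod 2} {a : V} (ha : a ∈ 𝒱 p) (b : V) (n : ℤ) (i : Fin N) :
    mulOddOp (X.S i) (X.vacProd p a b n) =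
      dtheta₂ i (X.vacProd p a b n) + dzeta₂ i (X.vacProd p a b n) := by
  funext j J k K
  simp only [mulOddOp, LinearMap.coe_mk, AddHom.coe_mk, Pi.add_apply, dtheta₂_apply, dzeta₂_apply,
    vacProd, map_smul]
  have hS := LinearMap.congr_fun (X.S_comm_field ha i n J) (X.vacCoeff K b)
  simp only [LinearMap.sub_apply, LinearMap.smul_apply, Module.End.mul_apply] at hS
  have hSv := X.S_vac_field b i 0 K
  rw [← vacCoeff_apply, ← vacCoeff_apply] at hSv
  rw [pow_add, mul_comm, mul_smul, smul_comm _ (ksign _ _), sub_eq_iff_eq_add.mp hS, smul_add,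
    smul_add]
  congr 1
  · by_cases hJ : i ∈ J
    · simp [hJ]
    · rw [if_neg hJ, if_neg hJ, LinearMap.smul_apply, smul_smul, smul_smul, smul_smul,
        Finset.card_insert_of_notMem hJ, Nat.cast_succ, ← add_assoc,
        ksign_add_right (p + (J.card : ZMod 2)) 1, ← negOne_pow_eq_ksign]
      congr 1; ring
  · have hSv' : X.S i (X.vacCoeff K b) =
        (-1 : ℂ) ^ K.card • if i ∈ K then 0 else eps i K • X.vacCoeff (insert i K) b := by
      rw [← hSv, smul_smul, negOne_pow_sq, one_smul]
    rw [hSv']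
    by_cases hK : i ∈ K
    · simp [hK]
    · simp only [if_neg hK, map_smul, smul_smul]
      rw [Finset.card_insert_of_notMem hK, Nat.cast_succ, ksign_add_left,
        ksign_add_right p _ 1, ksign_comm 1 (J.card : ZMod 2), ← negOne_pow_eq_ksign]
      congr 1
      linear_combination (ksign (K.card : ZMod 2) (p + (J.card : ZMod 2)) * ksign 1 p * eps i K) *
        (negOne_pow_sq K.card - negOne_pow_sq J.card)

theorem S_mulOdd_vacProd {p : ZMod 2} {a : V} (ha : a ∈ 𝒱 p) (b : V) (n : ℤ) (i : Fin N)
    (J : Finset (Fin N)) :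
    mulOddOp (X.S i) (mulOdd J (X.vacProd p a b n)) =
      dtheta₂ i (mulOdd J (X.vacProd p a b n)) + dzeta₂ i (mulOdd J (X.vacProd p a b n)) := by
  let E : Module.End ℂ (FormalDist₂ N V) := mulOddOp (X.S i) - (dtheta₂ i + dzeta₂ i)
  have hE := map_mulOdd (-1) E (fun j f => by
    simp only [E, LinearMap.sub_apply, LinearMap.add_apply, mulOddOp_mulChi,
      dtheta₂_add_dzeta₂_mulChi, map_sub, neg_one_smul]
    abel) J (X.vacProd p a b n)
  have h0 : E (X.vacProd p a b n) = 0 := by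
    simp only [E, LinearMap.sub_apply, LinearMap.add_apply, X.S_vacProd ha, sub_self]
  rw [h0, map_zero, smul_zero] at hE
  exact sub_eq_zero.mp hE

/-- The factor (θ - ζ)^J acts on odd indices only and commutes with the even residue, so it can be
applied to vectors instead of fields. -/
theorem resZ_homogeneous {p q : ZMod 2} {a b : V} (ha : a ∈ 𝒱 p) (hb : b ∈ 𝒱 q) (j : ℕ)
    (J : Finset (Fin N)) : resZ (mulPow j J (superComm 𝒱 (X.field a) (X.field b))) =
      sgnC J • X.field (X.prod a j J b) := by
  set g := (mulZsubW ^ j) (superComm 𝒱 (X.field a) (X.field b)) with hg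
  have hcoeff : ∀ n, evenCoeff (-1) n g = mapCoeff (X.coeff n ∅) (X.vacProd p a b (-1 - j)) := by
    intro n
    funext r P s Q
    change g (-1) P n Q = X.field (_ • _) n ∅
    rw [hg, mulZsubW_pow_apply]
    simp only [X.superComm_field ha hb]
    have h2 := zSubW_pow_map (ksign (Q.card : ZMod 2) (p + (P.card : ZMod 2)) •
      (LinearMap.id : Module.End ℂ V →ₗ[ℂ] Module.End ℂ V)) j
      (fun j k => X.field a j P * X.field b k Q -
          ksign (p + (P.card : ZMod 2)) (q + (Q.card : ZMod 2)) •
            (X.field b k Q * X.field a j P)) (-1) n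
    simp only [LinearMap.smul_apply, LinearMap.id_apply] at h2
    rw [h2, field_smul]
    simp only [X.field_eq_evenField a, X.field_eq_evenField b]
    rw [evenField_residue (X.vacCoeff_mem ha P) (X.vacCoeff_mem hb Q)]
    rfl
  set u : Finset (Fin N) → V :=
    fun K => mulOdd J (X.vacProd p a b (-1 - j)) 0 Finset.univ 0 K with hu
  have h := X.eq_field_of_components
    (B := resZ (mulPow j J (superComm 𝒱 (X.field a) (X.field b)))) u
    (fun n K => by
      change (mulZsubW ^ j) (mulOdd J _) (-1) Finset.univ n K = X.coeff n ∅ (u K)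
      rw [mulZsubW_pow_mulOdd, ← hg]
      have h1 := evenCoeff_mulOdd (-1) n J g
      rw [hcoeff, ← mapCoeff_mulOdd] at h1
      exact congrFun (congrFun (congrFun (congrFun h1 0) Finset.univ) 0) K)
    -- In the coefficient of θ^N the derivative ∂_{θ^i} contributes nothing, so S^i acts as ∂_{ζ^i}
    -- alone.
    (fun i K hi => by
      have h1 := congrFun (congrFun (congrFun (congrFun
        (X.S_mulOdd_vacProd ha b (-1 - j) i J) 0) Finset.univ) 0) K
      rw [Pi.add_apply, Pi.add_apply, Pi.add_apply, Pi.add_apply, dtheta₂_apply, dzeta₂_apply,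
        if_pos (Finset.mem_univ i), if_neg hi, zero_add] at h1
      change (-1 : ℂ) ^ (_ + _) • X.S i (u K) = _ • u (insert i K) at h1
      rw [pow_add, mul_smul, mul_smul] at h1
      exact smul_right_injective V (pow_ne_zero _ (neg_ne_zero.mpr one_ne_zero)) h1)
  rw [h, hu, ← field_smul]
  congr 1
  simp only
  rw [mulOdd_apply_empty, if_pos (Finset.subset_univ J), ← Finset.compl_eq_univ_sdiff]
  simp only [vacProd, Finset.card_empty, Nat.cast_zero, ksign_zero_left, one_smul, vacCoeff_empty]
  rfl

/-- `Res_Z (Z - W)^{j|J} [Y(a, Z), Y(b, W)] = σ(J) Y(a_{(j|J)} b, W)` for `j ≥ 0`. -/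
theorem resZ_superComm (a b : V) (j : ℕ) (J : Finset (Fin N)) :
    resZ (mulPow j J (superComm 𝒱 (X.field a) (X.field b))) =
      sgnC J • X.field (X.prod a j J b) := by
  have hres : ∀ f : ZMod 2 → ZMod 2 → FormalDist₂ N (Module.End ℂ V),
      resZ (∑ p, ∑ q, f p q) = ∑ p, ∑ q, resZ (f p q) := by
    intro f
    simp only [zmod2_sum]
    rfl
  rw [X.superComm_eq_sum]
  simp only [map_sum]
  rw [hres]
  simp only [fun p q => X.resZ_homogeneous (proj_mem 𝒱 p a) (proj_mem 𝒱 q b) j J, ← Finset.smul_sum]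
  congr 1
  exact X.sum_field_field _ _ a b

/-! ### The `(j|J)`-products -/

theorem field_prod (a b : V) (j : ℤ) (J : Finset (Fin N)) :
    X.field (X.prod a j J b) = sgnC J • fieldProd 𝒱 (X.field a) (X.field b) j J := by
  cases j with
  | ofNat j =>
    change _ = sgnC J • resZ (mulPow j J (superComm 𝒱 (X.field a) (X.field b)))
    rw [X.resZ_superComm, smul_smul, sgnC_mul_self, one_smul]
    rfl
  | negSucc m =>
    change _ = sgnC J • (sgnC Jᶜ * (-1 : ℂ) ^ (Jᶜ.card * N)) •
      normalOrd 𝒱 (dDiv m Jᶜ (X.field a)) (X.field b)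
    obtain ⟨a', ha'⟩ := X.exists_dDiv_field m Jᶜ a
    rw [ha', X.normalOrd_field, ← ha', dDiv_apply_zero, LinearMap.smul_apply, field_smul,
      smul_smul, smul_smul]
    have hN : N = J.card + Jᶜ.card := by
      rw [Finset.card_add_card_compl, Fintype.card_fin]
    -- With r, s the sizes of the complement and of J, the exponent is sr + r(s + r) + r = 2sr + r(r
    -- + 1), which is even.
    have hs : sgnC J * (sgnC Jᶜ * (-1 : ℂ) ^ (Jᶜ.card * N) * (-1) ^ Jᶜ.card) = 1 := by
      rw [mul_assoc, ← mul_assoc, sgnC_compl_mul, ← pow_add, ← pow_add]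
      refine Even.neg_one_pow ?_
      generalize Jᶜ.card = r at *
      generalize J.card = s at *
      subst hN
      rw [show s * r + (r * (s + r) + r) = 2 * (s * r) + r * (r + 1) by ring]
      exact (even_two_mul _).add (Nat.even_mul_succ_self r)
    have hj : -1 - Int.negSucc m = (m : ℤ) := by
      rw [Int.negSucc_eq]; ring
    rw [← mul_assoc] at hs
    simp only [← mul_assoc] at hs ⊢
    rw [hs, one_smul, prod, hj]

end SUSYVertexAlgebra

/-! ### Expansions of powers of `Z - W` -/

section Expansions

variable {N : ℕ}

/-- The binomial coefficient `binom(k, q)` for `q ∈ ℤ`, zero for negative `q`. -/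
def zchoose (k q : ℤ) : ℂ := if 0 ≤ q then (Ring.choose k q.toNat : ℤ) else 0

theorem zchoose_natCast (k : ℤ) (q : ℕ) : zchoose k q = (Ring.choose k q : ℤ) := by
  simp [zchoose]

theorem zchoose_of_neg (k : ℤ) {q : ℤ} (h : q < 0) : zchoose k q = 0 := by
  simp [zchoose, not_le.mpr h]

theorem zchoose_zero_right (k : ℤ) : zchoose k 0 = 1 := by
  simp [zchoose]

theorem zchoose_zero_left (q : ℤ) : zchoose 0 q = if q = 0 then 1 else 0 := by
  rcases lt_or_ge q 0 with h | h
  · rw [zchoose_of_neg _ h, if_neg h.ne]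
  · lift q to ℕ using h
    rw [zchoose_natCast, Ring.choose_zero_ite]
    simp

theorem zchoose_add_one (k q : ℤ) : zchoose (k + 1) q = zchoose k q + zchoose k (q - 1) := by
  rcases lt_trichotomy q 0 with h | rfl | h
  · rw [zchoose_of_neg _ h, zchoose_of_neg _ h, zchoose_of_neg _ (by omega), add_zero]
  · rw [zchoose_zero_right, zchoose_zero_right, zchoose_of_neg _ (by omega), add_zero]
  · obtain ⟨m, rfl⟩ : ∃ m : ℕ, q = (m + 1 : ℕ) := ⟨(q - 1).toNat, by omega⟩
    rw [show ((m + 1 : ℕ) : ℤ) - 1 = (m : ℕ) by push_cast; ring, zchoose_natCast, zchoose_natCast,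
      zchoose_natCast, Ring.choose_succ_succ]
    push_cast
    ring

theorem mul_zchoose (k q : ℤ) : ((q : ℂ) + 1) * zchoose k (q + 1) = k * zchoose (k - 1) q := by
  rcases lt_trichotomy q (-1) with h | rfl | h
  · rw [zchoose_of_neg _ (by omega), zchoose_of_neg _ (by omega), mul_zero, mul_zero]
  · rw [zchoose_of_neg _ (by omega : (-1 : ℤ) < 0)]; simp
  · lift q to ℕ using (by omega)
    have h1 := Ring.choose_smul_choose k (n := q + 1) (k := 1) (by omega)
    rw [Ring.choose_one_right, Nat.choose_one_right, Nat.add_sub_cancel] at h1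
    rw [show (q : ℤ) + 1 = (q + 1 : ℕ) by push_cast; ring, zchoose_natCast, zchoose_natCast]
    have h2 := congrArg (fun x : ℤ => (x : ℂ)) h1
    simp only [nsmul_eq_mul] at h2
    push_cast at h2 ⊢
    exact h2

theorem sub_mul_zchoose (k p : ℤ) :
    ((k : ℂ) - p) * zchoose k p = k * zchoose (k - 1) p := by
  have h1 := mul_zchoose k (p - 1)
  have h2 := zchoose_add_one (k - 1) p
  rw [sub_add_cancel] at h1 h2
  push_cast at h1
  rw [sub_mul, h2]
  rw [h2] at h1
  linear_combination -h1

variable (N) in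
/-- `(i_{z,w} - i_{w,z}) (z - w)^k` -/
def expandDiff (k : ℤ) : FormalDist₂ N ℂ := expandZW₀ N k - expandWZ₀ N k

theorem expandDiff_apply (k p : ℤ) (P : Finset (Fin N)) (q : ℤ) (Q : Finset (Fin N)) :
    expandDiff N k p P q Q = if P = ∅ ∧ Q = ∅ ∧ p + q = k then
      (-1) ^ q * (zchoose k q - zchoose k p) else 0 := by
  simp only [expandDiff, Pi.sub_apply, expandZW₀, expandWZ₀, zchoose]
  by_cases hP : P = ∅ <;> by_cases hQ : Q = ∅ <;> by_cases hk : p + q = k <;>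
    by_cases hp : 0 ≤ p <;> by_cases hq : 0 ≤ q <;> simp [hP, hQ, hk, hp, hq, mul_sub]

theorem expandZW_sub_expandWZ (k : ℤ) (J : Finset (Fin N)) :
    expandZW k J - expandWZ k J = mulOdd J (expandDiff N k) := by
  rw [expandDiff, map_sub]; rfl

theorem mulZsubW_expandDiff (k : ℤ) : mulZsubW (expandDiff N k) = expandDiff N (k + 1) := by
  funext p P q Q
  change expandDiff N k (p - 1) P q Q - expandDiff N k p P (q - 1) Q = _
  simp only [expandDiff_apply]
  by_cases h : P = ∅ ∧ Q = ∅ ∧ p + q = k + 1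
  · obtain ⟨hP, hQ, hk⟩ := h
    rw [if_pos ⟨hP, hQ, by omega⟩, if_pos ⟨hP, hQ, by omega⟩, if_pos ⟨hP, hQ, hk⟩,
      zchoose_add_one k q, zchoose_add_one k p, zpow_sub_one₀ (by norm_num)]
    ring
  · rw [if_neg h, if_neg (fun h' => h ⟨h'.1, h'.2.1, by omega⟩),
      if_neg (fun h' => h ⟨h'.1, h'.2.1, by omega⟩), sub_zero]

/-- A nonnegative power is a polynomial, so its two expansions coincide. This makes the right-hand
side of part 5 local. -/
theorem expandDiff_of_nonneg (k : ℕ) : expandDiff N k = 0 := by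
  induction k with
  | zero =>
    funext p P q Q
    rw [expandDiff_apply]
    by_cases h : P = ∅ ∧ Q = ∅ ∧ p + q = ((0 : ℕ) : ℤ)
    · have hpq : q = -p := by have := h.2.2; push_cast at this; omega
      rw [if_pos h, Nat.cast_zero, zchoose_zero_left, zchoose_zero_left, hpq]
      simp
    · rw [if_neg h]; rfl
  | succ k ih =>
    rw [Nat.cast_succ, ← mulZsubW_expandDiff, ih, map_zero]

theorem mulZsubW_pow_expandDiff (n : ℕ) (k : ℤ) :
    (mulZsubW ^ n) (expandDiff N k) = expandDiff N (k + n) := by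
  induction n with
  | zero => simp
  | succ n ih =>
    rw [pow_succ', Module.End.mul_apply, ih, mulZsubW_expandDiff]
    push_cast
    rw [add_assoc]

theorem dw₂_expandDiff (k : ℤ) : dw₂ (expandDiff N k) = (-k : ℂ) • expandDiff N (k - 1) := by
  funext p P q Q
  change ((q : ℂ) + 1) • expandDiff N k p P (q + 1) Q = (-k : ℂ) • expandDiff N (k - 1) p P q Q
  simp only [expandDiff_apply, smul_eq_mul]
  by_cases h : P = ∅ ∧ Q = ∅ ∧ p + (q + 1) = k
  · rw [if_pos h, if_pos ⟨h.1, h.2.1, by omega⟩, zpow_add_one₀ (by norm_num)]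
    have h1 := mul_zchoose k q
    have h2 := sub_mul_zchoose k p
    have h3 : (k : ℂ) - p = q + 1 := by
      rw [← h.2.2]; push_cast; ring
    rw [h3] at h2
    linear_combination (-(-1) ^ q) * h1 + (-1) ^ q * h2
  · rw [if_neg h, if_neg (fun h' => h ⟨h'.1, h'.2.1, by omega⟩), mul_zero, mul_zero]

theorem dw₂_pow_expandDiff (j : ℕ) :
    (dw₂ ^ j) (expandDiff N (-1)) = (j.factorial : ℂ) • expandDiff N (-1 - j) := by
  induction j with
  | zero => simp
  | succ j ih =>
    rw [pow_succ', Module.End.mul_apply, ih, map_smul, dw₂_expandDiff, smul_smul,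
      Nat.factorial_succ, show -1 - (j : ℤ) - 1 = -1 - ((j + 1 : ℕ) : ℤ) by push_cast; ring]
    congr 1
    push_cast
    ring

theorem dzeta₂_expandDiff (i : Fin N) (k : ℤ) : dzeta₂ i (expandDiff N k) = 0 := by
  funext p P q Q
  rw [dzeta₂_apply, expandDiff_apply]
  split_ifs with h1 h2
  · rfl
  · exact absurd h2.2.1 (Finset.insert_ne_empty _ _)
  · exact smul_zero _

/-- The even residue: only the simple pole contributes. -/
theorem evenCoeff_expandDiff (j : ℕ) : evenCoeff (-1) (-j) (expandDiff N (-1 - j)) =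
    fun _ P _ Q => if P = ∅ ∧ Q = ∅ ∧ j = 0 then 1 else 0 := by
  funext p P q Q
  change expandDiff N (-1 - j) (-1) P (-j) Q = _
  rw [expandDiff_apply, zchoose_of_neg _ (by omega : (-1 : ℤ) < 0), sub_zero]
  have h1 : (-1 : ℤ) + -(j : ℤ) = -1 - j := by ring
  cases j with
  | zero => simp [zchoose_zero_right]
  | succ j => rw [zchoose_of_neg _ (by push_cast; omega)]; simp

end Expansions

/-! ### Derivatives of the super delta function -/

section OddDerivatives

variable {N : ℕ} {U : Type*} [AddCommGroup U] [Module ℂ U]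

theorem dw₂_mulChi (i : Fin N) (f : FormalDist₂ N U) : dw₂ (mulChi i f) = mulChi i (dw₂ f) := by
  funext p P q Q
  simp only [dw₂, LinearMap.coe_mk, AddHom.coe_mk, mulChi_apply, Pi.sub_apply, mulTheta_apply,
    mulZeta_apply]
  split_ifs <;> simp [smul_sub, smul_comm ((q : ℂ) + 1)]

theorem dw₂_pow_mulOdd (n : ℕ) (A : Finset (Fin N)) (f : FormalDist₂ N U) :
    (dw₂ ^ n) (mulOdd A f) = mulOdd A ((dw₂ ^ n) f) := by
  have h : Commute (dw₂ (N := N) (U := U)) (mulOdd A) := LinearMap.ext fun f => by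
    have := map_mulOdd 1 dw₂ (fun i f => by rw [dw₂_mulChi, one_smul]) A f
    rwa [one_pow, one_smul] at this
  exact LinearMap.congr_fun (h.pow_left n) f

theorem dzeta₂_mulChi (i j : Fin N) (f : FormalDist₂ N U) :
    dzeta₂ i (mulChi j f) = (if i = j then -f else 0) - mulChi j (dzeta₂ i f) := by
  rw [mulChi_apply, mulChi_apply, map_sub, dzeta₂_mulTheta, dzeta₂_mulZeta]
  split_ifs <;> abel

theorem dzeta₂_mulOdd_of_notMem {i : Fin N} {A : Finset (Fin N)} (hi : i ∉ A)
    {f : FormalDist₂ N U} (hf : dzeta₂ i f = 0) : dzeta₂ i (mulOdd A f) = 0 := by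
  induction A using induction_min with
  | h0 => rwa [mulOdd_empty]
  | h1 j A h ih =>
    rw [Finset.mem_insert, not_or] at hi
    rw [mulOdd_insert_min h, dzeta₂_mulChi, if_neg hi.1, ih hi.2, map_zero, sub_zero]

/-- Bring θ^i - ζ^i to the front at the cost of `eps i A`; there the derivative gives -1. -/
theorem dzeta₂_mulOdd_of_mem {i : Fin N} {A : Finset (Fin N)} (hi : i ∈ A)
    {f : FormalDist₂ N U} (hf : dzeta₂ i f = 0) :
    dzeta₂ i (mulOdd A f) = (-eps i A) • mulOdd (A.erase i) f := by
  have h := mulChi_mulOdd i (A.erase i) f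
  rw [if_neg (Finset.notMem_erase i A), Finset.insert_erase hi, eps_erase_self] at h
  have h2 := congrArg (dzeta₂ i) h
  rw [dzeta₂_mulChi, if_pos rfl, dzeta₂_mulOdd_of_notMem (Finset.notMem_erase i A) hf, map_zero,
    sub_zero, map_smul] at h2
  rw [neg_smul, ← smul_neg, h2, smul_smul, eps_mul_self, one_smul]

theorem dzeta₂_prod_mulOdd (K : Finset (Fin N)) {f : FormalDist₂ N U}
    (hf : ∀ i, dzeta₂ i f = 0) :
    ((K.sort (· ≤ ·)).map dzeta₂).prod (mulOdd Finset.univ f) =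
      ((-1 : ℂ) ^ (K.card + 1).choose 2 * sgnC K) • mulOdd Kᶜ f := by
  induction K using induction_min with
  | h0 => simp [sgnC]
  | h1 i K h ih =>
    have hiK : i ∉ K := fun hi => lt_irrefl _ (h i hi)
    have hM : insert i (insert i K)ᶜ = Kᶜ := by
      rw [Finset.compl_insert, Finset.insert_erase (by simpa using hiK)]
    have hiM : i ∉ (insert i K)ᶜ := by simp
    rw [Finset.sort_insert (r := (· ≤ ·)) (fun x hx => (h x hx).le) hiK, List.map_cons,
      List.prod_cons, Module.End.mul_apply, ih, map_smul,
      dzeta₂_mulOdd_of_mem (by simpa using hiK) (hf i), smul_smul, Finset.compl_insert]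
    congr 1
    rw [Finset.card_insert_of_notMem hiK, Nat.choose_succ_succ' (K.card + 1) 1,
      Nat.choose_one_right, pow_add, pow_succ]
    unfold sgnC
    rw [sgn_insert_left hiK hiM, ← hM, sgn_insert_right hiK hiM, eps_insert_self, eps_eq_one h]
    ring

/-- The normalisation of the divided derivative cancels the factorial and the reordering sign, and
the remaining σ(J) is squared. This identifies the two sums in part 5. -/
theorem sgnC_smul_dDivW₂_superDelta (j : ℕ) (J : Finset (Fin N)) :
    sgnC J • dDivW₂ j J (superDelta N) = mulOdd Jᶜ (expandDiff N (-1 - j)) := by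
  have hδ : superDelta N = mulOdd Finset.univ (expandDiff N (-1)) :=
    expandZW_sub_expandWZ (-1) Finset.univ
  unfold dDivW₂
  rw [LinearMap.smul_apply, Module.End.mul_apply, hδ,
    dzeta₂_prod_mulOdd J fun i => dzeta₂_expandDiff i (-1), map_smul, dw₂_pow_mulOdd,
    dw₂_pow_expandDiff, map_smul, smul_smul, smul_smul, smul_smul]
  have hf : (j.factorial : ℂ) ≠ 0 := Nat.cast_ne_zero.mpr (Nat.factorial_ne_zero j)
  have hc : J.card * (J.card + 1) / 2 = (J.card + 1).choose 2 := by
    rw [Nat.choose_two_right, Nat.add_sub_cancel, mul_comm]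
  rw [hc]
  convert one_smul ℂ _ using 2
  field_simp
  linear_combination sgnC J * sgnC J * negOne_pow_sq ((J.card + 1).choose 2) + sgnC_mul_self J

end OddDerivatives

/-! ### Products of scalar distributions with distributions in `W` -/

section MulW

variable {N : ℕ} {U : Type*} [AddCommGroup U] [Module ℂ U]

/-- `f` is homogeneous of degree `d` in `z, w`. -/
def IsHomogeneousDist (d : ℤ) (f : FormalDist₂ N U) : Prop :=
  ∀ j J k K, j + k ≠ d → f j J k K = 0

theorem IsHomogeneousDist.mulOdd {d : ℤ} {f : FormalDist₂ N U} (hf : IsHomogeneousDist d f)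
    (A : Finset (Fin N)) : IsHomogeneousDist d (mulOdd A f) := by
  intro j J k K h
  have h0 : evenCoeff j k f = 0 := by
    funext _ P _ Q
    exact hf j P k Q h
  have h1 := evenCoeff_mulOdd j k A f
  rw [h0, map_zero] at h1
  exact congrFun (congrFun (congrFun (congrFun h1 0) J) 0) K

theorem isHomogeneousDist_expandDiff (k : ℤ) : IsHomogeneousDist k (expandDiff N k) := by
  intro p P q Q h
  rw [expandDiff_apply, if_neg fun h' => h h'.2.2]

/-- `f(Z, W) ↦ f(Z, W) c(W)` for `f` homogeneous of degree `d`. -/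
def mulWDeg (d : ℤ) (c : FormalDist N U) : FormalDist₂ N ℂ →ₗ[ℂ] FormalDist₂ N U where
  toFun f := fun j J k K =>
    ∑ A ∈ K.powerset, sgn A (K \ A) • f j J (d - j) A • c (k - (d - j)) (K \ A)
  map_add' f g := by
    funext j J k K
    simp only [Pi.add_apply, add_smul, smul_add, Finset.sum_add_distrib]
  map_smul' s f := by
    funext j J k K
    simp only [Pi.smul_apply, smul_eq_mul, RingHom.id_apply, Finset.smul_sum]
    exact Finset.sum_congr rfl fun A _ => by simp only [smul_smul]; congr 1; ring

theorem mulWDeg_apply (d : ℤ) (c : FormalDist N U) (f : FormalDist₂ N ℂ) (j : ℤ)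
    (J : Finset (Fin N)) (k : ℤ) (K : Finset (Fin N)) : mulWDeg d c f j J k K =
      ∑ A ∈ K.powerset, sgn A (K \ A) • f j J (d - j) A • c (k - (d - j)) (K \ A) := rfl

/-- Homogeneity leaves one term of the sum over m. The product becomes a linear map in f, which can
be commuted with z - w and θ - ζ. -/
theorem mulW_eq_mulWDeg {d : ℤ} {f : FormalDist₂ N ℂ} (hf : IsHomogeneousDist d f)
    (c : FormalDist N U) : mulW f c = mulWDeg d c f := by
  funext j J k K
  refine Finset.sum_congr rfl fun A _ => ?_
  rw [finsum_eq_single _ (d - j)]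
  intro m hm
  rw [hf j J m A (by omega), zero_smul]

theorem mulZsubW_mulWDeg (d : ℤ) (c : FormalDist N U) (f : FormalDist₂ N ℂ) :
    mulZsubW (mulWDeg d c f) = mulWDeg (d + 1) c (mulZsubW f) := by
  funext j J k K
  change mulWDeg d c f (j - 1) J k K - mulWDeg d c f j J (k - 1) K = _
  rw [mulWDeg_apply, mulWDeg_apply, mulWDeg_apply, ← Finset.sum_sub_distrib]
  refine Finset.sum_congr rfl fun A _ => ?_
  change _ = _ • (f (j - 1) J (d + 1 - j) A - f j J (d + 1 - j - 1) A) • _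
  rw [← smul_sub, sub_smul, show d - (j - 1) = d + 1 - j by ring,
    show k - 1 - (d - j) = k - (d + 1 - j) by ring, show d + 1 - j - 1 = d - j by ring]

theorem mulZsubW_pow_mulWDeg (n : ℕ) (d : ℤ) (c : FormalDist N U) (f : FormalDist₂ N ℂ) :
    (mulZsubW ^ n) (mulWDeg d c f) = mulWDeg (d + n) c ((mulZsubW ^ n) f) := by
  induction n with
  | zero => simp
  | succ n ih =>
    rw [pow_succ', Module.End.mul_apply, ih, mulZsubW_mulWDeg, pow_succ', Module.End.mul_apply]
    push_cast
    rw [add_assoc]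

theorem mulWDeg_mulChi (d : ℤ) (c : FormalDist N U) (i : Fin N) (f : FormalDist₂ N ℂ) :
    mulWDeg d c (mulChi i f) = mulChi i (mulWDeg d c f) := by
  have h1 : mulWDeg d c (mulTheta i f) = mulTheta i (mulWDeg d c f) := by
    funext j J k K
    rw [mulTheta_apply]
    simp only [mulWDeg_apply, mulTheta_apply]
    split_ifs
    · rw [Finset.smul_sum]
      exact Finset.sum_congr rfl fun A _ => by
        simp only [smul_eq_mul, smul_smul]; congr 1; ring
    · simp
  have h2 : mulWDeg d c (mulZeta i f) = mulZeta i (mulWDeg d c f) := by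
    funext j J k K
    rw [mulZeta_apply]
    simp only [mulWDeg_apply, mulZeta_apply]
    split_ifs with hi
    · obtain ⟨K', hK', rfl⟩ : ∃ K', i ∉ K' ∧ insert i K' = K :=
        ⟨K.erase i, Finset.notMem_erase i K, Finset.insert_erase hi⟩
      rw [Finset.sum_powerset_insert hK', Finset.erase_insert hK', Finset.smul_sum]
      -- After multiplication by ζ^i only the subsets A containing i contribute.
      rw [Finset.sum_eq_zero, zero_add]
      · refine Finset.sum_congr rfl fun A hA => ?_
        have hAK := Finset.mem_powerset.mp hA
        have hiA : i ∉ A := fun h => hK' (hAK h)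
        have hiB : i ∉ K' \ A := fun h => hK' (Finset.sdiff_subset h)
        have e : insert i K' \ insert i A = K' \ A := by
          ext x
          simp only [Finset.mem_sdiff, Finset.mem_insert, not_or]
          constructor
          · rintro ⟨h1 | h1, h2, h3⟩
            · exact absurd h1 h2
            · exact ⟨h1, h3⟩
          · rintro ⟨h1, h2⟩
            exact ⟨Or.inr h1, fun h => hK' (h ▸ h1), h2⟩
        rw [if_pos (Finset.mem_insert_self i A), Finset.erase_insert hiA, e,
          sgn_insert_left hiA hiB, eps_insert_self, eps_insert_self, smul_eq_mul, smul_smul,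
          smul_smul, smul_smul]
        congr 1
        have heK : eps i K' = eps i A * eps i (K' \ A) := by
          rw [← eps_union Finset.disjoint_sdiff, Finset.union_sdiff_of_subset hAK]
        rw [heK]; ring
      · intro A hA
        rw [if_neg fun h => hK' (Finset.mem_powerset.mp hA h)]
        simp
    · refine Finset.sum_eq_zero fun A hA => ?_
      rw [if_neg fun h => hi (Finset.mem_powerset.mp hA h)]
      simp
  rw [mulChi_apply, mulChi_apply, map_sub, h1, h2]

theorem mulWDeg_mulOdd (d : ℤ) (c : FormalDist N U) (A : Finset (Fin N)) (f : FormalDist₂ N ℂ) :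
    mulWDeg d c (mulOdd A f) = mulOdd A (mulWDeg d c f) := by
  have h := map_mulOdd 1 (mulWDeg d c) (fun i f => by rw [mulWDeg_mulChi, one_smul]) A f
  rwa [one_pow, one_smul] at h

/-- The product `(θ - ζ)^A` is homogeneous of degree `#A`. -/
theorem mulOdd_apply_of_card_ne (A : Finset (Fin N)) {f : FormalDist₂ N U}
    (hf : ∀ p P q Q, P.card + Q.card ≠ 0 → f p P q Q = 0) (p : ℤ) (P : Finset (Fin N)) (q : ℤ)
    (Q : Finset (Fin N)) (h : P.card + Q.card ≠ A.card) : mulOdd A f p P q Q = 0 := by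
  induction A using induction_min generalizing P Q with
  | h0 => rw [mulOdd_empty]; exact hf p P q Q h
  | h1 i A hi ih =>
    have hiA : i ∉ A := fun h => lt_irrefl _ (hi i h)
    rw [Finset.card_insert_of_notMem hiA] at h
    rw [mulOdd_insert_min hi, mulChi_apply, Pi.sub_apply, Pi.sub_apply, Pi.sub_apply, Pi.sub_apply,
      mulTheta_apply, mulZeta_apply]
    have h1 : i ∈ P → mulOdd A f p (P.erase i) q Q = 0 := fun hP =>
      ih _ _ (by have := Finset.card_erase_add_one hP; omega)
    have h2 : i ∈ Q → mulOdd A f p P q (Q.erase i) = 0 := fun hQ =>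
      ih _ _ (by have := Finset.card_erase_add_one hQ; omega)
    split_ifs with hP hQ hQ
    · rw [h1 hP, h2 hQ]; simp
    · rw [h1 hP]; simp
    · rw [h2 hQ]; simp
    · simp

/-- A count of odd degrees: θ^N already has degree N, and (θ - ζ)^L has degree at most N, so L must
be full and Q empty. -/
theorem mulOdd_expandDiff_top (L : Finset (Fin N)) (j : ℕ) (Q : Finset (Fin N)) :
    mulOdd L (expandDiff N (-1 - j)) (-1) Finset.univ (-j) Q =
      if L = Finset.univ ∧ Q = ∅ ∧ j = 0 then 1 else 0 := by
  have h := congrFun (congrFun (congrFun (congrFun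
    (evenCoeff_mulOdd (-1) (-j) L (expandDiff N (-1 - j))) 0) Finset.univ) 0) Q
  rw [evenCoeff_expandDiff] at h
  refine Eq.trans h ?_
  by_cases hL : L = Finset.univ ∧ Q = ∅
  · obtain ⟨rfl, rfl⟩ := hL
    rw [mulOdd_apply_empty]
    simp
  · rw [if_neg fun h => hL ⟨h.1, h.2.1⟩]
    refine mulOdd_apply_of_card_ne L (fun p P q Q h => ?_) _ _ _ _ fun hc => hL ?_
    · rw [if_neg]
      rintro ⟨rfl, rfl, -⟩
      simp at h
    · have h1 := Finset.card_le_univ L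
      rw [← Finset.card_univ (α := Fin N)] at h1
      have h2 : Q.card = 0 := by omega
      exact ⟨(Finset.card_eq_iff_eq_univ L).mp (by
        rw [← Finset.card_univ]; omega), Finset.card_eq_zero.mp h2⟩

/-- `Res_Z (Z - W)^{i|I} ((i_{z,w} - i_{w,z}) (Z - W)^{-1-j|N∖J}) c(W) = δ_{ij} δ_{IJ} σ(I) c(W)` -/
theorem resZ_mulPow_mulWDeg (i j : ℕ) (I J : Finset (Fin N)) (c : FormalDist N U) :
    resZ (mulPow i I (mulWDeg (-1 - j) c (mulOdd Jᶜ (expandDiff N (-1 - j))))) =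
      if i = j ∧ I = J then sgnC I • c else 0 := by
  have hstep : mulPow i I (mulWDeg (-1 - j) c (mulOdd Jᶜ (expandDiff N (-1 - j)))) =
      sgn I Jᶜ • mulWDeg (-1 - j + i) c (mulOdd (I ∪ Jᶜ) (expandDiff N (-1 - j + i))) := by
    change (mulZsubW ^ i) (mulOdd I _) = _
    rw [← mulWDeg_mulOdd, mulZsubW_pow_mulWDeg, mulOdd_mulOdd, map_smul, map_smul,
      mulZsubW_pow_mulOdd, mulZsubW_pow_expandDiff]
  rw [hstep]
  funext k K
  change sgn I Jᶜ • mulWDeg _ c _ (-1) Finset.univ k K = _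
  rw [mulWDeg_apply]
  -- For j < i the remaining power of z - w is nonnegative and its two expansions cancel. Otherwise
  -- m = j - i is left over, and only m = 0 has a residue.
  by_cases hij : j < i
  · obtain ⟨m, hm⟩ : ∃ m : ℕ, (-1 - j + i : ℤ) = m := ⟨(-1 - j + i : ℤ).toNat, by omega⟩
    rw [if_neg (by omega), hm, expandDiff_of_nonneg, map_zero]
    simp
  · obtain ⟨m, hm⟩ : ∃ m : ℕ, j = i + m := ⟨j - i, by omega⟩
    have hd : (-1 - j + i : ℤ) = -1 - m := by rw [hm]; push_cast; ring
    simp only [hd, show (-1 - (m : ℤ)) - -1 = -m by ring, mulOdd_expandDiff_top]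
    rw [Finset.sum_eq_single ∅ (fun A _ hA => by rw [if_neg fun h => hA h.2.1]; simp)
      (fun h => absurd (Finset.empty_mem_powerset K) h)]
    rw [sgn_empty_left, one_smul, Finset.sdiff_empty]
    by_cases hIJ : i = j ∧ I = J
    · obtain ⟨hij, rfl⟩ := hIJ
      have hm0 : m = 0 := by omega
      subst hm0
      rw [if_pos ⟨Finset.union_compl I, rfl, rfl⟩, if_pos ⟨hij, rfl⟩]
      simp [sgnC]
    · rw [if_neg hIJ]
      by_cases hd : Disjoint I Jᶜ
      · rw [if_neg]
        · simp
        · rintro ⟨h1, -, h3⟩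
          refine hIJ ⟨by omega, ?_⟩
          ext x
          have hx : x ∈ I ∪ Jᶜ := h1 ▸ Finset.mem_univ x
          have hd' := fun h : x ∈ I => Finset.disjoint_left.mp hd h
          simp only [Finset.mem_union, Finset.mem_compl] at hx hd'
          tauto
      · rw [sgn_eq_zero hd]; simp

/-- Decomposition theorem, uniqueness: a local distribution is determined by its residues. -/
theorem eq_zero_of_resZ {n : ℕ} {f : FormalDist₂ N U} (h : (mulZsubW ^ n) f = 0)
    (hf : ∀ m < n, ∀ I, resZ (mulPow m I f) = 0) : f = 0 := by
  refine eq_zero_of_topCoeff_mulOdd fun I => ?_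
  funext p q Q
  -- The θ^N-coefficient of (θ - ζ)^I f is an even local distribution to which the even uniqueness
  -- result applies.
  have := eq_zero_of_residues (n := n) (f := fun p q => mulOdd I f p Finset.univ q Q) (by
    funext p q
    rw [← mulZsubW_pow_apply, mulZsubW_pow_mulOdd, h, map_zero]; rfl) (fun m hm k => by
    rw [← mulZsubW_pow_apply]
    exact congrFun (congrFun (hf m hm I) k) Q)
  exact congrFun (congrFun this p) q

end MulW

/-! ### The commutator formula -/

namespace SUSYVertexAlgebra

variable {N : ℕ} {V : Type*} [AddCommGroup V] [Module ℂ V]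
  {𝒱 : ZMod 2 → Submodule ℂ V} [DirectSum.Decomposition 𝒱] (X : SUSYVertexAlgebra N 𝒱)

theorem exists_prod_eq_zero (a b : V) :
    ∃ n : ℕ, ∀ j : ℕ, n ≤ j → ∀ J : Finset (Fin N), X.prod a j J b = 0 := by
  obtain ⟨n₀, h⟩ := (X.Y a).2 b
  refine ⟨(-n₀).toNat, fun j hj J => h _ ?_ _⟩
  have := Int.self_le_toNat (-n₀)
  omega

/-- The difference of the two sides is killed by (z - w)^n, and its residues vanish because the
summands are dual to them. -/
theorem superComm_eq (a b : V) {n : ℕ}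
    (hn : (mulZsubW ^ n) (superComm 𝒱 (X.field a) (X.field b)) = 0) :
    superComm 𝒱 (X.field a) (X.field b) = ∑ j ∈ Finset.range n, ∑ J : Finset (Fin N),
      mulWDeg (-1 - (j : ℤ)) (X.field (X.prod a j J b)) (mulOdd Jᶜ (expandDiff N (-1 - j))) := by
  rw [← sub_eq_zero]
  refine eq_zero_of_resZ (n := n) ?_ fun m hm I => ?_
  · rw [map_sub, hn, zero_sub, neg_eq_zero, map_sum]
    refine Finset.sum_eq_zero fun j hj => ?_
    rw [map_sum]
    refine Finset.sum_eq_zero fun J _ => ?_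
    have hjn := Finset.mem_range.mp hj
    -- As j < n, the exponent after multiplication by (z - w)^n is nonnegative, so the term
    -- vanishes.
    obtain ⟨r, hr⟩ : ∃ r : ℕ, (-1 - j + n : ℤ) = r := ⟨(-1 - j + n : ℤ).toNat, by omega⟩
    rw [mulZsubW_pow_mulWDeg, mulZsubW_pow_mulOdd, mulZsubW_pow_expandDiff, hr,
      expandDiff_of_nonneg, map_zero, map_zero]
  · have hsub : ∀ f g : FormalDist₂ N (Module.End ℂ V), resZ (f - g) = resZ f - resZ g :=
      fun f g => rfl
    have hsum : ∀ {ι : Type} (s : Finset ι) (f : ι → FormalDist₂ N (Module.End ℂ V)),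
        resZ (∑ i ∈ s, f i) = ∑ i ∈ s, resZ (f i) := by
      intro ι s f
      funext k K
      simp [resZ, Finset.sum_apply]
    rw [map_sub, hsub, X.resZ_superComm, map_sum, hsum, sub_eq_zero, eq_comm]
    rw [Finset.sum_eq_single m]
    · rw [map_sum, hsum, Finset.sum_eq_single I]
      · rw [resZ_mulPow_mulWDeg, if_pos ⟨rfl, rfl⟩]
      · intro J _ hJ
        rw [resZ_mulPow_mulWDeg, if_neg fun h => hJ h.2.symm]
      · simp
    · intro j _ hj
      rw [map_sum, hsum]
      refine Finset.sum_eq_zero fun J _ => ?_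
      rw [resZ_mulPow_mulWDeg, if_neg fun h => hj h.1.symm]
    · intro h
      exact absurd (Finset.mem_range.mpr hm) h

end SUSYVertexAlgebra

end SUSYW
end

theorem mainTheorem3 (N : ℕ) {V : Type*} [AddCommGroup V] [Module ℂ V]
    (𝒱 : ZMod 2 → Submodule ℂ V) [DirectSum.Decomposition 𝒱] (X : SUSYVertexAlgebra N 𝒱) :
    (∀ (a b : V) (j : ℤ) (J : Finset (Fin N)),
      X.field (X.prod a j J b) = sgnC J • fieldProd 𝒱 (X.field a) (X.field b) j J) ∧
    (∀ a b : V,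
      X.field (X.prod a (-1) Finset.univ b) = normalOrd 𝒱 (X.field a) (X.field b)) ∧
    (∀ a : V, X.field (X.T a) = dz (X.field a)) ∧
    (∀ (i : Fin N) (a : V), X.field (X.S i a) = dtheta i (X.field a)) ∧
    (∀ a b : V, ∃ n₀ : ℕ,
      (∀ j : ℕ, n₀ ≤ j → ∀ J : Finset (Fin N), X.prod a j J b = 0) ∧
      superComm 𝒱 (X.field a) (X.field b) =
        ∑ j ∈ Finset.range n₀, ∑ J : Finset (Fin N),
          sgnC J • mulW (dDivW₂ j J (superDelta N)) (X.field (X.prod a j J b)) ∧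
      superComm 𝒱 (X.field a) (X.field b) =
        ∑ j ∈ Finset.range n₀, ∑ J : Finset (Fin N),
          mulW (expandZW (-1 - (j : ℤ)) Jᶜ - expandWZ (-1 - (j : ℤ)) Jᶜ)
            (X.field (X.prod a j J b))) := by
  refine ⟨X.field_prod, fun a b => ?_, X.field_T, X.field_S, fun a b => ?_⟩
  · rw [X.normalOrd_field]
    simp [SUSYVertexAlgebra.prod]
  · obtain ⟨n₁, h₁⟩ := X.exists_prod_eq_zero a b
    obtain ⟨n₂, h₂⟩ := X.locality a b
    -- One bound serves both purposes: n₁ makes the later products vanish, n₂ is the order of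
    -- locality.
    have hc := X.superComm_eq a b (pow_apply_eq_zero_of_le (le_max_right n₁ n₂) h₂)
    refine ⟨max n₁ n₂, fun j hj J => h₁ j (le_trans (le_max_left _ _) hj) J, ?_, ?_⟩
    · rw [hc]
      refine Finset.sum_congr rfl fun j _ => Finset.sum_congr rfl fun J _ => ?_
      have hhom : IsHomogeneousDist (-1 - (j : ℤ)) (dDivW₂ j J (superDelta N)) := by
        have h := sgnC_smul_dDivW₂_superDelta j J
        have h' : dDivW₂ j J (superDelta N) = sgnC J • mulOdd Jᶜ (expandDiff N (-1 - j)) := by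
          rw [← h, smul_smul, sgnC_mul_self, one_smul]
        intro p P q Q hpq
        rw [h', Pi.smul_apply, Pi.smul_apply, Pi.smul_apply, Pi.smul_apply,
          ((isHomogeneousDist_expandDiff _).mulOdd Jᶜ) p P q Q hpq, smul_zero]
      rw [mulW_eq_mulWDeg hhom, ← map_smul, sgnC_smul_dDivW₂_superDelta]
    · rw [hc]
      refine Finset.sum_congr rfl fun j _ => Finset.sum_congr rfl fun J _ => ?_
      rw [expandZW_sub_expandWZ,
        mulW_eq_mulWDeg ((isHomogeneousDist_expandDiff _).mulOdd Jᶜ)]
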